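/- Let $Q=(Q_0,Q_1)$ be a finite quiver (loops and multiple arrows allowed), with tail and head maps $b\mapsto tb$, $b\mapsto hb$, and let $\overline Q$ be the doubled quiver, with arrows $Q_1\sqcup Q_1'$ where $Q_1'$ consists of the opposites of the arrows in $Q_1$. Put $t_e=t$ for $e\in Q_1$ and $t_e=q$ for $e\in Q_1'$. Let $\Lambda^Q=\bigotimes_{j\in Q_0}\Lambda^{(j)}$ be the tensor product over $\mathbb Z[q^{\pm1},t^{\pm1}]$ of copies of the ring of symmetric functions, in alphabets $X^{(j)}$, with basis the tensor Schur functions $s_{\lambda^\bullet}[X^\bullet]=\prod_j s_{\lambda^{(j)}}[X^{(j)}]$ indexed by $Q_0$-tuples of partitions. Let $f^\perp$ be the adjoint of multiplication by $f$ for the Hall scalar product, and let $\Omega=\sum_{n\ge0}h_n$ (in plethystic notation, so $\Omega[Y+Z]=\Omega[Y]\Omega[Z]$ and $\Omega[-Y]=1/\Omega[Y]$). Fix $i\in Q_0$, $a\in\mathbb Z_{>0}$ and $U=(u_1,\dots,u_a)$, and write $R(U)=\prod_{1\le k<l\le a}(1-u_l/u_k)$, $U^*=\sum_k u_k^{-1}$.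 The operators $\overline H_\kappa^{(i,a)}$ on $\Lambda^Q$, $\kappa\in\mathbb Z^a$, are defined by $$\sum_{\kappa\in\mathbb Z^a}u^\kappa\,\overline H_\kappa^{(i,a)}=R(U)\,\Omega[UX^{(i)}]\,\Omega[-U^*X^{(i)}(1+qt)]^\perp\prod_{e\in Q_1\sqcup Q_1',\ te=i}\Omega[t_e\,U^*X^{(he)}]^\perp .$$ For dimension vectors $\alpha^\bullet,\beta^\bullet\in\mathbb Z_{\ge0}^{Q_0}$ and Laurent polynomials $f(u)$, $g(v)$ in variables $u_k^{(j)}$ ($1\le k\le\alpha^{(j)}$) and $v_\ell^{(j)}$ ($1\le\ell\le\beta^{(j)}$), symmetric at each vertex, let $$f\,\overline\star\,g=D_{w_0^\bullet}\!\left(f(u)\,g(v)\,\frac{\prod_{j\in Q_0}\prod_{k,\ell}\bigl(1-qt\,u_k^{(j)}/v_\ell^{(j)}\bigr)}{\prod_{e\in Q_1\sqcup Q_1'}\prod_{k,\ell}\bigl(1-t_e\,u_k^{(te)}/v_\ell^{(he)}\bigr)}\right),$$ where the denominators are expanded as geometric series in $q,t$. Here $D_{w_0^\bullet}(F)=J^\bullet(z^{\rho^\bullet})^{-1}J^\bullet(z^{\rho^\bullet}F)$,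 where $z^{(j)}$ is the list of the variables $u^{(j)}$ followed by $v^{(j)}$, $J^\bullet=\sum_w(-1)^w w$ is the antisymmetrizer over $\prod_jS_{\alpha^{(j)}+\beta^{(j)}}$, and $\rho^{(j)}=(\alpha^{(j)}+\beta^{(j)}-1,\dots,1,0)$. The result is a Laurent series in $q,t$ whose coefficients are Laurent polynomials in $z$, symmetric at each vertex. It has a unique expansion $\sum_{\lambda^\bullet}C_{\lambda^\bullet}s_{\lambda^\bullet}[U+V]$ over dominant weights $\lambda^\bullet$, with $C_{\lambda^\bullet}\in\mathbb Z((q,t))$ and only finitely many $\lambda^\bullet$ contributing to each monomial in $q,t$. (Schur polynomials of dominant weights are Laurent polynomials.) Now let $\alpha^{(i)}=a$ and $\alpha^{(j)}=0$ for $j\ne i$, let $\beta^\bullet$ be any dimension vector, let $\mu\in\mathbb Z^a$ be weakly decreasing, and let $\xi^\bullet$ be a $Q_0$-tuple of partitions such that $\xi^{(j)}$ has at most $\beta^{(j)}$ rows for each $j$. **Proposition 5.12.** For every $Q_0$-tuple of partitions $\lambda^\bullet$ such that $\lambda^{(j)}$ has at most $\alpha^{(j)}+\beta^{(j)}$ rows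 for each $j$, the coefficient of $s_{\lambda^\bullet}[X^\bullet]$ in the Schur expansion of $\overline H_\mu^{(i,a)}\cdot s_{\xi^\bullet}[X^\bullet]$ is equal, in $\mathbb Z((q,t))$, to the coefficient of $s_{\lambda^\bullet}[U+V]$ in the Schur expansion of the shuffle product $s_\mu[U]\,\overline\star\,s_{\xi^\bullet}[V]$. Moreover, the coefficient of $s_{\lambda^\bullet}[X^\bullet]$ in $\overline H_\mu^{(i,a)}\cdot s_{\xi^\bullet}[X^\bullet]$ is zero for every other $Q_0$-tuple of partitions $\lambda^\bullet$. -/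

import Mathlib

universe v u

namespace QuiverCurrents

noncomputable section

/-! ### Coefficient rings -/

/-- `ℤ[q^{±1}, t^{±1}]`; the exponent `(m, n)` stands for `q ^ m * t ^ n`. -/
abbrev LaurentQT : Type := AddMonoidAlgebra ℤ (ℤ × ℤ)

/-- Formal Laurent series in `q, t` with coefficients in `A`. A subset of `ℤ × ℤ` is partially
well ordered for the product order iff it lies in some `(m, n) + ℕ × ℕ`, so this is
`A[[q, t]][q⁻¹, t⁻¹]`. -/
abbrev SeriesQT (A : Type*) [Zero A] : Type _ := HahnSeries (ℤ × ℤ) A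

/-- The inclusion `ℤ[q^{±1}, t^{±1}] ⊆ ℤ((q, t))`. -/
def LaurentQT.toSeries (p : LaurentQT) : SeriesQT ℤ := HahnSeries.ofFinsupp p.coeff

/-! ### The doubled quiver -/

section Doubled

variable {Q₀ : Type u} [Quiver.{v} Q₀]

/-- Arrows `i ⟶ j` of the doubled quiver: the arrows `i ⟶ j` of the given quiver, and the
opposites of its arrows `j ⟶ i`. -/
abbrev DoubledHom (i j : Q₀) : Type v :=
  (Quiver.Symmetrify.of.obj i : Quiver.Symmetrify Q₀) ⟶
    (Quiver.Symmetrify.of.obj j : Quiver.Symmetrify Q₀)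

instance (i j : Q₀) [Fintype (i ⟶ j)] [Fintype (j ⟶ i)] : Fintype (DoubledHom i j) :=
  inferInstanceAs (Fintype ((i ⟶ j) ⊕ (j ⟶ i)))

/-- Exponent of the arrow variable: it is `t` for an original arrow and `q` for an opposite. -/
def arrowExp {i j : Q₀} (e : DoubledHom i j) : ℤ × ℤ :=
  Sum.elim (fun _ : i ⟶ j => ((0, 1) : ℤ × ℤ)) (fun _ : j ⟶ i => (1, 0)) e

end Doubled

/-! ### Quiver symmetric functions

`Λ^Q` is the tensor product, over `ℤ[q^{±1}, t^{±1}]`, of one copy of the ring of symmetric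
functions `Λ = ℤ[q^{±1}, t^{±1}][h₁, h₂, …]` for each vertex. -/

/-- `Λ^Q`, presented as the polynomial ring in the complete homogeneous symmetric functions:
the variable `(i, n)` is `h_{n+1}[X^{(i)}]`. -/
abbrev QSym (Q₀ : Type u) : Type u := MvPolynomial (Q₀ × ℕ) LaurentQT

section SymmetricFunctions

variable {Q₀ : Type u}

/-- `h_n[X^{(i)}]` for any integer `n`; `h_0 = 1`, and `h_n = 0` for negative `n`. -/
def hfun (i : Q₀) : ℤ → QSym Q₀
  | Int.ofNat 0 => 1
  | Int.ofNat (n + 1) => MvPolynomial.X (i, n)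
  | Int.negSucc _ => 0

open Classical in
/-- The sum of all monomials of degree `n` in the variables `x_0^{(i)}, x_1^{(i)}, …`. -/
def hSeries (i : Q₀) (n : ℕ) : MvPowerSeries (Q₀ × ℕ) LaurentQT :=
  fun m => if (∀ p ∈ m.support, p.1 = i) ∧ m.degree = n then 1 else 0

/-- A quiver symmetric function written out as a formal power series in the variables
`x_k^{(i)}`, for `i` a vertex and `k : ℕ`. -/
def expand : QSym Q₀ →ₐ[LaurentQT] MvPowerSeries (Q₀ × ℕ) LaurentQT :=
  MvPolynomial.aeval fun p => hSeries p.1 (p.2 + 1)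

variable [DecidableEq Q₀]

/-- The multiset of the parts at vertex `i` of the tuple of partitions `λ^•` for which the
monomial in the `h_n^{(i)}` with exponent vector `d` equals `h_{λ^•}`. -/
def partsAt (d : Q₀ × ℕ →₀ ℕ) (i : Q₀) : Multiset ℕ :=
  ∑ p ∈ d.support with p.1 = i, Multiset.replicate (d p) (p.2 + 1)

variable [Fintype Q₀]

/-- The exponent vector of the monomial `x^{λ^•} = ∏_i ∏_k (x_k^{(i)}) ^ λ^{(i)}_k`, with `λ^•`
as in `partsAt`. -/
def partitionExp (d : Q₀ × ℕ →₀ ℕ) : Q₀ × ℕ →₀ ℕ :=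
  ∑ i, (((partsAt d i).sort (· ≥ ·)).toFinsupp).mapDomain (Prod.mk i)

/-- The Hall scalar product: the bilinear form for which the `h_{λ^•}` and the monomial symmetric
functions `m_{λ^•}` are dual bases, that is, for which `⟨f, h_{λ^•}⟩` is the coefficient of
`x^{λ^•}` in `f`. -/
def hall (f g : QSym Q₀) : LaurentQT :=
  ∑ d ∈ g.support, g.coeff d * MvPowerSeries.coeff (partitionExp d) (expand f)

open Classical in
/-- `f^⊥`, the adjoint with respect to the Hall scalar product of multiplication by `f`. -/
def perp (f : QSym Q₀) : QSym Q₀ →ₗ[LaurentQT] QSym Q₀ :=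
  if h : ∃ A : QSym Q₀ →ₗ[LaurentQT] QSym Q₀, ∀ g k, hall (A g) k = hall g (f * k)
  then h.choose else 0

/-- The tensor Schur function `s_{λ^•}[X^•] = ∏_i s_{λ^{(i)}}[X^{(i)}]`, each factor being given
by the Jacobi-Trudi determinant `det (h_{λ_r - r + s})`. -/
def schurFun (lam : Q₀ → YoungDiagram) : QSym Q₀ :=
  ∏ i, Matrix.det (Matrix.of fun r s : Fin ((lam i).colLen 0) =>
    hfun i (((lam i).rowLen r : ℤ) - (r : ℕ) + (s : ℕ)))

/-- `c` gives the coefficients of `f` in the basis of tensor Schur functions. -/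
def IsSchurFunExpansion (f : QSym Q₀) (c : (Q₀ → YoungDiagram) →₀ LaurentQT) : Prop :=
  f = c.sum fun lam r => r • schurFun lam

/-! ### The `(q, t)`-quiver currents -/

/-- `Ω[z U^* X^{(j)}] = ∏_k ∑_n (z u_k⁻¹) ^ n h_n[X^{(j)}]` for `z = q ^ m t ^ n`, `e = (m, n)`, as
a power series in the variables `u_0⁻¹, …, u_{a-1}⁻¹`. -/
def omegaDual (a : ℕ) (e : ℤ × ℤ) (j : Q₀) : MvPowerSeries (Fin a) (QSym Q₀) :=
  fun δ => ∏ k, MvPolynomial.C (AddMonoidAlgebra.single e (1 : ℤ)) ^ δ k * hfun j (δ k : ℤ)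

variable [Quiver.{v} Q₀] [∀ i j : Q₀, Fintype (i ⟶ j)]

/-- The series `Ω[-U^* X^{(i)} (1 + q t)] ∏_e Ω[t_e U^* X^{(he)}]` in the `u_k⁻¹`, where `e` runs
over the arrows of the doubled quiver with tail `i` and `t_e` is `t` or `q`. Here
`Ω[-Y] = 1 / Ω[Y]` and `Ω[Y + Z] = Ω[Y] Ω[Z]`. -/
def skewSeries (i : Q₀) (a : ℕ) : MvPowerSeries (Fin a) (QSym Q₀) :=
  MvPowerSeries.invOfUnit (omegaDual a (0, 0) i * omegaDual a (1, 1) i) 1 *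
    ∏ j, ∏ e : DoubledHom i j, omegaDual a (arrowExp e) j

/-- `R(U) = ∏_{k < l} (1 - u_l / u_k)`. -/
def rFactor (a : ℕ) : AddMonoidAlgebra ℤ (Fin a → ℤ) :=
  ∏ k : Fin a, ∏ l ∈ Finset.Ioi k, (1 - AddMonoidAlgebra.single (Pi.single l 1 - Pi.single k 1) 1)

/-- The operator `H̄_β^{(i,a)}`: the coefficient of `u ^ β` in
`R(U) Ω[U X^{(i)}] Ω[-U^* X^{(i)} (1 + q t)]^⊥ ∏_e Ω[t_e U^* X^{(he)}]^⊥`,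
applied to `g`. The monomial `u ^ β` is composed of `u ^ κ` from `R(U)`, `u ^ (β - κ + δ)` from
`Ω[U X^{(i)}]` and `u ^ (-δ)` from the skewing operators; only finitely many `δ` contribute,
because skewing lowers the degree of `g` by `∑ k, δ k`. -/
def current (i : Q₀) (a : ℕ) (β : Fin a → ℤ) (g : QSym Q₀) : QSym Q₀ :=
  ∑ κ ∈ (rFactor a).coeff.support, (rFactor a).coeff κ •
    ∑ᶠ δ : Fin a →₀ ℕ, (∏ k, hfun i (β k - κ k + (δ k : ℤ))) *
      perp (MvPowerSeries.coeff δ (skewSeries i a)) g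

end SymmetricFunctions

/-! ### Characters, symmetrizers and the shuffle product -/

section Shuffle

variable {Q₀ : Type u}

/-- Weights of the maximal torus of `∏_j GL_{ν j}`. -/
abbrev Weight (ν : Q₀ → ℕ) : Type u := (j : Q₀) → Fin (ν j) → ℤ

/-- Laurent polynomials in the variables `x_k^{(j)}`, for `j` a vertex and `k : Fin (ν j)`. -/
abbrev TorusRing (ν : Q₀ → ℕ) : Type u := AddMonoidAlgebra ℤ (Weight ν)

/-- Laurent series in `q, t` whose coefficients are Laurent polynomials in the `x_k^{(j)}`. -/
abbrev TorusSeries (ν : Q₀ → ℕ) : Type u := SeriesQT (TorusRing ν)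

/-- The action of `∏_j S_{ν j}` on weights. -/
def permWeight {ν : Q₀ → ℕ} (w : (j : Q₀) → Equiv.Perm (Fin (ν j))) : Weight ν →+ Weight ν where
  toFun κ := fun j k => κ j ((w j)⁻¹ k)
  map_zero' := rfl
  map_add' _ _ := rfl

/-- The staircase weight `ρ_n = (n - 1, …, 1, 0)` at every vertex. -/
def rho (ν : Q₀ → ℕ) : Weight ν := fun j k => (ν j : ℤ) - 1 - (k : ℕ)

/-- The dominant weights of `∏_j GL_{ν j}`. -/
abbrev DominantWeight (ν : Q₀ → ℕ) : Type u := {κ : Weight ν // ∀ j, Antitone (κ j)}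

/-- A tuple of partitions as a dominant weight. (Rows beyond the first `ν j` are dropped, so this
is meant for tuples in which `λ^{(j)}` has at most `ν j` rows.) -/
def youngWeight (ν : Q₀ → ℕ) (lam : Q₀ → YoungDiagram) : DominantWeight ν :=
  ⟨fun j k => ((lam j).rowLen k : ℤ), fun j k l h => by
    have h' : (k : ℕ) ≤ l := h
    simpa using (lam j).rowLen_anti k l h'⟩

open Classical in
/-- The exact quotient `b / a` when `a` divides `b`. -/
def exactQuot {A : Type*} [CommRing A] (b a : A) : A := if h : a ∣ b then h.choose else 0

variable [Fintype Q₀] [DecidableEq Q₀]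

/-- The antisymmetrizer `J^• = ∑_w (-1)^w w` over `∏_j S_{ν j}`. -/
def antisymm (ν : Q₀ → ℕ) : TorusRing ν →+ TorusRing ν :=
  ∑ w : (j : Q₀) → Equiv.Perm (Fin (ν j)), (∏ j, (Equiv.Perm.sign (w j) : ℤ)) •
    (AddMonoidAlgebra.mapDomainRingHom ℤ (permWeight w)).toAddMonoidHom

/-- The Demazure symmetrizer `f ↦ J^•(x^ρ)⁻¹ J^•(x^ρ f)`, coefficientwise in `q, t`. -/
def demazure (ν : Q₀ → ℕ) (f : TorusSeries ν) : TorusSeries ν :=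
  exactQuot ((HahnSeries.C (AddMonoidAlgebra.single (rho ν) (1 : ℤ)) * f).map (antisymm ν))
    (HahnSeries.C (antisymm ν (AddMonoidAlgebra.single (rho ν) 1)))

/-- The Schur (Laurent) polynomial `s_{λ^•} = J^•(x^{λ + ρ}) / J^•(x^ρ)`, the product over the
vertices `j` of the Schur polynomials `s_{λ^{(j)}}(x^{(j)})`. -/
def schurPoly {ν : Q₀ → ℕ} (lam : DominantWeight ν) : TorusRing ν :=
  exactQuot (antisymm ν (AddMonoidAlgebra.single (lam.1 + rho ν) 1))
    (antisymm ν (AddMonoidAlgebra.single (rho ν) 1))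

/-- `c` gives the coefficients in the (in general infinite) expansion of `f` into Schur Laurent
polynomials; for each `m n`, only finitely many of them contribute to the coefficient of
`q ^ m * t ^ n`. -/
def IsSchurPolyExpansion {ν : Q₀ → ℕ} (f : TorusSeries ν) (c : DominantWeight ν → SeriesQT ℤ) :
    Prop :=
  ∀ d : ℤ × ℤ, (Function.support fun lam => (c lam).coeff d).Finite ∧
    f.coeff d = ∑ᶠ lam, (c lam).coeff d • schurPoly lam

/-- The weights of the variables `U`, as weights for the variables `U + V`. At each vertex the
variables of `U` precede those of `V`. -/
def inclU (α β : Q₀ → ℕ) : Weight α →+ Weight (α + β) where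
  toFun κ := fun j => Fin.append (κ j) (0 : Fin (β j) → ℤ)
  map_zero' := by
    funext j k
    refine Fin.addCases (fun k => ?_) (fun k => ?_) k <;> simp
  map_add' κ κ' := by
    funext j k
    refine Fin.addCases (fun k => ?_) (fun k => ?_) k <;> simp

/-- The weights of the variables `V`, as weights for the variables `U + V`. -/
def inclV (α β : Q₀ → ℕ) : Weight β →+ Weight (α + β) where
  toFun κ := fun j => Fin.append (0 : Fin (α j) → ℤ) (κ j)
  map_zero' := by
    funext j k
    refine Fin.addCases (fun k => ?_) (fun k => ?_) k <;> simp
  map_add' κ κ' := by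
    funext j k
    refine Fin.addCases (fun k => ?_) (fun k => ?_) k <;> simp

/-- The weight of `u_k^{(i)} / v_l^{(j)}`. -/
def ratio (α β : Q₀ → ℕ) (i j : Q₀) (k : Fin (α i)) (l : Fin (β j)) : Weight (α + β) :=
  inclU α β (Pi.single i (Pi.single k 1)) - inclV α β (Pi.single j (Pi.single l 1))

/-- The factor `1 - z u_k^{(i)} / v_l^{(j)}` for `z = q ^ m t ^ n`, `e = (m, n)`. -/
def shuffleFactor (α β : Q₀ → ℕ) (e : ℤ × ℤ) (i j : Q₀) (k : Fin (α i)) (l : Fin (β j)) :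
    TorusSeries (α + β) :=
  1 - HahnSeries.single e (AddMonoidAlgebra.single (ratio α β i j k l) 1)

variable [Quiver.{v} Q₀] [∀ i j : Q₀, Fintype (i ⟶ j)]

/-- `∏ (1 - q t u_k^{(i)} / v_l^{(i)}) / ∏ (1 - t_e u_k^{(te)} / v_l^{(he)})`, with `i` running
over the vertices and `e` over the arrows of the doubled quiver; the denominators are inverted as
(geometric) series in `q` and `t`. -/
def shuffleKernel (α β : Q₀ → ℕ) : TorusSeries (α + β) :=
  (∏ i, ∏ k : Fin (α i), ∏ l : Fin (β i), shuffleFactor α β (1, 1) i i k l) *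
    ∏ i, ∏ j, ∏ e : DoubledHom i j, ∏ k : Fin (α i), ∏ l : Fin (β j),
      Ring.inverse (shuffleFactor α β (arrowExp e) i j k l)

/-- The preprojective shuffle product `f ⋆̄ g`. -/
def shuffle {α β : Q₀ → ℕ} (f : TorusSeries α) (g : TorusSeries β) : TorusSeries (α + β) :=
  demazure (α + β)
    (f.map (AddMonoidAlgebra.mapDomainRingHom ℤ (inclU α β)) *
      g.map (AddMonoidAlgebra.mapDomainRingHom ℤ (inclV α β)) * shuffleKernel α β)

end Shuffle

/-- The `GL_a`-weight `μ` placed at the vertex `i`, the dimension vector being `a` at `i` and `0`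
elsewhere. -/
def vertexWeight {Q₀ : Type u} [DecidableEq Q₀] (i : Q₀) {a : ℕ} (μ : Fin a → ℤ)
    (hμ : Antitone μ) : DominantWeight (Pi.single i a : Q₀ → ℕ) :=
  ⟨fun j k => if h : j = i then μ (Fin.cast (by rw [h, Pi.single_eq_same]) k) else 0, by
    intro j k l hkl
    by_cases h : j = i
    · simpa only [h, dite_true] using hμ (by simpa using hkl)
    · simp [h]⟩

end

end QuiverCurrents

open QuiverCurrents

namespace QuiverCurrents

noncomputable section

open AddMonoidAlgebra (single)

/-! Write `K` for the shuffle kernel, `x` for the variables of `U + V`, and `τ = ρ + (μ, ξ)`. Both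
coefficients attached to `λ` equal the same signed sum `∑_w (-1)^w [x^{w(λ+ρ) - τ}] K`.

Shuffle side. Multiplying a Schur expansion by `J(x^ρ)` turns Schur polynomials into alternants, so
the coefficient of `s_λ` is the coefficient of `x^{λ+ρ}` in `J(x^ρ s_μ[U] s_ξ[V] K)`. Since `K` is
symmetric separately in `U` and in `V`, the two Schur polynomials may be replaced there by the
monomials `u^μ` and `v^ξ` (`antisymm_schurPoly_mul_schurPoly`). The signed sum is then read off in
`IsSchurPolyExpansion.coeff_eq_of_shuffle`.

Current side. The tool is the linear map `hlin`, `x^γ ↦ h_γ`. By Jacobi-Trudi, `s_ξ` is the image of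
`v^ξ ∏_{k<l} (1 - v_k/v_l)` (`schurZ_eq_hlin`). Because `⟨f, h_γ⟩` is the coefficient of `x^γ` in
`f` (`hall_hmon`), the operator `f^⊥` becomes multiplication by `f[V^*]` (`perp_hlin`). A factor
`u_k^{-1}` in the skewing series raises the index of the matching `h` from `Ω[UX]`, so it acts as
`u_k` on exponents. The skewing series thus becomes `∏ (1 - u_k/v_l)`, over the variables at the
vertex `i`, times `K`. The first product, the factor `R(U)` with its variables inverted, and the
Vandermonde product of `V` assemble into the Vandermonde product of `U + V` (`vandInv_add`). Hence
the current is the image of `x^{(μ,ξ)} ∏_{k<l} (1 - x_k/x_l) K` (`current_schurFun`), which is a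
combination of Jacobi-Trudi determinants with the coefficients of `K`. The straightening rule
`schurZ_permWeight_sub_rho` collects these into the signed sum (`hsum_act_alt`). Only shapes with at
most `α^{(j)} + β^{(j)}` rows occur, which gives the vanishing statement.

The kernel is expanded in two different rings: in the `u_k^{-1}` over Laurent polynomials for the
current, in `q, t` for the shuffle product. `isCompatible_kernel` shows that the coefficients agree.
On the current side `K` is handled as a function of exponents on which Laurent polynomials act by
convolution (`act`), and homogeneity keeps every sum finite. -/

/-! ### The group of vertexwise permutations and alternants -/

section Alternants

open AddMonoidAlgebra (coeff_single coeff_sum coeff_smul)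

variable {Q₀ : Type u} {ν : Q₀ → ℕ}

/-- The group `∏_j S_{ν j}`. -/
abbrev PermGroup (ν : Q₀ → ℕ) : Type u := (j : Q₀) → Equiv.Perm (Fin (ν j))

theorem permWeight_apply (w : PermGroup ν) (κ : Weight ν) (j : Q₀) (k : Fin (ν j)) :
    permWeight w κ j k = κ j ((w j)⁻¹ k) := rfl

@[simp] theorem permWeight_one (κ : Weight ν) : permWeight (1 : PermGroup ν) κ = κ := rfl

theorem permWeight_mul (w w' : PermGroup ν) (κ : Weight ν) :
    permWeight (w * w') κ = permWeight w (permWeight w' κ) := by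
  funext j k
  simp [permWeight_apply]

@[simp] theorem permWeight_inv_permWeight (w : PermGroup ν) (κ : Weight ν) :
    permWeight w⁻¹ (permWeight w κ) = κ := by
  rw [← permWeight_mul, inv_mul_cancel, permWeight_one]

@[simp] theorem permWeight_permWeight_inv (w : PermGroup ν) (κ : Weight ν) :
    permWeight w (permWeight w⁻¹ κ) = κ := by
  rw [← permWeight_mul, mul_inv_cancel, permWeight_one]

theorem permWeight_injective (w : PermGroup ν) : Function.Injective (permWeight w) :=
  Function.LeftInverse.injective (permWeight_inv_permWeight w)

/-- A weight is regular dominant when it is strictly decreasing at every vertex. -/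
def IsStrict (γ : Weight ν) : Prop := ∀ j, StrictAnti (γ j)

/-- A weight is regular when its entries at every vertex are distinct. -/
def IsRegularWeight (γ : Weight ν) : Prop := ∀ j, Function.Injective (γ j)

theorem IsStrict.isRegularWeight {γ : Weight ν} (h : IsStrict γ) : IsRegularWeight γ :=
  fun j => (h j).injective

theorem isRegularWeight_permWeight (w : PermGroup ν) {γ : Weight ν} (h : IsRegularWeight γ) :
    IsRegularWeight (permWeight w γ) :=
  fun j => (h j).comp (w j)⁻¹.injective

theorem exists_isStrict_permWeight {γ : Weight ν} (h : IsRegularWeight γ) :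
    ∃ w : PermGroup ν, IsStrict (permWeight w γ) := by
  -- `Tuple.sort` sorts increasingly, hence the reversal; the inverse appears because `permWeight w`
  -- precomposes with `w⁻¹`.
  refine ⟨fun j => (Fin.revPerm.trans (Tuple.sort (γ j)))⁻¹, fun j => ?_⟩
  have h1 : Antitone (permWeight (fun j => (Fin.revPerm.trans (Tuple.sort (γ j)))⁻¹) γ j) := by
    intro k l hkl
    simpa [permWeight_apply] using Tuple.monotone_sort (γ j) (Fin.rev_le_rev.2 hkl)
  exact h1.strictAnti_of_injective (isRegularWeight_permWeight _ h j)

theorem eq_one_of_isStrict_permWeight {γ : Weight ν} {w : PermGroup ν} (h : IsStrict γ)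
    (h' : IsStrict (permWeight w γ)) : w = 1 := by
  funext j
  have h1 : StrictMono ((w j)⁻¹ : Equiv.Perm (Fin (ν j))) := fun k l hkl => (h j).lt_iff_gt.1 (h' j hkl)
  -- A finite chain has no order automorphism but the identity.
  have h2 : ((w j)⁻¹ : Equiv.Perm (Fin (ν j))) = 1 := by
    ext k
    have := congrArg (fun e : Fin (ν j) ≃o Fin (ν j) => (e k : ℕ))
      (Subsingleton.elim (StrictMono.orderIsoOfSurjective _ h1 ((w j)⁻¹ : Equiv.Perm (Fin (ν j))).surjective)
        (OrderIso.refl _))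
    simpa using this
  simpa using h2

theorem isStrict_unique {γ γ' : Weight ν} {w w' : PermGroup ν} (h : IsStrict γ)
    (h' : IsStrict γ') (e : permWeight w γ = permWeight w' γ') : w = w' ∧ γ = γ' := by
  have e1 : permWeight (w'⁻¹ * w) γ = γ' := by rw [permWeight_mul, e, permWeight_inv_permWeight]
  have e2 := eq_one_of_isStrict_permWeight h (by rw [e1]; exact h')
  refine ⟨(inv_mul_eq_one.1 e2).symm, ?_⟩
  rw [← e1, e2, permWeight_one]

variable [Fintype Q₀]

/-- The sign character of `∏_j S_{ν j}`. -/
def sgn (w : PermGroup ν) : ℤ := ∏ j, (Equiv.Perm.sign (w j) : ℤ)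

@[simp] theorem sgn_one : sgn (1 : PermGroup ν) = 1 := by simp [sgn]

theorem sgn_mul (w w' : PermGroup ν) : sgn (w * w') = sgn w * sgn w' := by
  simp [sgn, Finset.prod_mul_distrib]

theorem sgn_mul_self (w : PermGroup ν) : sgn w * sgn w = 1 := by
  rw [sgn, ← Finset.prod_mul_distrib]
  exact Finset.prod_eq_one fun j _ => by
    rcases Int.units_eq_one_or (Equiv.Perm.sign (w j)) with h | h <;> simp [h]

@[simp] theorem sgn_inv (w : PermGroup ν) : sgn w⁻¹ = sgn w := by simp [sgn]

variable [DecidableEq Q₀]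

open Classical in
/-- Summation over the orbits of `∏_j S_{ν j}` on the regular weights. -/
theorem sum_eq_sum_isStrict {M : Type*} [AddCommMonoid M] (Γ : Finset (Weight ν))
    (hΓ : ∀ w, ∀ γ ∈ Γ, permWeight w γ ∈ Γ) (f : Weight ν → M)
    (hf : ∀ γ, ¬ IsRegularWeight γ → f γ = 0) :
    ∑ γ ∈ Γ, f γ = ∑ γ ∈ Γ with IsStrict γ, ∑ w : PermGroup ν, f (permWeight w γ) := by
  rw [← Finset.sum_filter_of_ne (p := IsRegularWeight) fun γ _ h => by
    by_contra h'; exact h (hf γ h')]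
  rw [← Finset.sum_product']
  symm
  refine Finset.sum_bij (fun p _ => permWeight p.2 p.1) ?_ ?_ ?_ ?_
  · rintro ⟨γ, w⟩ h
    simp only [Finset.mem_product, Finset.mem_filter] at h ⊢
    exact ⟨hΓ _ _ h.1.1, isRegularWeight_permWeight _ h.1.2.isRegularWeight⟩
  · rintro ⟨γ, w⟩ h ⟨γ', w'⟩ h' e
    simp only [Finset.mem_product, Finset.mem_filter] at h h'
    obtain ⟨e1, e2⟩ := isStrict_unique h.1.2 h'.1.2 e
    exact Prod.ext e2 e1
  · intro γ h
    simp only [Finset.mem_filter] at h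
    obtain ⟨w, hw⟩ := exists_isStrict_permWeight h.2
    exact ⟨(permWeight w γ, w⁻¹), by simp [hw, hΓ _ _ h.1], by simp⟩
  · intros; rfl

/-- A transposition of two equal entries fixes the weight and has sign `-1`, so the value is its own
negative. -/
theorem eq_zero_of_antisymm {M : Type*} [AddCommGroup M] [Module.IsTorsionFree ℤ M]
    (f : Weight ν → M) (hf : ∀ w γ, f (permWeight w γ) = sgn w • f γ) {γ : Weight ν}
    (h : ¬ IsRegularWeight γ) : f γ = 0 := by
  simp only [IsRegularWeight, not_forall] at h
  obtain ⟨j, hj⟩ := h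
  simp only [Function.Injective, not_forall] at hj
  obtain ⟨k, l, e, hkl⟩ := hj
  let w : PermGroup ν := Pi.mulSingle j (Equiv.swap k l)
  have h1 : permWeight w γ = γ := by
    funext i m
    rw [permWeight_apply]
    by_cases hi : i = j
    · subst hi
      simp only [w, Pi.mulSingle_eq_same, Equiv.swap_inv]
      by_cases hk : m = k
      · rw [hk, Equiv.swap_apply_left, e]
      by_cases hl : m = l
      · rw [hl, Equiv.swap_apply_right, e]
      rw [Equiv.swap_apply_of_ne_of_ne hk hl]
    · simp [w, hi]
  have h2 : sgn w = -1 := by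
    rw [sgn, Finset.prod_eq_single j]
    · simp [w, Equiv.Perm.sign_swap hkl]
    · intro i _ hi; simp [w, hi]
    · simp
  have h3 := hf w γ
  rw [h1, h2, neg_one_zsmul] at h3
  have h4 : (2 : ℤ) • f γ = 0 := by rw [two_zsmul]; nth_rewrite 1 [h3]; simp
  exact (smul_eq_zero.1 h4).resolve_left (by norm_num)

variable (R : Type*) [CommRing R]

/-- The alternant `∑_w (-1)^w x^{w κ}`. -/
def alt (κ : Weight ν) : AddMonoidAlgebra R (Weight ν) :=
  ∑ w : PermGroup ν, sgn w • single (permWeight w κ) 1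

theorem alt_permWeight (w : PermGroup ν) (κ : Weight ν) :
    alt R (permWeight w κ) = sgn w • alt R κ := by
  rw [alt, alt, Finset.smul_sum]
  refine Fintype.sum_equiv (Equiv.mulRight w) _ _ fun w' => ?_
  rw [Equiv.coe_mulRight, permWeight_mul, sgn_mul, smul_smul, mul_left_comm, sgn_mul_self, mul_one]

/-- An orbit meets the strict weights at most once, and with trivial stabilizer, so only `w = 1`
contributes. This is what allows Schur coefficients to be read off one monomial at a time. -/
theorem coeff_alt_of_isStrict {κ γ : Weight ν} (h : IsStrict κ) (h' : IsStrict γ)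
    [Decidable (κ = γ)] :
    (alt R κ).coeff γ = if κ = γ then 1 else 0 := by
  classical
  have : (alt R κ).coeff γ =
      ∑ w : PermGroup ν, sgn w • (if permWeight w κ = γ then (1 : R) else 0) := by
    simp [alt, AddMonoidAlgebra.coeff_sum, Finsupp.single_apply]
  rw [this, Finset.sum_eq_single 1]
  · rw [sgn_one, one_smul, permWeight_one]
    split_ifs <;> rfl
  · intro w _ hw
    rw [if_neg, smul_zero]
    intro e
    exact hw (isStrict_unique (w' := 1) h h' (by simpa using e)).1
  · simp

-- An antisymmetric polynomial vanishes at weights with repeated entries, and every other orbit has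
-- exactly one strict representative.
open Classical in
theorem eq_sum_alt [Module.IsTorsionFree ℤ R] (p : AddMonoidAlgebra R (Weight ν))
    (hp : ∀ w γ, p.coeff (permWeight w γ) = sgn w • p.coeff γ) :
    p = ∑ γ ∈ p.coeff.support with IsStrict γ, p.coeff γ • alt R γ := by
  have h1 : p = ∑ γ ∈ p.coeff.support, single γ (p.coeff γ) :=
    (AddMonoidAlgebra.sum_coeff_single p).symm
  nth_rewrite 1 [h1]
  rw [sum_eq_sum_isStrict]
  · refine Finset.sum_congr rfl fun γ _ => ?_
    rw [alt, Finset.smul_sum]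
    refine Finset.sum_congr rfl fun w _ => ?_
    rw [hp, smul_comm, AddMonoidAlgebra.smul_single', mul_one, AddMonoidAlgebra.smul_single]
  · intro w γ h
    rw [Finsupp.mem_support_iff] at h ⊢
    rw [hp]
    intro h'
    apply h
    rw [← one_smul ℤ (p.coeff γ), ← sgn_mul_self w, mul_smul, h', smul_zero]
  · intro γ h
    rw [eq_zero_of_antisymm _ hp h, AddMonoidAlgebra.single_zero]

theorem coeff_permWeight_alt (w : PermGroup ν) (κ γ : Weight ν) :
    (alt R κ).coeff (permWeight w γ) = sgn w • (alt R κ).coeff γ := by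
  classical
  simp only [alt, AddMonoidAlgebra.coeff_sum, AddMonoidAlgebra.coeff_smul, coeff_single,
    Finsupp.finsetSum_apply, Finsupp.smul_apply, Finsupp.single_apply, Finset.smul_sum]
  refine Fintype.sum_equiv (Equiv.mulLeft w⁻¹) _ _ fun w' => ?_
  rw [Equiv.coe_mulLeft, permWeight_mul, sgn_mul, sgn_inv, smul_smul, ← mul_assoc, sgn_mul_self,
    one_mul]
  congr 1
  refine if_congr ⟨fun h => ?_, fun h => ?_⟩ rfl rfl
  · rw [h, permWeight_inv_permWeight]
  · rw [← h, permWeight_permWeight_inv]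

theorem antisymm_single (κ : Weight ν) (r : ℤ) :
    antisymm ν (single κ r) = r • alt ℤ κ := by
  simp only [antisymm, AddMonoidHom.finsetSum_apply, alt, Finset.smul_sum]
  refine Finset.sum_congr rfl fun w _ => ?_
  simp [sgn, AddMonoidAlgebra.mapDomain_single, AddMonoidAlgebra.smul_single, mul_comm]

theorem antisymm_eq_sum (p : TorusRing ν) :
    antisymm ν p = ∑ γ ∈ p.coeff.support, p.coeff γ • alt ℤ γ := by
  conv_lhs => rw [← AddMonoidAlgebra.sum_coeff_single p]
  rw [Finsupp.sum, map_sum]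
  exact Finset.sum_congr rfl fun γ _ => antisymm_single _ _

theorem coeff_antisymm (p : TorusRing ν) (γ : Weight ν) :
    (antisymm ν p).coeff γ = ∑ w : PermGroup ν, sgn w * p.coeff (permWeight w γ) := by
  classical
  have h0 : ∀ κ : Weight ν, (alt ℤ κ).coeff γ =
      ∑ w : PermGroup ν, sgn w * if κ = permWeight w γ then 1 else 0 := by
    intro κ
    simp only [alt, AddMonoidAlgebra.coeff_sum, AddMonoidAlgebra.coeff_smul, coeff_single,
      Finsupp.finsetSum_apply, Finsupp.smul_apply, Finsupp.single_apply, smul_eq_mul]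
    refine Fintype.sum_equiv (Equiv.inv _) _ _ fun w => ?_
    rw [Equiv.inv_apply, sgn_inv]
    congr 1
    refine if_congr ⟨fun h => ?_, fun h => ?_⟩ rfl rfl
    · rw [← h, permWeight_inv_permWeight]
    · rw [h, permWeight_permWeight_inv]
  rw [antisymm_eq_sum, AddMonoidAlgebra.coeff_sum, Finsupp.finsetSum_apply]
  simp only [AddMonoidAlgebra.coeff_smul, Finsupp.smul_apply, h0, smul_eq_mul, Finset.mul_sum]
  rw [Finset.sum_comm]
  refine Finset.sum_congr rfl fun w _ => ?_
  simp only [mul_left_comm _ (sgn w), ← Finset.mul_sum]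
  congr 1
  simp only [mul_ite, mul_one, mul_zero, Finset.sum_ite_eq', Finsupp.mem_support_iff]
  split_ifs with h
  · rfl
  · exact (not_not.1 h).symm

end Alternants

/-! ### Complete homogeneous polynomials and the Jacobi-Trudi identity -/

section CompleteHomogeneous

variable {A : Type*} [CommRing A]

theorem mk_pow_mul_one_sub (a : A) :
    (PowerSeries.mk fun n => a ^ n) * (1 - PowerSeries.C a * PowerSeries.X) = 1 := by
  ext n
  rw [mul_sub, mul_one, mul_left_comm, map_sub, PowerSeries.coeff_C_mul]
  cases n with
  | zero => simp
  | succ n => simp [PowerSeries.coeff_succ_mul_X, pow_succ', PowerSeries.coeff_one]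

variable {ι : Type*} [Fintype ι]

/-- The generating series `∏_l 1 / (1 - x_l t)` of the complete homogeneous polynomials. -/
def completeSeries (x : ι → A) : PowerSeries A := ∏ l, PowerSeries.mk fun n => x l ^ n

theorem completeSeries_mul_prod (x : ι → A) :
    completeSeries x * ∏ l, (1 - PowerSeries.C (x l) * PowerSeries.X) = 1 := by
  rw [completeSeries, ← Finset.prod_mul_distrib]
  exact Finset.prod_eq_one fun l _ => mk_pow_mul_one_sub (x l)

/-- The complete homogeneous polynomial of degree `m`, which is zero for negative `m`. -/
def completeZ (x : ι → A) (m : ℤ) : A :=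
  if 0 ≤ m then PowerSeries.coeff m.toNat (completeSeries x) else 0

theorem completeZ_natCast (x : ι → A) (m : ℕ) :
    completeZ x m = PowerSeries.coeff m (completeSeries x) := by simp [completeZ]

theorem completeZ_of_neg (x : ι → A) {m : ℤ} (h : m < 0) : completeZ x m = 0 := by
  simp [completeZ, not_le.2 h]

@[simp] theorem completeZ_zero (x : ι → A) : completeZ x 0 = 1 := by
  simp [completeZ, completeSeries]

theorem coeff_completeSeries [DecidableEq ι] (x : ι → A) (m : ℕ) :
    PowerSeries.coeff m (completeSeries x) =
      ∑ p ∈ Finset.finsuppAntidiag Finset.univ m, ∏ l, x l ^ p l := by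
  simp [completeSeries, PowerSeries.coeff_prod]

theorem map_completeZ {B : Type*} [CommRing B] (f : A →+* B) (x : ι → A) (m : ℤ) :
    f (completeZ x m) = completeZ (fun l => f (x l)) m := by
  classical
  unfold completeZ
  split_ifs
  · simp [coeff_completeSeries]
  · simp

variable {n : ℕ}

/-- The polynomial `∏_{l ≠ k} (1 - x_l t)`. -/
def complementPoly (x : Fin n → A) (k : Fin n) : Polynomial A :=
  ∏ l ∈ Finset.univ.erase k, (1 - Polynomial.C (x l) * Polynomial.X)

/-- Every geometric factor of the complete series cancels except the `k`-th. -/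
theorem completeSeries_mul_complementPoly (x : Fin n → A) (k : Fin n) :
    completeSeries x * (complementPoly x k : PowerSeries A) = PowerSeries.mk fun n => x k ^ n := by
  have h : (complementPoly x k : PowerSeries A) =
      ∏ l ∈ Finset.univ.erase k, (1 - PowerSeries.C (x l) * PowerSeries.X) := by
    rw [complementPoly, ← Polynomial.coeToPowerSeries.ringHom_apply, map_prod]
    simp
  have h1 := completeSeries_mul_prod x
  rw [← Finset.mul_prod_erase _ _ (Finset.mem_univ k), ← h, mul_left_comm] at h1
  calc _ = ((PowerSeries.mk fun n => x k ^ n) * (1 - PowerSeries.C (x k) * PowerSeries.X)) *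
        (completeSeries x * (complementPoly x k : PowerSeries A)) := by
        rw [mk_pow_mul_one_sub, one_mul]
    _ = _ := by rw [mul_assoc, h1, mul_one]

theorem natDegree_complementPoly_lt (x : Fin n → A) (k : Fin n) :
    (complementPoly x k).natDegree < n := by
  have h1 : ∀ l : Fin n, (1 - Polynomial.C (x l) * Polynomial.X).natDegree ≤ 1 := fun l =>
    (Polynomial.natDegree_sub_le _ _).trans (by
      simpa using
      (Polynomial.natDegree_C_mul_le (x l) Polynomial.X).trans Polynomial.natDegree_X_le)
  have h2 := (Polynomial.natDegree_prod_le (Finset.univ.erase k)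
    (fun l => (1 - Polynomial.C (x l) * Polynomial.X))).trans
    (Finset.sum_le_card_nsmul _ _ 1 fun l _ => h1 l)
  rw [Finset.card_erase_of_mem (Finset.mem_univ k), Finset.card_univ, Fintype.card_fin] at h2
  have := k.pos
  simp only [smul_eq_mul, mul_one] at h2
  exact lt_of_le_of_lt h2 (by omega)

/-- Coefficient of degree `m` in the preceding identity. The sum stops at `n` because the
complementary polynomial has degree less than `n`. -/
theorem pow_eq_sum_completeZ (x : Fin n → A) (k : Fin n) (m : ℕ) :
    x k ^ m = ∑ s : Fin n, (complementPoly x k).coeff s * completeZ x (m - (s : ℕ)) := by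
  have h1 := congrArg (PowerSeries.coeff m) (completeSeries_mul_complementPoly x k)
  rw [mul_comm, PowerSeries.coeff_mk, PowerSeries.coeff_mul,
    Finset.Nat.sum_antidiagonal_eq_sum_range_succ_mk] at h1
  rw [← h1, Finset.sum_range fun s => _, ← Finset.sum_range
    (fun s => PowerSeries.coeff s (complementPoly x k : PowerSeries A) *
      PowerSeries.coeff (m - s) (completeSeries x)),
    ← Finset.sum_range (fun s => (complementPoly x k).coeff s * completeZ x (m - (s : ℕ)))]
  -- The ranges `m + 1` and `n` are compared through a common larger range: beyond the first,
  -- `completeZ` has negative index; beyond the second, the polynomial has no coefficients.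
  have e1 : ∀ N, m + 1 ≤ N → ∑ s ∈ Finset.range (m + 1),
      PowerSeries.coeff s (complementPoly x k : PowerSeries A) *
        PowerSeries.coeff (m - s) (completeSeries x) =
      ∑ s ∈ Finset.range N, (complementPoly x k).coeff s * completeZ x (m - (s : ℕ)) := by
    intro N hN
    rw [← Finset.sum_subset (Finset.range_mono hN)]
    · refine Finset.sum_congr rfl fun s hs => ?_
      rw [Finset.mem_range] at hs
      rw [Polynomial.coeff_coe, ← completeZ_natCast, Nat.cast_sub (by omega)]
    · intro s _ hs
      rw [Finset.mem_range] at hs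
      rw [completeZ_of_neg _ (by omega), mul_zero]
  have e2 : ∀ N, n ≤ N →
      ∑ s ∈ Finset.range n, (complementPoly x k).coeff s * completeZ x (m - (s : ℕ)) =
      ∑ s ∈ Finset.range N, (complementPoly x k).coeff s * completeZ x (m - (s : ℕ)) := by
    intro N hN
    rw [← Finset.sum_subset (Finset.range_mono hN)]
    intro s _ hs
    rw [Finset.mem_range] at hs
    rw [Polynomial.coeff_eq_zero_of_natDegree_lt
      ((natDegree_complementPoly_lt x k).trans_le (by omega)), zero_mul]
  rw [e1 (m + 1 + n) (by omega), e2 (m + 1 + n) (by omega)]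

/-- The left factor does not involve `γ`. Taking `γ = ρ`, where the right factor is unitriangular,
identifies it with the Vandermonde determinant. -/
theorem det_pow_eq_det_mul_det (x : Fin n → A) (γ : Fin n → ℕ) :
    Matrix.det (Matrix.of fun k l => x k ^ γ l) =
      Matrix.det (Matrix.of fun k s : Fin n => (complementPoly x k).coeff (Fin.rev s)) *
        Matrix.det (Matrix.of fun l s : Fin n => completeZ x (γ l - ((n : ℤ) - 1 - (s : ℕ)))) := by
  rw [← Matrix.det_transpose (Matrix.of fun l s : Fin n => completeZ x _), ← Matrix.det_mul]
  congr 1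
  ext k l
  rw [Matrix.mul_apply, Matrix.of_apply, pow_eq_sum_completeZ, ← Equiv.sum_comp Fin.revPerm]
  refine Finset.sum_congr rfl fun s _ => ?_
  simp only [Fin.revPerm_apply, Matrix.of_apply, Matrix.transpose_apply]
  congr 2
  rw [Fin.val_rev]
  have := s.2
  push_cast [Nat.cast_sub (show (s : ℕ) + 1 ≤ n by omega)]
  ring

theorem det_completeZ_rho (x : Fin n → A) :
    Matrix.det (Matrix.of fun l s : Fin n =>
      completeZ x (((n - 1 - (l : ℕ) : ℕ) : ℤ) - ((n : ℤ) - 1 - (s : ℕ)))) = 1 := by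
  rw [Matrix.det_of_isUpperTriangular]
  · refine Finset.prod_eq_one fun l _ => ?_
    have := l.2
    rw [Matrix.of_apply, show (((n - 1 - (l : ℕ) : ℕ) : ℤ) - ((n : ℤ) - 1 - (l : ℕ))) = 0 by omega,
      completeZ_zero]
  · intro l s h
    have h' : (s : ℕ) < l := h
    have := l.2
    rw [Matrix.of_apply, completeZ_of_neg _ (by omega)]

/-- The Jacobi-Trudi identity in bialternant form. -/
theorem det_pow_eq (x : Fin n → A) (γ : Fin n → ℕ) :
    Matrix.det (Matrix.of fun k l => x k ^ γ l) =
      Matrix.det (Matrix.of fun k l : Fin n => x k ^ (n - 1 - (l : ℕ))) *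
        Matrix.det (Matrix.of fun l s : Fin n => completeZ x (γ l - ((n : ℤ) - 1 - (s : ℕ)))) := by
  rw [det_pow_eq_det_mul_det x γ, det_pow_eq_det_mul_det x (fun l => n - 1 - (l : ℕ)),
    det_completeZ_rho, mul_one]

end CompleteHomogeneous

/-! ### Alternants as products of determinants, and divisibility by the Vandermonde alternant. -/

section AlternantDeterminants

variable {Q₀ : Type u} [DecidableEq Q₀] {ν : Q₀ → ℕ} (R : Type*) [CommRing R]


/-- The weight of the variable `x_k^{(j)}`. -/
def varWeight (j : Q₀) (k : Fin (ν j)) : Weight ν := Pi.single j (Pi.single k 1)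

/-- The variable `x_k^{(j)}`. -/
def var (j : Q₀) (k : Fin (ν j)) : AddMonoidAlgebra R (Weight ν) := single (varWeight j k) 1

variable [Fintype Q₀]

theorem sum_smul_varWeight (γ : Weight ν) : ∑ j, ∑ k, γ j k • varWeight j k = γ := by
  funext i l
  rw [Finset.sum_apply, Finset.sum_apply, Finset.sum_eq_single i]
  · simp [varWeight, Pi.single_apply]
  · intro j _ hj
    simp [varWeight, hj.symm]
  · simp

theorem prod_var_pow (γ : (j : Q₀) → Fin (ν j) → ℕ) :
    ∏ j, ∏ k, var R j k ^ γ j k = single (fun j k => (γ j k : ℤ) : Weight ν) 1 := by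
  conv_rhs => rw [← sum_smul_varWeight (fun j k => (γ j k : ℤ) : Weight ν)]
  simp [var, AddMonoidAlgebra.single_pow, AddMonoidAlgebra.prod_single]

theorem alt_eq_prod_det (γ : (j : Q₀) → Fin (ν j) → ℕ) :
    alt R (fun j k => (γ j k : ℤ) : Weight ν) =
      ∏ j, Matrix.det (Matrix.of fun k l : Fin (ν j) => var R j k ^ γ j l) := by
  simp only [Matrix.det_apply']
  rw [Finset.prod_univ_sum, Fintype.piFinset_univ, alt]
  refine Finset.sum_congr rfl fun w _ => ?_
  rw [Finset.prod_mul_distrib, zsmul_eq_mul, sgn]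
  congr 1
  · simp
  · have h : permWeight w (fun j k => (γ j k : ℤ) : Weight ν) =
        fun j k => ((γ j ((w j)⁻¹ k) : ℕ) : ℤ) := rfl
    rw [h, ← prod_var_pow]
    refine Finset.prod_congr rfl fun j _ => ?_
    rw [← Equiv.prod_comp (w j)]
    simp

theorem alt_eq_alt_rho_mul (γ : Weight ν) (hγ : ∀ j k, 0 ≤ γ j k) :
    alt R γ = alt R (rho ν) * ∏ j, Matrix.det (Matrix.of fun l s : Fin (ν j) =>
      completeZ (var R j) (γ j l - ((ν j : ℤ) - 1 - (s : ℕ)))) := by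
  have h1 : γ = fun j k => ((γ j k).toNat : ℤ) := by
    funext j k; exact (Int.toNat_of_nonneg (hγ j k)).symm
  have h2 : rho ν = fun j (k : Fin (ν j)) => ((ν j - 1 - (k : ℕ) : ℕ) : ℤ) := by
    funext j k
    have := k.2
    simp only [rho]; omega
  conv_lhs => rw [h1]
  rw [h2, alt_eq_prod_det R fun j k => (γ j k).toNat,
    alt_eq_prod_det R fun j (k : Fin (ν j)) => ν j - 1 - (k : ℕ), ← Finset.prod_mul_distrib]
  refine Finset.prod_congr rfl fun j _ => ?_
  rw [det_pow_eq]
  simp only [Int.toNat_of_nonneg (hγ j _)]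

theorem alt_add_const (γ : Weight ν) (c : Q₀ → ℤ) :
    alt R (γ + fun j _ => c j) = single (fun j _ => c j : Weight ν) 1 * alt R γ := by
  rw [alt, alt, Finset.mul_sum]
  refine Finset.sum_congr rfl fun w _ => ?_
  rw [mul_smul_comm, AddMonoidAlgebra.single_mul_single, one_mul, map_add, add_comm]
  rfl

/-- Jacobi-Trudi requires nonnegative exponents. A shift constant at each vertex only multiplies the
alternant by an invertible monomial, so the general case follows. -/
theorem alt_rho_dvd_alt (γ : Weight ν) : alt R (rho ν) ∣ alt R γ := by
  let N : ℤ := ∑ j, ∑ k, |γ j k|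
  have hN : ∀ j k, 0 ≤ (γ + fun j _ => N : Weight ν) j k := by
    intro j k
    have h1 : |γ j k| ≤ ∑ k, |γ j k| :=
      Finset.single_le_sum (f := fun k => |γ j k|) (fun _ _ => abs_nonneg _) (Finset.mem_univ k)
    have h2 : ∑ k, |γ j k| ≤ N :=
      Finset.single_le_sum (f := fun j => ∑ k, |γ j k|)
        (fun _ _ => Finset.sum_nonneg fun _ _ => abs_nonneg _) (Finset.mem_univ j)
    have := neg_abs_le (γ j k)
    simp only [Pi.add_apply]; linarith
  have h1 := alt_eq_alt_rho_mul R (γ + fun j _ => N) hN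
  have h2 : alt R γ = single (fun j _ => -N : Weight ν) 1 * alt R (γ + fun j _ => N) := by
    rw [← alt_add_const R _ fun _ => -N]
    congr 1
    funext j k
    simp
  rw [h2, h1]
  exact Dvd.dvd.mul_left (dvd_mul_right _ _) _

end AlternantDeterminants

/-! ### Expansions into Schur Laurent polynomials -/

section SchurPolynomials

theorem mul_exactQuot {A : Type*} [CommRing A] {a b : A} (h : a ∣ b) : a * exactQuot b a = b := by
  rw [exactQuot, dif_pos h]
  exact h.choose_spec.symm

variable {Q₀ : Type u} {ν : Q₀ → ℕ}

theorem isStrict_rho : IsStrict (rho ν) := fun j k l h => by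
  have : (k : ℕ) < l := h
  simp only [rho]; omega

theorem isStrict_add_rho {κ : Weight ν} (h : ∀ j, Antitone (κ j)) : IsStrict (κ + rho ν) :=
  fun j => (h j).add_strictAnti (isStrict_rho j)

/-- A strictly decreasing integer sequence drops by at least `l - k` between positions `k` and `l`,
which is exactly the drop of `ρ`. -/
theorem antitone_sub_rho {γ : Weight ν} (h : IsStrict γ) (j : Q₀) :
    Antitone ((γ - rho ν) j) := by
  have h1 : ∀ n : ℕ, ∀ k l : Fin (ν j), (l : ℕ) = k + n → γ j l + n ≤ γ j k := by
    intro n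
    induction n with
    | zero => intro k l e; simp [Fin.ext (show (k : ℕ) = l by omega)]
    | succ n ih =>
      intro k l e
      have hl := l.2
      have h2 := ih k ⟨k + n, by omega⟩ rfl
      have h3 : γ j l < γ j ⟨k + n, by omega⟩ := h j (Fin.lt_def.2 (by simp only; omega))
      push_cast; omega
  intro k l h2
  have h3 : (k : ℕ) ≤ l := h2
  have h4 := h1 (l - k) k l (by omega)
  simp only [Pi.sub_apply, rho]
  omega

variable [Fintype Q₀] [DecidableEq Q₀]

theorem alt_rho_ne_zero : alt ℤ (rho ν) ≠ 0 := by
  classical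
  intro h
  have h1 := coeff_alt_of_isStrict ℤ (isStrict_rho (ν := ν)) isStrict_rho
  rw [h] at h1
  simp at h1

theorem alt_rho_mul_schurPoly (lam : DominantWeight ν) :
    alt ℤ (rho ν) * schurPoly lam = alt ℤ (lam.1 + rho ν) := by
  rw [schurPoly, antisymm_single, antisymm_single, one_smul, one_smul]
  exact mul_exactQuot (alt_rho_dvd_alt ℤ _)

theorem coeff_permWeight_antisymm (p : TorusRing ν) (w : PermGroup ν) (γ : Weight ν) :
    (antisymm ν p).coeff (permWeight w γ) = sgn w • (antisymm ν p).coeff γ := by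
  rw [antisymm_eq_sum, AddMonoidAlgebra.coeff_sum, Finsupp.finsetSum_apply,
    Finsupp.finsetSum_apply, Finset.smul_sum]
  refine Finset.sum_congr rfl fun κ _ => ?_
  rw [AddMonoidAlgebra.coeff_smul, Finsupp.smul_apply, Finsupp.smul_apply, coeff_permWeight_alt,
    smul_comm]

theorem alt_rho_dvd_antisymm (p : TorusRing ν) : alt ℤ (rho ν) ∣ antisymm ν p := by
  rw [antisymm_eq_sum]
  exact Finset.dvd_sum fun γ _ => by
    rw [zsmul_eq_mul]; exact (alt_rho_dvd_alt ℤ γ).mul_left _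

theorem coeff_C_mul {Γ R : Type*} [AddCommGroup Γ] [PartialOrder Γ] [IsOrderedAddMonoid Γ]
    [Semiring R] (r : R) (x : HahnSeries Γ R) (d : Γ) :
    (HahnSeries.C r * x).coeff d = r * x.coeff d := by
  rw [HahnSeries.C_mul_eq_smul, HahnSeries.coeff_smul, smul_eq_mul]

/-- The quotient defining `demazure` is taken in the ring of series. It exists there because the
coefficientwise quotients have support inside that of `g`. -/
theorem alt_rho_mul_coeff_demazure (g : TorusSeries ν) (d : ℤ × ℤ) :
    alt ℤ (rho ν) * (demazure ν g).coeff d =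
      antisymm ν (single (rho ν) 1 * g.coeff d) := by
  have h0 : ∀ d, ((HahnSeries.C (single (rho ν) (1 : ℤ)) * g).map (antisymm ν)).coeff d =
      antisymm ν (single (rho ν) 1 * g.coeff d) := fun d => by
    rw [HahnSeries.map_coeff, coeff_C_mul]
  have h1 : HahnSeries.C (alt ℤ (rho ν)) ∣
      (HahnSeries.C (single (rho ν) (1 : ℤ)) * g).map (antisymm ν) := by
    refine ⟨⟨fun d => exactQuot (antisymm ν (single (rho ν) 1 * g.coeff d)) (alt ℤ (rho ν)),
      g.isPWO_support.mono fun d hd => ?_⟩, ?_⟩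
    -- Where `g` vanishes the chosen quotient must vanish too: Laurent polynomials form a domain, so
    -- the choice is forced.
    · rw [Function.mem_support] at hd
      rw [HahnSeries.mem_support]
      intro h
      apply hd
      have h2 := mul_exactQuot (alt_rho_dvd_antisymm (single (rho ν) 1 * g.coeff d))
      rw [h, mul_zero, map_zero] at h2
      rw [h, mul_zero, map_zero]
      exact (mul_eq_zero.1 h2).resolve_left alt_rho_ne_zero
    · ext1
      funext d
      rw [h0, coeff_C_mul]
      exact (mul_exactQuot (alt_rho_dvd_antisymm _)).symm
  have h2 := congrArg (fun x => HahnSeries.coeff x d) (mul_exactQuot h1)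
  rw [coeff_C_mul, h0] at h2
  rw [demazure, antisymm_single, one_smul]
  exact h2

/-- Multiplication by the Vandermonde alternant turns the expansion into one in alternants, exactly
one of which contains `x^{λ+ρ}`. In particular the expansion is unique. -/
theorem IsSchurPolyExpansion.coeff_eq {f : TorusSeries ν} {C : DominantWeight ν → SeriesQT ℤ}
    (h : IsSchurPolyExpansion f C) (lam : DominantWeight ν) (d : ℤ × ℤ) :
    (C lam).coeff d = (alt ℤ (rho ν) * f.coeff d).coeff (lam.1 + rho ν) := by
  classical
  obtain ⟨hfin, e⟩ := h d
  rw [e, finsum_eq_sum_of_support_subset (s := hfin.toFinset)]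
  · rw [Finset.mul_sum, AddMonoidAlgebra.coeff_sum, Finsupp.finsetSum_apply,
      Finset.sum_eq_single lam]
    · rw [mul_smul_comm, alt_rho_mul_schurPoly, AddMonoidAlgebra.coeff_smul, Finsupp.smul_apply,
        coeff_alt_of_isStrict _ (isStrict_add_rho lam.2) (isStrict_add_rho lam.2)]
      simp
    · intro κ _ hκ
      rw [mul_smul_comm, alt_rho_mul_schurPoly, AddMonoidAlgebra.coeff_smul, Finsupp.smul_apply,
        coeff_alt_of_isStrict _ (isStrict_add_rho κ.2) (isStrict_add_rho lam.2), if_neg, smul_zero]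
      exact fun h => hκ (Subtype.ext (add_right_cancel h))
    · intro h
      rw [Set.Finite.mem_toFinset, Function.mem_support, not_not] at h
      simp [h]
  · intro κ hκ
    rw [Set.Finite.coe_toFinset]
    rw [Function.mem_support] at hκ ⊢
    exact fun h => hκ (by rw [h, zero_smul])

/-- The coefficient of `x ^ γ`, as an additive map. -/
def coeffHom (γ : Weight ν) : TorusRing ν →+ ℤ where
  toFun p := p.coeff γ
  map_zero' := rfl
  map_add' _ _ := rfl

theorem exists_isSchurPolyExpansion_demazure (g : TorusSeries ν) :
    ∃ C, IsSchurPolyExpansion (demazure ν g) C := by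
  classical
  refine ⟨fun lam => ((HahnSeries.C (single (rho ν) (1 : ℤ)) * g).map (antisymm ν)).map
    (coeffHom (lam.1 + rho ν)), fun d => ?_⟩
  have h0 : ∀ lam : DominantWeight ν,
      (((HahnSeries.C (single (rho ν) (1 : ℤ)) * g).map (antisymm ν)).map
        (coeffHom (lam.1 + rho ν))).coeff d =
      (antisymm ν (single (rho ν) 1 * g.coeff d)).coeff (lam.1 + rho ν) := fun lam => by
    rw [HahnSeries.map_coeff, HahnSeries.map_coeff, coeff_C_mul]; rfl
  simp only [h0]
  have hfin : (Function.support fun lam : DominantWeight ν =>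
      (antisymm ν (single (rho ν) 1 * g.coeff d)).coeff (lam.1 + rho ν)).Finite := by
    refine Set.Finite.of_injOn (f := fun lam : DominantWeight ν => lam.1 + rho ν)
      (t := (antisymm ν (single (rho ν) 1 * g.coeff d)).coeff.support) ?_ ?_ (Finset.finite_toSet _)
    · intro lam h
      exact Finsupp.mem_support_iff.2 h
    · intro lam _ lam' _ h
      exact Subtype.ext (add_right_cancel h)
  refine ⟨hfin, mul_left_cancel₀ alt_rho_ne_zero ?_⟩
  rw [alt_rho_mul_coeff_demazure, finsum_eq_sum_of_support_subset (s := hfin.toFinset)]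
  · conv_lhs => rw [eq_sum_alt ℤ _ (coeff_permWeight_antisymm _)]
    rw [Finset.mul_sum]
    symm
    refine Finset.sum_bij (fun lam _ => lam.1 + rho ν) ?_ ?_ ?_ ?_
    · intro lam h
      rw [Set.Finite.mem_toFinset, Function.mem_support] at h
      exact Finset.mem_filter.2 ⟨Finsupp.mem_support_iff.2 h, isStrict_add_rho lam.2⟩
    · intro lam _ lam' _ h
      exact Subtype.ext (add_right_cancel h)
    · intro γ h
      rw [Finset.mem_filter] at h
      refine ⟨⟨γ - rho ν, antitone_sub_rho h.2⟩, ?_, sub_add_cancel _ _⟩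
      rw [Set.Finite.mem_toFinset, Function.mem_support]
      simpa using h.1
    · intro lam _
      rw [mul_smul_comm, alt_rho_mul_schurPoly]
  · intro κ hκ
    rw [Set.Finite.coe_toFinset]
    rw [Function.mem_support] at hκ ⊢
    exact fun h => hκ (by rw [h, zero_smul])

end SchurPolynomials

/-! ### Reduction of the symmetrizer modulo a block subgroup -/

section Blocks

variable {Q₀ : Type u}

/-- The action of a vertexwise permutation on Laurent polynomials. -/
def permRing {ν : Q₀ → ℕ} (w : PermGroup ν) : TorusRing ν →+* TorusRing ν :=
  AddMonoidAlgebra.mapDomainRingHom ℤ (permWeight w)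

@[simp] theorem permRing_single {ν : Q₀ → ℕ} (w : PermGroup ν) (γ : Weight ν) (r : ℤ) :
    permRing w (single γ r) = single (permWeight w γ) r := by
  simp [permRing, AddMonoidAlgebra.mapDomain_single]

variable (α β : Q₀ → ℕ)

/-- Laurent polynomials in `U`, as Laurent polynomials in `U + V`. -/
abbrev inclRingU : TorusRing α →+* TorusRing (α + β) :=
  AddMonoidAlgebra.mapDomainRingHom ℤ (inclU α β)

/-- Laurent polynomials in `V`, as Laurent polynomials in `U + V`. -/
abbrev inclRingV : TorusRing β →+* TorusRing (α + β) :=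
  AddMonoidAlgebra.mapDomainRingHom ℤ (inclV α β)

variable {α β}

/-- The inclusion of `∏_j S_{α j} × S_{β j}` in `∏_j S_{α j + β j}`. -/
def blockPerm (w : PermGroup α) (w' : PermGroup β) : PermGroup (α + β) :=
  fun j => finSumFinEquiv.permCongr (Equiv.Perm.sumCongr (w j) (w' j))

@[simp] theorem inclU_castAdd (κ : Weight α) (j : Q₀) (k : Fin (α j)) :
    inclU α β κ j (Fin.castAdd (β j) k) = κ j k := by
  simp [inclU]

@[simp] theorem inclU_natAdd (κ : Weight α) (j : Q₀) (l : Fin (β j)) :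
    inclU α β κ j (Fin.natAdd (α j) l) = 0 := by
  simp [inclU]

@[simp] theorem inclV_castAdd (κ : Weight β) (j : Q₀) (k : Fin (α j)) :
    inclV α β κ j (Fin.castAdd (β j) k) = 0 := by
  simp [inclV]

@[simp] theorem inclV_natAdd (κ : Weight β) (j : Q₀) (l : Fin (β j)) :
    inclV α β κ j (Fin.natAdd (α j) l) = κ j l := by
  simp [inclV]

theorem weight_add_ext {γ γ' : Weight (α + β)}
    (h : ∀ j (k : Fin (α j)), γ j (Fin.castAdd (β j) k) = γ' j (Fin.castAdd (β j) k))
    (h' : ∀ j (l : Fin (β j)), γ j (Fin.natAdd (α j) l) = γ' j (Fin.natAdd (α j) l)) : γ = γ' := by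
  funext j k
  exact Fin.addCases (motive := fun k => γ j k = γ' j k) (h j) (h' j) k

theorem permWeight_blockPerm_castAdd (w : PermGroup α) (w' : PermGroup β) (γ : Weight (α + β))
    (j : Q₀) (k : Fin (α j)) :
    permWeight (blockPerm w w') γ j (Fin.castAdd (β j) k) =
      γ j (Fin.castAdd (β j) ((w j)⁻¹ k)) := by
  rw [permWeight_apply]
  congr 1
  rw [Equiv.Perm.inv_eq_iff_eq]
  simp [blockPerm, Equiv.permCongr_apply]

theorem permWeight_blockPerm_natAdd (w : PermGroup α) (w' : PermGroup β) (γ : Weight (α + β))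
    (j : Q₀) (l : Fin (β j)) :
    permWeight (blockPerm w w') γ j (Fin.natAdd (α j) l) =
      γ j (Fin.natAdd (α j) ((w' j)⁻¹ l)) := by
  rw [permWeight_apply]
  congr 1
  rw [Equiv.Perm.inv_eq_iff_eq]
  simp [blockPerm, Equiv.permCongr_apply]

theorem permWeight_blockPerm_inclU (w : PermGroup α) (w' : PermGroup β) (κ : Weight α) :
    permWeight (blockPerm w w') (inclU α β κ) = inclU α β (permWeight w κ) := by
  apply weight_add_ext <;> intro j k
  · rw [permWeight_blockPerm_castAdd, inclU_castAdd, inclU_castAdd, permWeight_apply]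
  · simp [permWeight_blockPerm_natAdd]

theorem permWeight_blockPerm_inclV (w : PermGroup α) (w' : PermGroup β) (κ : Weight β) :
    permWeight (blockPerm w w') (inclV α β κ) = inclV α β (permWeight w' κ) := by
  apply weight_add_ext <;> intro j k
  · simp [permWeight_blockPerm_castAdd]
  · rw [permWeight_blockPerm_natAdd, inclV_natAdd, inclV_natAdd, permWeight_apply]

/-- The difference between the staircase weights of `U + V` and of its blocks. -/
def blockShift (α β : Q₀ → ℕ) : Weight (α + β) :=
  rho (α + β) - inclU α β (rho α) - inclV α β (rho β)

/-- The shift is constant on each block: `β j` on the variables of `U` and `0` on those of `V`. -/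
theorem permWeight_blockPerm_blockShift (w : PermGroup α) (w' : PermGroup β) :
    permWeight (blockPerm w w') (blockShift α β) = blockShift α β := by
  apply weight_add_ext <;> intro j k
  · simp [permWeight_blockPerm_castAdd, blockShift, rho]
  · simp only [permWeight_blockPerm_natAdd, blockShift, rho, Pi.sub_apply, Pi.add_apply,
      inclU_natAdd, inclV_natAdd, Fin.val_natAdd]
    push_cast
    ring

theorem permRing_blockPerm_inclRingU (w : PermGroup α) (w' : PermGroup β) (p : TorusRing α) :
    permRing (blockPerm w w') (inclRingU α β p) = inclRingU α β (permRing w p) := by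
  induction p using AddMonoidAlgebra.induction_linear with
  | zero => simp
  | add p q hp hq => rw [map_add, map_add, map_add, map_add, hp, hq]
  | single γ r =>
    simp [inclRingU, AddMonoidAlgebra.mapDomain_single, permWeight_blockPerm_inclU]

theorem permRing_blockPerm_inclRingV (w : PermGroup α) (w' : PermGroup β) (p : TorusRing β) :
    permRing (blockPerm w w') (inclRingV α β p) = inclRingV α β (permRing w' p) := by
  induction p using AddMonoidAlgebra.induction_linear with
  | zero => simp
  | add p q hp hq => rw [map_add, map_add, map_add, map_add, hp, hq]
  | single γ r =>
    simp [inclRingV, AddMonoidAlgebra.mapDomain_single, permWeight_blockPerm_inclV]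

variable [Fintype Q₀]

theorem sgn_blockPerm (w : PermGroup α) (w' : PermGroup β) :
    sgn (blockPerm w w') = sgn w * sgn w' := by
  rw [sgn, sgn, sgn, ← Finset.prod_mul_distrib]
  refine Finset.prod_congr rfl fun j _ => ?_
  have h : Equiv.Perm.sign (blockPerm w w' j) =
      Equiv.Perm.sign (w j) * Equiv.Perm.sign (w' j) := by
    rw [← Equiv.Perm.sign_sumCongr]
    exact Equiv.Perm.sign_permCongr _ _
  rw [h]
  push_cast; rfl

variable [DecidableEq Q₀]

theorem antisymm_permRing {ν : Q₀ → ℕ} (w : PermGroup ν) (p : TorusRing ν) :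
    antisymm ν (permRing w p) = sgn w • antisymm ν p := by
  induction p using AddMonoidAlgebra.induction_linear with
  | zero => simp
  | add p q hp hq => rw [map_add, map_add, map_add, hp, hq, smul_add]
  | single γ r => rw [permRing_single, antisymm_single, antisymm_single, alt_permWeight, smul_comm]

theorem permRing_alt {ν : Q₀ → ℕ} (w : PermGroup ν) (κ : Weight ν) :
    permRing w (alt ℤ κ) = sgn w • alt ℤ κ := by
  rw [alt, map_sum, Finset.smul_sum]
  refine Fintype.sum_equiv (Equiv.mulLeft w) _ _ fun w' => ?_
  rw [Equiv.coe_mulLeft, map_zsmul, permRing_single, permWeight_mul, sgn_mul, smul_smul,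
    ← mul_assoc, sgn_mul_self, one_mul]

theorem permRing_schurPoly {ν : Q₀ → ℕ} (w : PermGroup ν) (lam : DominantWeight ν) :
    permRing w (schurPoly lam) = schurPoly lam := by
  have h := congrArg (permRing w) (alt_rho_mul_schurPoly lam)
  rw [map_mul, permRing_alt, permRing_alt, ← alt_rho_mul_schurPoly, smul_mul_assoc] at h
  have h' := congrArg (sgn w • ·) h
  simp only [smul_smul, sgn_mul_self, one_smul] at h'
  exact mul_left_cancel₀ alt_rho_ne_zero h'

theorem inclRingU_alt_mul_inclRingV_alt (κ : Weight α) (η : Weight β) :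
    inclRingU α β (alt ℤ κ) * inclRingV α β (alt ℤ η) =
      ∑ w : PermGroup α, ∑ w' : PermGroup β, sgn (blockPerm w w') •
        permRing (blockPerm w w') (single (inclU α β κ + inclV α β η) 1) := by
  rw [alt, alt, map_sum, map_sum, Finset.sum_mul_sum]
  refine Finset.sum_congr rfl fun w _ => Finset.sum_congr rfl fun w' _ => ?_
  rw [map_zsmul, map_zsmul, smul_mul_smul_comm, sgn_blockPerm, permRing_single, map_add,
    permWeight_blockPerm_inclU, permWeight_blockPerm_inclV]
  simp [AddMonoidAlgebra.mapDomain_single, AddMonoidAlgebra.single_mul_single]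

/-- The product of the two alternants is a signed sum over the block subgroup. All other factors are
invariant under that subgroup, so the full antisymmetrizer takes the same value on each term. -/
theorem antisymm_alt_mul_alt (κ : Weight α) (η : Weight β) (K : TorusRing (α + β))
    (hK : ∀ w w', permRing (blockPerm w w') K = K) :
    antisymm (α + β) (single (blockShift α β) 1 *
      (inclRingU α β (alt ℤ κ) * inclRingV α β (alt ℤ η)) * K) =
    ((Fintype.card (PermGroup α) * Fintype.card (PermGroup β) : ℕ) : ℤ) •
      antisymm (α + β) (single (blockShift α β) 1 * single (inclU α β κ + inclV α β η) 1 * K) := by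
  have h : ∀ w w', single (blockShift α β) 1 * (sgn (blockPerm w w') •
        permRing (blockPerm w w') (single (inclU α β κ + inclV α β η) 1)) * K =
      sgn (blockPerm w w') • permRing (blockPerm w w')
        (single (blockShift α β) 1 * single (inclU α β κ + inclV α β η) 1 * K) := by
    intro w w'
    rw [map_mul, map_mul, hK, permRing_single _ (blockShift α β), permWeight_blockPerm_blockShift,
      mul_smul_comm, smul_mul_assoc]
  rw [inclRingU_alt_mul_inclRingV_alt]
  simp only [Finset.mul_sum, Finset.sum_mul, h, map_sum, map_zsmul, antisymm_permRing, smul_smul,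
    sgn_mul_self, one_smul, Finset.sum_const, Finset.card_univ]
  rw [natCast_zsmul]

/-- Two applications of the preceding lemma: to the alternants of `ρ` with the Schur polynomials
absorbed in the invariant factor, and to the alternants of `κ + ρ` and `η + ρ`. The left sides
agree, and the order of the block subgroup cancels. -/
theorem antisymm_schurPoly_mul_schurPoly (κ : DominantWeight α) (η : DominantWeight β)
    (K : TorusRing (α + β)) (hK : ∀ w w', permRing (blockPerm w w') K = K) :
    antisymm (α + β) (single (rho (α + β)) 1 *
      (inclRingU α β (schurPoly κ) * inclRingV α β (schurPoly η) * K)) =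
    antisymm (α + β) (single (rho (α + β) + (inclU α β κ.1 + inclV α β η.1)) 1 * K) := by
  have hrho : rho (α + β) = blockShift α β + (inclU α β (rho α) + inclV α β (rho β)) := by
    rw [blockShift]; abel
  have h1 := antisymm_alt_mul_alt (rho α) (rho β)
    (inclRingU α β (schurPoly κ) * inclRingV α β (schurPoly η) * K) (fun w w' => by
      rw [map_mul, map_mul, hK, permRing_blockPerm_inclRingU, permRing_blockPerm_inclRingV,
        permRing_schurPoly, permRing_schurPoly])
  have h2 := antisymm_alt_mul_alt (κ.1 + rho α) (η.1 + rho β) K hK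
  rw [← alt_rho_mul_schurPoly, ← alt_rho_mul_schurPoly, map_mul (inclRingU α β),
    map_mul (inclRingV α β)] at h2
  have h3 : single (blockShift α β) 1 * (inclRingU α β (alt ℤ (rho α)) * inclRingU α β
        (schurPoly κ) * (inclRingV α β (alt ℤ (rho β)) * inclRingV α β (schurPoly η))) * K =
      single (blockShift α β) 1 * (inclRingU α β (alt ℤ (rho α)) *
        inclRingV α β (alt ℤ (rho β))) *
        (inclRingU α β (schurPoly κ) * inclRingV α β (schurPoly η) * K) := by ring
  rw [h3, h1] at h2
  have h4 := smul_right_injective (TorusRing (α + β)) (show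
    ((Fintype.card (PermGroup α) * Fintype.card (PermGroup β) : ℕ) : ℤ) ≠ 0 by
      exact_mod_cast mul_ne_zero Fintype.card_ne_zero Fintype.card_ne_zero) h2
  rw [AddMonoidAlgebra.single_mul_single, AddMonoidAlgebra.single_mul_single, one_mul,
    ← hrho] at h4
  rw [h4, hrho]
  congr 3
  rw [map_add, map_add]
  abel

end Blocks

/-! ### Products of complete homogeneous functions and their evaluation -/

section Evaluation

variable {Q₀ : Type u} [DecidableEq Q₀] (ν : Q₀ → ℕ)

/-- The evaluation of a quiver symmetric function in the finite alphabets `x^{(j)}`. -/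
def ev : QSym Q₀ →ₐ[LaurentQT] AddMonoidAlgebra LaurentQT (Weight ν) :=
  MvPolynomial.aeval fun p => completeZ (var (ν := ν) LaurentQT p.1) ((p.2 + 1 : ℕ) : ℤ)

omit [DecidableEq Q₀] in
theorem hfun_natCast_succ (j : Q₀) (n : ℕ) :
    hfun j ((n + 1 : ℕ) : ℤ) = MvPolynomial.X (j, n) := rfl

omit [DecidableEq Q₀] in
@[simp] theorem hfun_zero (j : Q₀) : hfun j 0 = 1 := rfl

omit [DecidableEq Q₀] in
theorem hfun_of_neg (j : Q₀) {m : ℤ} (h : m < 0) : hfun j m = 0 := by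
  obtain ⟨n, rfl⟩ := Int.eq_negSucc_of_lt_zero h
  rfl

theorem ev_hfun (j : Q₀) (m : ℤ) :
    ev ν (hfun j m) = completeZ (var (ν := ν) LaurentQT j) m := by
  rcases lt_or_ge m 0 with h | h
  · rw [hfun_of_neg j h, completeZ_of_neg _ h, map_zero]
  · obtain ⟨n, rfl⟩ := Int.eq_ofNat_of_zero_le h
    cases n with
    | zero => simp
    | succ n => rw [hfun_natCast_succ, ev, MvPolynomial.aeval_X]

variable {ν} [Fintype Q₀]

/-- The product `h_γ = ∏_j ∏_l h_{γ_l^{(j)}}[X^{(j)}]`. -/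
def hmon (γ : Weight ν) : QSym Q₀ := ∏ j, ∏ l, hfun j (γ j l)

omit [DecidableEq Q₀] in
theorem hmon_of_neg {γ : Weight ν} {j : Q₀} {l : Fin (ν j)} (h : γ j l < 0) : hmon γ = 0 :=
  Finset.prod_eq_zero (Finset.mem_univ j)
    (Finset.prod_eq_zero (Finset.mem_univ l) (hfun_of_neg j h))

omit [DecidableEq Q₀] in
theorem hmon_permWeight (w : PermGroup ν) (γ : Weight ν) : hmon (permWeight w γ) = hmon γ := by
  refine Finset.prod_congr rfl fun j _ => ?_
  exact Equiv.prod_comp (w j)⁻¹ fun l => hfun j (γ j l)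

omit [DecidableEq Q₀] in
theorem hmon_add {α β : Q₀ → ℕ} (γ : Weight (α + β)) :
    hmon γ = hmon (fun j k => γ j (Fin.castAdd (β j) k) : Weight α) *
      hmon (fun j l => γ j (Fin.natAdd (α j) l) : Weight β) := by
  rw [hmon, hmon, hmon, ← Finset.prod_mul_distrib]
  exact Finset.prod_congr rfl fun j _ => Fin.prod_univ_add _

/-- The linear map `x ^ γ ↦ h_γ`. -/
def hlin (ν : Q₀ → ℕ) : AddMonoidAlgebra LaurentQT (Weight ν) →ₗ[LaurentQT] QSym Q₀ :=
  (Finsupp.linearCombination LaurentQT hmon).comp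
    (AddMonoidAlgebra.coeffLinearEquiv LaurentQT).toLinearMap

omit [DecidableEq Q₀] in
@[simp] theorem hlin_single (γ : Weight ν) (r : LaurentQT) : hlin ν (single γ r) = r • hmon γ := by
  simp [hlin]

/-- The evaluation of a quiver symmetric function in the inverses of the variables `x^{(j)}`. -/
def evInv (ν : Q₀ → ℕ) : QSym Q₀ →ₐ[LaurentQT] AddMonoidAlgebra LaurentQT (Weight ν) :=
  (AddMonoidAlgebra.mapDomainAlgHom LaurentQT LaurentQT negAddMonoidHom).comp (ev ν)

omit [Fintype Q₀] in
theorem coeff_evInv (f : QSym Q₀) (γ : Weight ν) :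
    (evInv ν f).coeff γ = (ev ν f).coeff (-γ) := by
  have h : Function.Injective (negAddMonoidHom : Weight ν →+ Weight ν) := neg_injective
  have := Finsupp.mapDomain_apply h (ev ν f).coeff (-γ)
  rw [negAddMonoidHom_apply, neg_neg] at this
  exact this

omit [Fintype Q₀] in
theorem coeff_ev_permWeight (w : PermGroup ν) (f : QSym Q₀) (γ : Weight ν) :
    (ev ν f).coeff (permWeight w γ) = (ev ν f).coeff γ := by
  let P : AddMonoidAlgebra LaurentQT (Weight ν) →ₐ[LaurentQT] AddMonoidAlgebra LaurentQT (Weight ν) :=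
    AddMonoidAlgebra.mapDomainAlgHom LaurentQT LaurentQT (permWeight w)
  have h1 : P.comp (ev ν) = ev ν := by
    ext1 p
    rw [AlgHom.comp_apply, ev, MvPolynomial.aeval_X, ← AlgHom.coe_toRingHom, map_completeZ,
      completeZ_natCast, completeZ_natCast]
    congr 1
    rw [completeSeries, completeSeries]
    refine Fintype.prod_equiv (w p.1) _ _ fun l => ?_
    congr 1
    funext n
    congr 1
    have : permWeight w (varWeight p.1 l) = varWeight (ν := ν) p.1 (w p.1 l) := by
      funext i m
      rw [permWeight_apply]
      by_cases hi : i = p.1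
      · subst hi
        simp [varWeight, Pi.single_apply, Equiv.symm_apply_eq]
      · simp [varWeight, hi]
    simp [P, var, AddMonoidAlgebra.mapDomain_single, this]
  have h2 : ev ν f = P (ev ν f) := (congrArg (fun F => F f) h1).symm
  conv_lhs => rw [h2]
  exact Finsupp.mapDomain_apply (permWeight_injective w) (ev ν f).coeff γ

/-- The exponent vector of the monomial `∏_j ∏_l (x_l^{(j)}) ^ γ_l^{(j)}` in infinitely many
variables. -/
def toExp (γ : Weight ν) : Q₀ × ℕ →₀ ℕ :=
  ∑ j, ∑ l : Fin (ν j), Finsupp.single (j, (l : ℕ)) (γ j l).toNat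

theorem toExp_apply (γ : Weight ν) (j : Q₀) (m : ℕ) :
    toExp γ (j, m) = if h : m < ν j then (γ j ⟨m, h⟩).toNat else 0 := by
  rw [toExp, Finsupp.finsetSum_apply, Finset.sum_eq_single j]
  · rw [Finsupp.finsetSum_apply]
    split_ifs with h
    · rw [Finset.sum_eq_single ⟨m, h⟩]
      · simp
      · intro l _ hl
        rw [Finsupp.single_apply, if_neg]
        simpa [Fin.ext_iff] using hl
      · simp
    · refine Finset.sum_eq_zero fun l _ => ?_
      rw [Finsupp.single_apply, if_neg]
      have := l.2
      simp only [Prod.mk.injEq, not_and]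
      omega
  · intro i _ hi
    rw [Finsupp.finsetSum_apply]
    refine Finset.sum_eq_zero fun l _ => ?_
    rw [Finsupp.single_apply, if_neg]
    simp [hi]
  · simp

omit [Fintype Q₀] in
theorem coeff_completeSeries_var (j : Q₀) (n : ℕ) :
    PowerSeries.coeff n (completeSeries (var (ν := ν) LaurentQT j)) =
      ∑ p ∈ Finset.finsuppAntidiag Finset.univ n,
        single (Pi.single j fun l => (p l : ℤ) : Weight ν) 1 := by
  rw [coeff_completeSeries]
  refine Finset.sum_congr rfl fun p _ => ?_
  simp only [var, AddMonoidAlgebra.single_pow, one_pow]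
  rw [AddMonoidAlgebra.prod_single, Finset.prod_const_one]
  congr 1
  funext i m
  rw [Finset.sum_apply, Finset.sum_apply]
  by_cases hi : i = j
  · subst hi
    simp [varWeight, Pi.single_apply]
  · simp [varWeight, hi]

/-- Setting all but finitely many variables to zero preserves the coefficients of monomials in the
others. This links `expand`, through which `hall` is defined, with the finite alphabets used for
computing. -/
theorem coeff_ev_eq (f : QSym Q₀) (γ : Weight ν) [Decidable (∀ j l, 0 ≤ γ j l)] :
    (ev ν f).coeff γ =
      if ∀ j l, 0 ≤ γ j l then MvPowerSeries.coeff (toExp γ) (expand f) else 0 := by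
  classical
  have main : ∀ γ : Weight ν, (ev ν f).coeff γ =
      if ∀ j l, 0 ≤ γ j l then MvPowerSeries.coeff (toExp γ) (expand f) else 0 := by
    induction f using MvPolynomial.induction_on with
    | C r =>
      intro γ
      rw [← MvPolynomial.algebraMap_eq, AlgHom.commutes, AlgHom.commutes,
        MvPowerSeries.algebraMap_apply, Algebra.algebraMap_self, RingHom.id_apply,
        MvPowerSeries.coeff_C]
      have : (algebraMap LaurentQT (AddMonoidAlgebra LaurentQT (Weight ν)) r) = single 0 r := rfl
      rw [this, AddMonoidAlgebra.coeff_single, Finsupp.single_apply]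
      by_cases h : ∀ j l, 0 ≤ γ j l
      · rw [if_pos h]
        refine if_congr ⟨fun e => ?_, fun e => ?_⟩ rfl rfl
        · subst e; simp [toExp]
        · funext j l
          have h1 := congrArg (fun d => d (j, (l : ℕ))) e
          simp only [toExp_apply, Fin.is_lt, dite_true, Fin.eta, Finsupp.coe_zero,
            Pi.zero_apply] at h1
          have := h j l
          simp only [Pi.zero_apply]; omega
      · rw [if_neg h, if_neg]
        rintro rfl
        exact h (by simp)
    | add p q hp hq =>
      intro γ
      rw [map_add, map_add, AddMonoidAlgebra.coeff_add, Finsupp.add_apply, hp, hq, map_add]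
      split_ifs <;> simp
    | mul_X f p hf =>
      intro γ
      obtain ⟨j, n⟩ := p
      rw [map_mul, map_mul, ev, MvPolynomial.aeval_X, ← ev, expand, MvPolynomial.aeval_X,
        ← expand]
      simp only
      rw [completeZ_natCast, coeff_completeSeries_var, Finset.mul_sum,
        AddMonoidAlgebra.coeff_sum, Finsupp.finsetSum_apply]
      simp only [AddMonoidAlgebra.coeff_mul_single_apply, mul_one, hf]
      by_cases h : ∀ j l, 0 ≤ γ j l
      swap
      · rw [if_neg h]
        refine Finset.sum_eq_zero fun p _ => if_neg fun h' => h fun i l => ?_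
        have h1 := h' i l
        by_cases hi : i = j
        · subst hi
          simp only [Pi.add_apply, Pi.neg_apply, Pi.single_eq_same] at h1
          have : (0 : ℤ) ≤ p l := Int.natCast_nonneg _
          linarith
        · simpa [hi] using h1
      rw [if_pos h, MvPowerSeries.coeff_mul]
      have hS : ∀ b : Q₀ × ℕ →₀ ℕ, MvPowerSeries.coeff b (hSeries j (n + 1)) =
          if (∀ p ∈ b.support, p.1 = j) ∧ b.degree = n + 1 then (1 : LaurentQT) else 0 :=
        fun b => by
          rw [MvPowerSeries.coeff_apply]
          unfold hSeries
          congr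
      simp only [hS, mul_ite, mul_one, mul_zero]
      rw [← Finset.sum_filter, ← Finset.sum_filter]
      -- A monomial of `h_{n+1}[X^{(j)}]` dividing `x^γ` corresponds to a splitting of the exponent
      -- vector. Divisibility rules out variables beyond the first `ν j`.
      refine Finset.sum_bij' (fun p _ => (toExp (γ + -Pi.single j fun l => (p l : ℤ)),
          toExp (Pi.single j fun l => (p l : ℤ) : Weight ν)))
        (fun b _ => Finsupp.equivFunOnFinite.symm fun l : Fin (ν j) => b.2 (j, (l : ℕ)))
        ?_ ?_ ?_ ?_ ?_
      · intro p hp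
        simp only [Finset.mem_filter, Finset.mem_finsuppAntidiag] at hp
        simp only [Finset.mem_filter, Finset.HasAntidiagonal.mem_antidiagonal]
        have hsupp : ∀ i, i ≠ j → ∀ m,
            toExp (Pi.single j fun l => (p l : ℤ) : Weight ν) (i, m) = 0 := by
          intro i hi m
          rw [toExp_apply]
          simp [hi]
        refine ⟨?_, ?_, ?_⟩
        · ext ⟨i, m⟩
          rw [Finsupp.add_apply, toExp_apply, toExp_apply, toExp_apply]
          split_ifs with hm
          · have h1 := hp.2 i ⟨m, hm⟩
            have h2 := h i ⟨m, hm⟩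
            by_cases hi : i = j
            · subst hi
              simp only [Pi.add_apply, Pi.neg_apply, Pi.single_eq_same] at h1 ⊢
              omega
            · simp [hi]
          · rfl
        · rintro ⟨i, m⟩ hb
          by_contra hi
          exact (Finsupp.mem_support_iff.1 hb) (hsupp i hi m)
        · rw [toExp, map_sum, Finset.sum_eq_single j]
          · rw [map_sum]
            simpa using hp.1.1
          · intro i _ hi
            simp [hi]
          · simp
      · rintro ⟨a, b⟩ hb
        simp only [Finset.mem_filter, Finset.HasAntidiagonal.mem_antidiagonal] at hb
        obtain ⟨hab, hb1, hb2⟩ := hb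
        have hle : ∀ q, b q ≤ toExp γ q := fun q => by rw [← hab]; simp
        have hb3 : b = ∑ l : Fin (ν j), Finsupp.single (j, (l : ℕ)) (b (j, (l : ℕ))) := by
          ext ⟨i, m⟩
          rw [Finsupp.finsetSum_apply]
          by_cases hi : i = j
          · subst hi
            by_cases hm : m < ν i
            · rw [Finset.sum_eq_single ⟨m, hm⟩]
              · simp
              · intro l _ hl
                rw [Finsupp.single_apply, if_neg]
                simpa [Fin.ext_iff] using hl
              · simp
            · have := hle (i, m)
              rw [toExp_apply, dif_neg hm] at this
              rw [Finset.sum_eq_zero]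
              · omega
              · intro l _
                rw [Finsupp.single_apply, if_neg]
                have := l.2
                simp only [Prod.mk.injEq, true_and]
                omega
          · have h1 : b (i, m) = 0 := by
              by_contra h0
              exact hi (hb1 _ (Finsupp.mem_support_iff.2 h0))
            rw [h1, Finset.sum_eq_zero]
            intro l _
            rw [Finsupp.single_apply, if_neg]
            simp [Ne.symm hi]
        simp only [Finset.mem_filter, Finset.mem_finsuppAntidiag]
        refine ⟨⟨?_, Finset.subset_univ _⟩, ?_⟩
        · rw [hb3] at hb2
          rw [map_sum] at hb2
          simpa using hb2
        · intro i l
          by_cases hi : i = j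
          · subst hi
            have h1 := hle (i, (l : ℕ))
            rw [toExp_apply, dif_pos l.2] at h1
            have h2 := h i l
            simp only [Fin.eta] at h1
            simp only [Pi.add_apply, Pi.neg_apply, Pi.single_eq_same,
              Finsupp.equivFunOnFinite_symm_apply_apply]
            omega
          · simpa [hi] using h i l
      · intro p _
        ext l
        simp [toExp_apply]
      · rintro ⟨a, b⟩ hb
        simp only [Finset.mem_filter, Finset.HasAntidiagonal.mem_antidiagonal] at hb
        obtain ⟨hab, hb1, hb2⟩ := hb
        have hle : ∀ q, b q ≤ toExp γ q := fun q => by rw [← hab]; simp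
        have e2 : toExp (Pi.single j fun l : Fin (ν j) => ((b (j, (l : ℕ)) : ℕ) : ℤ) : Weight ν) =
            b := by
          ext ⟨i, m⟩
          rw [toExp_apply]
          by_cases hi : i = j
          · subst hi
            split_ifs with hm
            · simp
            · have := hle (i, m)
              rw [toExp_apply, dif_neg hm] at this
              omega
          · have h1 : b (i, m) = 0 := by
              by_contra h0
              exact hi (hb1 _ (Finsupp.mem_support_iff.2 h0))
            simp [hi, h1]
        have e1 : toExp (γ + -Pi.single j fun l : Fin (ν j) => ((b (j, (l : ℕ)) : ℕ) : ℤ)) = a := by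
          ext ⟨i, m⟩
          have h1 : a (i, m) + b (i, m) = toExp γ (i, m) := by rw [← hab]; rfl
          have h2 := congrArg (fun d => d (i, m)) e2
          simp only [toExp_apply] at h1 h2 ⊢
          split_ifs at h1 h2 ⊢ with hm
          · have h3 := h i ⟨m, hm⟩
            have h4 : (0 : ℤ) ≤ (Pi.single j fun l : Fin (ν j) =>
                ((b (j, (l : ℕ)) : ℕ) : ℤ) : Weight ν) i ⟨m, hm⟩ := by
              by_cases hi : i = j
              · subst hi; simp
              · simp [hi]
            simp only [Pi.add_apply, Pi.neg_apply]
            omega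
          · omega
        simp only [Finsupp.equivFunOnFinite_symm_apply_apply]
        rw [e1, e2]
      · intro p _
        rfl
  rw [main]
  congr

end Evaluation

/-! ### The Hall scalar product through finite alphabets -/

section HallProduct

theorem exists_perm_of_map_eq {n : ℕ} (f g : Fin n → ℕ)
    (h : Multiset.map f Finset.univ.val = Multiset.map g Finset.univ.val) :
    ∃ σ : Equiv.Perm (Fin n), g ∘ σ = f := by
  have h1 : List.ofFn (f ∘ Tuple.sort f) = List.ofFn (g ∘ Tuple.sort g) := by
    refine List.Perm.eq_of_pairwise' (r := (· ≤ ·)) ?_ ?_ ?_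
    · exact (List.sortedLE_ofFn_iff.2 (Tuple.monotone_sort f)).pairwise
    · exact (List.sortedLE_ofFn_iff.2 (Tuple.monotone_sort g)).pairwise
    · rw [← Multiset.coe_eq_coe, List.ofFn_eq_map, List.ofFn_eq_map, ← Multiset.map_coe,
        ← Multiset.map_coe]
      have e : ((List.finRange n : List (Fin n)) : Multiset (Fin n)) = Finset.univ.val := rfl
      rw [e, ← Multiset.map_map, ← Multiset.map_map, Multiset.map_univ_val_equiv,
        Multiset.map_univ_val_equiv, h]
  have h2 := List.ofFn_injective h1
  refine ⟨(Tuple.sort f)⁻¹.trans (Tuple.sort g), ?_⟩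
  funext k
  have := congrFun h2 ((Tuple.sort f)⁻¹ k)
  simp only [Function.comp_apply, Equiv.Perm.inv_def, Equiv.apply_symm_apply] at this
  rw [this]; rfl

variable {Q₀ : Type u} [DecidableEq Q₀]

/-- The exponent of `h_m[X^{(j)}]` as a monomial of `QSym`. -/
def hExp (j : Q₀) (m : ℕ) : Q₀ × ℕ →₀ ℕ := if m = 0 then 0 else Finsupp.single (j, m - 1) 1

omit [DecidableEq Q₀] in
theorem hfun_natCast (j : Q₀) (m : ℕ) :
    hfun j (m : ℤ) = MvPolynomial.monomial (hExp j m) 1 := by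
  cases m with
  | zero => simp [hExp]
  | succ m => rw [hfun_natCast_succ]; simp [hExp, MvPolynomial.X]

theorem partsAt_add (d d' : Q₀ × ℕ →₀ ℕ) (i : Q₀) :
    partsAt (d + d') i = partsAt d i + partsAt d' i := by
  have h : ∀ (d : Q₀ × ℕ →₀ ℕ) (S : Finset (Q₀ × ℕ)), d.support ⊆ S → partsAt d i =
      ∑ p ∈ S with p.1 = i, Multiset.replicate (d p) (p.2 + 1) := by
    intro d S hS
    refine Finset.sum_subset (Finset.filter_subset_filter _ hS) fun p hp hp' => ?_
    have : d p = 0 := by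
      by_contra h0
      exact hp' (Finset.mem_filter.2 ⟨Finsupp.mem_support_iff.2 h0, (Finset.mem_filter.1 hp).2⟩)
    rw [this, Multiset.replicate_zero]
  rw [h _ (d.support ∪ d'.support) Finsupp.support_add, h d _ Finset.subset_union_left,
    h d' _ Finset.subset_union_right, ← Finset.sum_add_distrib]
  exact Finset.sum_congr rfl fun p _ => by rw [← Multiset.replicate_add]; rfl

/-- `partsAt` as an additive map in the exponent. -/
def partsAtHom (i : Q₀) : (Q₀ × ℕ →₀ ℕ) →+ Multiset ℕ where
  toFun d := partsAt d i
  map_zero' := by simp [partsAt]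
  map_add' d d' := partsAt_add d d' i

theorem partsAt_hExp (j i : Q₀) (m : ℕ) :
    partsAt (hExp j m) i = if j = i ∧ m ≠ 0 then {m} else 0 := by
  by_cases hm : m = 0
  · simp [hm, hExp, partsAt]
  · rw [hExp, if_neg hm, partsAt, Finsupp.support_single _ one_ne_zero, Finset.filter_singleton]
    by_cases hj : j = i
    · simp [hj, hm, Nat.sub_add_cancel (Nat.one_le_iff_ne_zero.2 hm)]
    · simp [hj]

variable [Fintype Q₀] {ν : Q₀ → ℕ}

/-- The exponent of `h_γ` as a monomial of `QSym`. -/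
def hmonExp (γ : Weight ν) : Q₀ × ℕ →₀ ℕ := ∑ j, ∑ l, hExp j (γ j l).toNat

omit [DecidableEq Q₀] in
theorem hmon_eq_monomial {γ : Weight ν} (h : ∀ j l, 0 ≤ γ j l) :
    hmon γ = MvPolynomial.monomial (hmonExp γ) 1 := by
  rw [hmon, hmonExp, MvPolynomial.monomial_sum_one]
  refine Finset.prod_congr rfl fun j _ => ?_
  rw [MvPolynomial.monomial_sum_one]
  refine Finset.prod_congr rfl fun l _ => ?_
  rw [← hfun_natCast, Int.toNat_of_nonneg (h j l)]

theorem partsAt_hmonExp (γ : Weight ν) (i : Q₀) :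
    partsAt (hmonExp γ) i =
      (Multiset.map (fun l => (γ i l).toNat) Finset.univ.val).filter (· ≠ 0) := by
  have h : partsAt (hmonExp γ) i = ∑ j, ∑ l, partsAt (hExp j (γ j l).toNat) i := by
    change partsAtHom i _ = _
    simp only [hmonExp, map_sum]
    rfl
  rw [h, Finset.sum_eq_single i]
  · have e : ∀ s : Multiset ℕ, s.filter (· ≠ 0) = (s.map fun m => if m ≠ 0 then {m} else 0).sum := by
      intro s
      induction s using Multiset.induction_on with
      | empty => simp
      | cons a s ih => by_cases ha : a = 0 <;> simp_all
    rw [e, Multiset.map_map]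
    refine Finset.sum_congr rfl fun l _ => ?_
    rw [partsAt_hExp]
    simp only [true_and, Function.comp_apply]
  · intro j _ hj
    exact Finset.sum_eq_zero fun l _ => by simp [partsAt_hExp, hj]
  · simp

theorem partitionExp_apply (d : Q₀ × ℕ →₀ ℕ) (j : Q₀) (m : ℕ) :
    partitionExp d (j, m) = ((partsAt d j).sort (· ≥ ·)).getD m 0 := by
  rw [partitionExp, Finsupp.finsetSum_apply, Finset.sum_eq_single j]
  · rw [Finsupp.mapDomain_apply (Prod.mk_right_injective j), List.toFinsupp_apply]
  · intro i _ hi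
    refine Finsupp.mapDomain_of_notMem_range _ _ ?_
    rintro ⟨x, hx⟩
    exact hi (Prod.ext_iff.1 hx).1
  · simp

/-- `partitionExp` sorts the nonzero entries; padding with zeros recovers the multiset of all
entries, so the two differ by a permutation. -/
theorem exists_partitionExp_eq (γ : Weight ν) :
    ∃ w : PermGroup ν, partitionExp (hmonExp γ) = toExp (permWeight w γ) := by
  have key : ∀ j, ∃ σ : Equiv.Perm (Fin (ν j)), (fun l => (γ j l).toNat) ∘ σ =
      fun l : Fin (ν j) => ((partsAt (hmonExp γ) j).sort (· ≥ ·)).getD l 0 := by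
    intro j
    apply exists_perm_of_map_eq
    set s := Multiset.map (fun l => (γ j l).toNat) Finset.univ.val with hs
    have hcard : s.card = ν j := by simp [hs]
    set L := (partsAt (hmonExp γ) j).sort (· ≥ ·) with hL
    have hLs : (L : Multiset ℕ) = s.filter (· ≠ 0) := by
      rw [hL, Multiset.sort_eq, partsAt_hmonExp]
    have hzero : s = s.filter (· ≠ 0) + Multiset.replicate (ν j - L.length) 0 := by
      conv_lhs => rw [← Multiset.filter_add_not (· ≠ 0) s]
      congr 1
      have hc := congrArg Multiset.card (Multiset.filter_add_not (· ≠ 0) s)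
      rw [Multiset.card_add, ← hLs, Multiset.coe_card, hcard] at hc
      rw [Multiset.eq_replicate]
      exact ⟨by omega, fun b hb => not_not.1 (Multiset.mem_filter.1 hb).2⟩
    have hlen : L.length ≤ ν j := by
      rw [← Multiset.coe_card, hLs, ← hcard]
      exact Multiset.card_le_card (Multiset.filter_le _ _)
    rw [hzero, ← hLs, ← Multiset.coe_replicate, Multiset.coe_add]
    have e : ((List.finRange (ν j) : List (Fin (ν j))) : Multiset (Fin (ν j))) =
      Finset.univ.val := rfl
    rw [← e, Multiset.map_coe, ← List.ofFn_eq_map]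
    congr 1
    refine List.ext_getElem (by simp; omega) fun m h1 h2 => ?_
    rw [List.getElem_ofFn]
    by_cases hm : m < L.length
    · rw [List.getElem_append_left hm, List.getD_eq_getElem _ _ hm]
    · rw [List.getElem_append_right (not_lt.1 hm), List.getElem_replicate,
        List.getD_eq_default _ _ (not_lt.1 hm)]
  choose σ hσ using key
  refine ⟨fun j => (σ j)⁻¹, ?_⟩
  ext ⟨j, m⟩
  rw [partitionExp_apply, toExp_apply]
  split_ifs with hm
  · have := congrFun (hσ j) ⟨m, hm⟩
    simp only [Function.comp_apply] at this
    rw [← this, permWeight_apply, inv_inv]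
  · apply List.getD_eq_default
    rw [Multiset.length_sort, partsAt_hmonExp]
    refine (Multiset.card_le_card (Multiset.filter_le _ _)).trans ?_
    simpa using hm

omit [DecidableEq Q₀] in
theorem hall_add_left [DecidableEq Q₀] (f f' g : QSym Q₀) :
    hall (f + f') g = hall f g + hall f' g := by
  simp [hall, mul_add, Finset.sum_add_distrib]

theorem hall_smul_left (r : LaurentQT) (f g : QSym Q₀) : hall (r • f) g = r * hall f g := by
  simp [hall, Finset.mul_sum, mul_left_comm]

theorem hall_eq_sum (f g : QSym Q₀) : hall f g = Finsupp.sum (AddMonoidAlgebra.coeff g)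
    fun d r => r * MvPowerSeries.coeff (partitionExp d) (expand f) := rfl

theorem hall_add_right (f g g' : QSym Q₀) : hall f (g + g') = hall f g + hall f g' := by
  classical
  rw [hall_eq_sum, hall_eq_sum, hall_eq_sum]
  exact Finsupp.sum_add_index' (fun _ => zero_mul _) fun _ _ _ => add_mul _ _ _

theorem hall_smul_right (r : LaurentQT) (f g : QSym Q₀) : hall f (r • g) = r * hall f g := by
  rw [hall_eq_sum, hall_eq_sum, Finsupp.mul_sum]
  refine (Finsupp.sum_smul_index' (g := AddMonoidAlgebra.coeff g) (b := r)
    (h := fun d r => r * MvPowerSeries.coeff (partitionExp d) (expand f))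
    fun _ => zero_mul _).trans ?_
  exact Finsupp.sum_congr fun d _ => by rw [smul_eq_mul, mul_assoc]

/-- The Hall scalar product as a bilinear map. -/
def hallBilin : QSym Q₀ →ₗ[LaurentQT] QSym Q₀ →ₗ[LaurentQT] LaurentQT :=
  LinearMap.mk₂ LaurentQT hall hall_add_left hall_smul_left hall_add_right hall_smul_right

theorem hallBilin_apply (f g : QSym Q₀) : hallBilin f g = hall f g := rfl

/-- The duality of `h` and `m` read in a finite alphabet: sorting `γ` does not matter since `ev ν f`
is symmetric, and with a negative entry both sides vanish. -/
theorem hall_hmon (f : QSym Q₀) (γ : Weight ν) : hall f (hmon γ) = (ev ν f).coeff γ := by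
  classical
  by_cases h : ∀ j l, 0 ≤ γ j l
  · obtain ⟨w, hw⟩ := exists_partitionExp_eq γ
    have h' : ∀ j l, 0 ≤ permWeight w γ j l := fun j l => h j _
    rw [← coeff_ev_permWeight w, coeff_ev_eq, if_pos h', ← hw, hmon_eq_monomial h,
      hall_eq_sum]
    refine (Finsupp.sum_single_index ?_).trans (one_mul _)
    exact zero_mul _
  · rw [coeff_ev_eq, if_neg h]
    push Not at h
    obtain ⟨j, l, hjl⟩ := h
    rw [hmon_of_neg hjl, ← hallBilin_apply, map_zero]

omit [DecidableEq Q₀] in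
theorem hmon_inclU_mul_hmon_inclV {α β : Q₀ → ℕ} (κ : Weight α) (η : Weight β) :
    hmon κ * hmon η = hmon (inclU α β κ + inclV α β η) := by
  rw [hmon_add]
  simp

/-- The number of variables is allowed to grow with the monomial, so the `h_γ` exhaust the monomial
basis and suffice for comparing linear maps. -/
theorem exists_hmon_eq_monomial (d : Q₀ × ℕ →₀ ℕ) :
    ∃ (ν : Q₀ → ℕ) (γ : Weight ν), MvPolynomial.monomial d (1 : LaurentQT) = hmon γ := by
  induction d using Finsupp.induction_linear with
  | zero => exact ⟨0, 0, by simp [hmon]⟩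
  | add d d' h h' =>
    obtain ⟨ν, γ, h⟩ := h
    obtain ⟨ν', γ', h'⟩ := h'
    refine ⟨ν + ν', inclU ν ν' γ + inclV ν ν' γ', ?_⟩
    rw [← hmon_inclU_mul_hmon_inclV, ← h, ← h', MvPolynomial.monomial_mul, one_mul]
  | single p n =>
    obtain ⟨j, m⟩ := p
    refine ⟨Pi.single j n, fun _ _ => (m + 1 : ℕ), ?_⟩
    rw [hmon, Finset.prod_eq_single j]
    · simp only [hfun_natCast_succ, Finset.prod_const, Finset.card_univ, Fintype.card_fin,
        Pi.single_eq_same]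
      rw [MvPolynomial.X_pow_eq_monomial]
    · intro i _ hi
      rw [Finset.prod_const, Finset.card_univ, Fintype.card_fin, Pi.single_eq_of_ne hi, pow_zero]
    · simp

theorem linearMap_ext_hmon {M : Type*} [AddCommMonoid M] [Module LaurentQT M]
    {F G : QSym Q₀ →ₗ[LaurentQT] M}
    (h : ∀ (ν : Q₀ → ℕ) (γ : Weight ν), F (hmon γ) = G (hmon γ)) : F = G := by
  refine (MvPolynomial.basisMonomials (Q₀ × ℕ) LaurentQT).ext fun d => ?_
  obtain ⟨ν, γ, e⟩ := exists_hmon_eq_monomial d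
  rw [MvPolynomial.coe_basisMonomials]
  simp only [e, h]

theorem ev_hmon {ν' : Q₀ → ℕ} (γ : Weight ν) : ev ν' (hmon γ) =
    ∏ j, ∏ l, completeZ (var (ν := ν') LaurentQT j) (γ j l) := by
  simp only [hmon, map_prod, ev_hfun]

theorem ev_hmon_natCast {ν' : Q₀ → ℕ} (γ : (j : Q₀) → Fin (ν j) → ℕ) :
    ev ν' (hmon (fun j l => (γ j l : ℤ) : Weight ν)) =
      ∑ P ∈ Fintype.piFinset fun j => Fintype.piFinset fun l =>
        Finset.finsuppAntidiag (Finset.univ : Finset (Fin (ν' j))) (γ j l),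
        single (fun j m => ((∑ l, P j l m : ℕ) : ℤ) : Weight ν') 1 := by
  rw [ev_hmon]
  simp only [completeZ_natCast, coeff_completeSeries, Finset.prod_univ_sum]
  refine Finset.sum_congr rfl fun P _ => ?_
  rw [← prod_var_pow]
  refine Finset.prod_congr rfl fun j _ => ?_
  rw [Finset.prod_comm]
  exact Finset.prod_congr rfl fun m _ => Finset.prod_pow_eq_pow_sum _ _ _

/-- Both sides count families of nonnegative integer matrices with prescribed row and column sums;
transposition exchanges them. -/
theorem coeff_ev_hmon_natCast_comm {ν' : Q₀ → ℕ} (γ : (j : Q₀) → Fin (ν j) → ℕ)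
    (η : (j : Q₀) → Fin (ν' j) → ℕ) :
    (ev ν' (hmon (fun j l => (γ j l : ℤ) : Weight ν))).coeff (fun j m => (η j m : ℤ)) =
      (ev ν (hmon (fun j l => (η j l : ℤ) : Weight ν'))).coeff (fun j m => (γ j m : ℤ)) := by
  classical
  rw [ev_hmon_natCast, ev_hmon_natCast]
  simp only [AddMonoidAlgebra.coeff_sum, Finsupp.finsetSum_apply, AddMonoidAlgebra.coeff_single,
    Finsupp.single_apply, ← Finset.sum_filter]
  refine Finset.sum_bij'
    (fun P _ j m => Finsupp.equivFunOnFinite.symm fun l => P j l m)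
    (fun P _ j l => Finsupp.equivFunOnFinite.symm fun m => P j m l) ?_ ?_ ?_ ?_ ?_
  all_goals
    simp only [Finset.mem_filter, Fintype.mem_piFinset, Finset.mem_finsuppAntidiag, funext_iff,
      Nat.cast_inj]
  · rintro P ⟨h1, h2⟩
    exact ⟨fun j m => ⟨h2 j m, Finset.subset_univ _⟩, fun j l => (h1 j l).1⟩
  · rintro P ⟨h1, h2⟩
    exact ⟨fun j m => ⟨h2 j m, Finset.subset_univ _⟩, fun j l => (h1 j l).1⟩
  · intro P _ j l
    ext m
    rfl
  · intro P _ j l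
    ext m
    rfl
  · exact fun _ _ => trivial

theorem coeff_ev_hmon_comm {ν' : Q₀ → ℕ} (γ : Weight ν) (η : Weight ν') :
    (ev ν' (hmon γ)).coeff η = (ev ν (hmon η)).coeff γ := by
  classical
  have hneg : ∀ {ν ν' : Q₀ → ℕ} (γ : Weight ν) (η : Weight ν'), ¬ (∀ j l, 0 ≤ γ j l) →
      (ev ν' (hmon γ)).coeff η = (ev ν (hmon η)).coeff γ := by
    intro ν ν' γ η h
    rw [coeff_ev_eq _ γ, if_neg h]
    push Not at h
    obtain ⟨j, l, hjl⟩ := h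
    rw [hmon_of_neg hjl, map_zero]
    rfl
  by_cases hγ : ∀ j l, 0 ≤ γ j l
  · by_cases hη : ∀ j l, 0 ≤ η j l
    · have h1 : γ = fun j l => ((γ j l).toNat : ℤ) := by
        funext j l; exact (Int.toNat_of_nonneg (hγ j l)).symm
      have h2 : η = fun j l => ((η j l).toNat : ℤ) := by
        funext j l; exact (Int.toNat_of_nonneg (hη j l)).symm
      rw [h1, h2]
      exact coeff_ev_hmon_natCast_comm _ _
    · exact (hneg η γ hη).symm
  · exact hneg γ η hγ

theorem hall_comm (f g : QSym Q₀) : hall f g = hall g f := by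
  have h : hallBilin (Q₀ := Q₀) = hallBilin.flip := by
    refine linearMap_ext_hmon fun ν γ => linearMap_ext_hmon fun ν' η => ?_
    rw [LinearMap.flip_apply, hallBilin_apply, hallBilin_apply, hall_hmon, hall_hmon,
      coeff_ev_hmon_comm]
  exact congrArg (fun B => B f g) h

/-- `⟨h_γ, g⟩` is the constant term of `x^γ g(x⁻¹)`. In this form multiplication by `f` in the
second argument moves to multiplication by `f(x⁻¹)` in the first. -/
theorem hall_hlin (p : AddMonoidAlgebra LaurentQT (Weight ν)) (g : QSym Q₀) :
    hall (hlin ν p) g = (p * evInv ν g).coeff 0 := by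
  rw [← hallBilin_apply]
  induction p using AddMonoidAlgebra.induction_linear with
  | zero => simp
  | add p q hp hq => rw [map_add, map_add, LinearMap.add_apply, hp, hq, add_mul]; rfl
  | single γ r =>
    rw [hlin_single, map_smul, LinearMap.smul_apply, hallBilin_apply, hall_comm, hall_hmon,
      AddMonoidAlgebra.coeff_single_mul_apply, coeff_evInv, add_zero, neg_neg, smul_eq_mul]

theorem hall_hlin_mul_evInv (p : AddMonoidAlgebra LaurentQT (Weight ν)) (f g : QSym Q₀) :
    hall (hlin ν (p * evInv ν f)) g = hall (hlin ν p) (f * g) := by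
  rw [hall_hlin, hall_hlin, map_mul, mul_assoc]

/-- Guarantees that `perp` is a genuine adjoint and not its default value `0`. The adjoint is
prescribed on the monomial basis, one alphabet for each monomial. -/
theorem exists_hall_adjoint (f : QSym Q₀) :
    ∃ A : QSym Q₀ →ₗ[LaurentQT] QSym Q₀, ∀ g k, hall (A g) k = hall g (f * k) := by
  choose ν γ h using exists_hmon_eq_monomial (Q₀ := Q₀)
  let A : QSym Q₀ →ₗ[LaurentQT] QSym Q₀ :=
    (MvPolynomial.basisMonomials (Q₀ × ℕ) LaurentQT).constr LaurentQT
      fun d => hlin (ν d) (single (γ d) 1 * evInv (ν d) f)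
  refine ⟨A, fun g k => ?_⟩
  have e : hallBilin.comp A = (hallBilin.flip.comp (LinearMap.mulLeft LaurentQT f)).flip := by
    refine (MvPolynomial.basisMonomials (Q₀ × ℕ) LaurentQT).ext fun d => LinearMap.ext fun k => ?_
    rw [LinearMap.comp_apply, Module.Basis.constr_basis, hallBilin_apply, hall_hlin_mul_evInv,
      LinearMap.flip_apply, LinearMap.comp_apply, LinearMap.flip_apply, hallBilin_apply,
      LinearMap.mulLeft_apply, MvPolynomial.coe_basisMonomials]
    simp only [h, hlin_single, one_smul]
  exact congrArg (fun B => B g k) e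

theorem hall_perp (f g k : QSym Q₀) : hall (perp f g) k = hall g (f * k) := by
  rw [perp, dif_pos (exists_hall_adjoint f)]
  exact (exists_hall_adjoint f).choose_spec g k

end HallProduct

/-! ### Translation operators on functions -/

section Action

variable {k G : Type*} [CommRing k] [AddCommGroup G]

/-- The convolution action of Laurent polynomials on arbitrary functions of the exponent. -/
def act : AddMonoidAlgebra k G →ₐ[k] Module.End k (G → k) :=
  AddMonoidAlgebra.lift k (Module.End k (G → k)) G
    { toFun := fun κ => LinearMap.funLeft k k fun γ => γ - κ.toAdd
      map_one' := by ext F γ; simp [LinearMap.funLeft_apply]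
      map_mul' := fun κ κ' => by
        ext F γ
        simp [LinearMap.funLeft_apply, Module.End.mul_apply, sub_sub] }

theorem act_single (κ : G) (r : k) (F : G → k) (γ : G) :
    act (single κ r) F γ = r * F (γ - κ) := by
  simp [act, LinearMap.funLeft_apply]

theorem act_one_sub_single (κ : G) (r : k) (F : G → k) (γ : G) :
    act (1 - single κ r) F γ = F γ - r * F (γ - κ) := by
  rw [map_sub, map_one, LinearMap.sub_apply, Pi.sub_apply, act_single]; rfl

/-- The inverse is the geometric series `∑ F(γ - nκ)`. It is finite at each `γ` because `φ`
decreases along it and `F` vanishes where `φ` is below `C`. -/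
theorem exists_act_one_sub_single_eq (φ : G →+ ℤ) {κ : G} (hκ : 0 < φ κ) (C : ℤ) (F : G → k)
    (hF : ∀ γ, φ γ < C → F γ = 0) :
    ∃ F' : G → k, (∀ γ, φ γ < C → F' γ = 0) ∧ act (1 - single κ 1) F' = F := by
  have hN : ∀ γ (N N' : ℕ), (φ γ - C + 1).toNat ≤ N → N ≤ N' →
      ∑ n ∈ Finset.range N, F (γ - n • κ) = ∑ n ∈ Finset.range N', F (γ - n • κ) := by
    intro γ N N' h1 h2
    refine Finset.sum_subset (Finset.range_mono h2) fun n _ hn => hF _ ?_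
    rw [Finset.mem_range, not_lt] at hn
    rw [map_sub, map_nsmul, nsmul_eq_mul]
    have h3 : (n : ℤ) ≤ n * φ κ := le_mul_of_one_le_right (by positivity) hκ
    omega
  refine ⟨fun γ => ∑ n ∈ Finset.range (φ γ - C + 1).toNat, F (γ - n • κ), fun γ hγ => ?_, ?_⟩
  · beta_reduce
    rw [show (φ γ - C + 1).toNat = 0 by omega, Finset.range_zero, Finset.sum_empty]
  · funext γ
    rw [act_one_sub_single, one_mul]
    set N := (φ γ - C + 1).toNat + (φ (γ - κ) - C + 1).toNat with hNdef
    rw [hN γ _ (N + 1) le_rfl (by omega), hN (γ - κ) _ N le_rfl (by omega),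
      Finset.sum_range_succ']
    have : ∀ n : ℕ, γ - (n + 1) • κ = γ - κ - n • κ := fun n => by rw [succ_nsmul]; abel
    simp [this]

theorem exists_act_prod_eq {ι : Type*} (s : Finset ι) (φ : G →+ ℤ) (κ : ι → G)
    (hκ : ∀ i ∈ s, 0 < φ (κ i)) (C : ℤ) (F : G → k) (hF : ∀ γ, φ γ < C → F γ = 0) :
    ∃ F' : G → k, (∀ γ, φ γ < C → F' γ = 0) ∧ act (∏ i ∈ s, (1 - single (κ i) 1)) F' = F := by
  classical
  induction s using Finset.induction_on generalizing F with
  | empty => exact ⟨F, hF, by simp⟩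
  | insert i s hi ih =>
    obtain ⟨F1, h1, e1⟩ := exists_act_one_sub_single_eq φ (hκ i (Finset.mem_insert_self _ _)) C F hF
    obtain ⟨F2, h2, e2⟩ := ih (fun i' h => hκ i' (Finset.mem_insert_of_mem h)) F1 h1
    refine ⟨F2, h2, ?_⟩
    rw [Finset.prod_insert hi, map_mul, Module.End.mul_apply, e2, e1]

end Action

/-! ### Schur functions -/

section SchurFunctions

variable {Q₀ : Type u} [DecidableEq Q₀] [Fintype Q₀] {ν : Q₀ → ℕ}

/-- The Jacobi-Trudi determinant of an arbitrary weight. -/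
def schurZ (γ : Weight ν) : QSym Q₀ :=
  ∏ j, Matrix.det (Matrix.of fun r s : Fin (ν j) => hfun j (γ j r - (r : ℕ) + (s : ℕ)))

-- The row of an empty part is zero except for the diagonal entry `f 0 = 1`, so expansion along the
-- last row removes it.
omit [DecidableEq Q₀] [Fintype Q₀] in
theorem det_young_eq {A : Type*} [CommRing A] (f : ℤ → A) (hf : f 0 = 1)
    (hf' : ∀ m, m < 0 → f m = 0) (μ : YoungDiagram) {n : ℕ} (h : μ.colLen 0 ≤ n) :
    Matrix.det (Matrix.of fun r s : Fin n => f ((μ.rowLen r : ℤ) - (r : ℕ) + (s : ℕ))) =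
      Matrix.det (Matrix.of fun r s : Fin (μ.colLen 0) =>
        f ((μ.rowLen r : ℤ) - (r : ℕ) + (s : ℕ))) := by
  induction n, h using Nat.le_induction with
  | base => rfl
  | succ n h ih =>
    rw [← ih, Matrix.det_succ_row _ (Fin.last n), Fin.sum_univ_castSucc, Finset.sum_eq_zero,
      zero_add]
    · have h0 : μ.rowLen n = 0 := by
        by_contra h0
        have : (n, 0) ∈ μ := YoungDiagram.mem_iff_lt_rowLen.2 (Nat.pos_of_ne_zero h0)
        exact absurd (YoungDiagram.mem_iff_lt_colLen.1 this) (not_lt.2 h)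
      rw [Matrix.of_apply]
      simp only [Fin.val_last, h0, Nat.cast_zero, zero_sub, neg_add_cancel, hf, mul_one]
      rw [Even.neg_one_pow ⟨n, rfl⟩, one_mul]
      congr 1
      ext r s
      simp
    · intro s _
      have h0 : μ.rowLen n = 0 := by
        by_contra h0
        have : (n, 0) ∈ μ := YoungDiagram.mem_iff_lt_rowLen.2 (Nat.pos_of_ne_zero h0)
        exact absurd (YoungDiagram.mem_iff_lt_colLen.1 this) (not_lt.2 h)
      have := s.2
      rw [Matrix.of_apply, hf', mul_zero, zero_mul]
      simp only [Fin.val_last, h0, Fin.val_castSucc]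
      omega

omit [DecidableEq Q₀] in
theorem schurZ_youngWeight {lam : Q₀ → YoungDiagram} (h : ∀ j, (lam j).colLen 0 ≤ ν j) :
    schurZ (youngWeight ν lam).1 = schurFun lam :=
  Finset.prod_congr rfl fun j _ =>
    det_young_eq (hfun j) (hfun_zero j) (fun _ => hfun_of_neg j) (lam j) (h j)

theorem schurZ_eq_sum (γ : Weight ν) :
    schurZ γ = ∑ w : PermGroup ν, sgn w • hmon (γ + rho ν - permWeight w (rho ν)) := by
  have h : ∀ j, Matrix.det (Matrix.of fun r s : Fin (ν j) =>
      hfun j (γ j r - (r : ℕ) + (s : ℕ))) = ∑ σ : Equiv.Perm (Fin (ν j)),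
      ((Equiv.Perm.sign σ : ℤ) : QSym Q₀) * ∏ r, hfun j (γ j r - (r : ℕ) + (σ⁻¹ r : ℕ)) := by
    intro j
    rw [← Matrix.det_transpose, Matrix.det_apply']
    refine Fintype.sum_equiv (Equiv.inv _) _ _ fun σ => ?_
    simp
  rw [schurZ]
  simp only [h]
  rw [Finset.prod_univ_sum, Fintype.piFinset_univ]
  refine Finset.sum_congr rfl fun w _ => ?_
  rw [Finset.prod_mul_distrib, zsmul_eq_mul, sgn]
  congr 1
  · simp
  · refine Finset.prod_congr rfl fun j _ => Finset.prod_congr rfl fun r _ => ?_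
    congr 1
    simp only [Pi.sub_apply, Pi.add_apply, permWeight_apply, rho]
    ring

theorem alt_rho_mul_ev_schurZ {γ : Weight ν} (h : ∀ j l, 0 ≤ (γ + rho ν) j l) :
    alt LaurentQT (rho ν) * ev ν (schurZ γ) = alt LaurentQT (γ + rho ν) := by
  rw [alt_eq_alt_rho_mul _ _ h, schurZ, map_prod]
  congr 1
  refine Finset.prod_congr rfl fun j _ => ?_
  rw [AlgHom.map_det]
  congr 1
  ext1 r s
  rw [AlgHom.mapMatrix_apply, Matrix.map_apply, Matrix.of_apply, Matrix.of_apply, ev_hfun]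
  congr 1
  simp only [Pi.add_apply, rho]
  ring

omit [DecidableEq Q₀] [Fintype Q₀] in
theorem rho_nonneg (j : Q₀) (l : Fin (ν j)) : 0 ≤ rho ν j l := by
  have := l.2
  simp only [rho]; omega

theorem schurZ_sub_rho_eq_sum (κ : Weight ν) :
    schurZ (κ - rho ν) = ∑ w : PermGroup ν, sgn w • hmon (κ - permWeight w (rho ν)) := by
  rw [schurZ_eq_sum, sub_add_cancel]

/-- The straightening rule: after the shift by `ρ`, permuting the weight permutes the rows of the
Jacobi-Trudi determinants. -/
theorem schurZ_permWeight_sub_rho (w : PermGroup ν) (κ : Weight ν) :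
    schurZ (permWeight w κ - rho ν) = sgn w • schurZ (κ - rho ν) := by
  rw [schurZ_sub_rho_eq_sum, schurZ_sub_rho_eq_sum, Finset.smul_sum]
  refine Fintype.sum_equiv (Equiv.mulLeft w⁻¹) _ _ fun w' => ?_
  rw [Equiv.coe_mulLeft, sgn_mul, sgn_inv, smul_smul, ← mul_assoc, sgn_mul_self, one_mul]
  congr 1
  rw [← hmon_permWeight w⁻¹, map_sub, permWeight_inv_permWeight, permWeight_mul]

/-! #### Young diagrams and dominant weights -/

omit [DecidableEq Q₀] [Fintype Q₀] in
theorem exists_youngWeight_eq {γ : Weight ν} (h : ∀ j, Antitone (γ j)) (h' : ∀ j l, 0 ≤ γ j l) :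
    ∃ lam : Q₀ → YoungDiagram, (∀ j, (lam j).colLen 0 ≤ ν j) ∧ (youngWeight ν lam).1 = γ := by
  have hs : ∀ j, (List.ofFn fun l => (γ j l).toNat).SortedGE := fun j =>
    List.sortedGE_ofFn_iff.2 fun k l hkl => Int.toNat_le_toNat (h j hkl)
  refine ⟨fun j => YoungDiagram.ofRowLens _ (hs j), fun j => ?_, ?_⟩
  · by_contra hlt
    have h1 := YoungDiagram.mem_ofRowLens.1 (YoungDiagram.mem_iff_lt_colLen.2 (not_le.1 hlt))
    obtain ⟨h2, -⟩ := h1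
    simp at h2
  · funext j l
    have := YoungDiagram.rowLen_ofRowLens (hw := hs j) ⟨l, by simp⟩
    simp only [youngWeight]
    rw [this]
    simpa using h' j l

omit [DecidableEq Q₀] [Fintype Q₀] in
theorem youngWeight_injOn {lam lam' : Q₀ → YoungDiagram} (h : ∀ j, (lam j).colLen 0 ≤ ν j)
    (h' : ∀ j, (lam' j).colLen 0 ≤ ν j)
    (e : (youngWeight ν lam).1 = (youngWeight ν lam').1) : lam = lam' := by
  funext j
  have hrow : ∀ r, (lam j).rowLen r = (lam' j).rowLen r := by
    intro r
    by_cases hr : r < ν j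
    · have := congrFun (congrFun e j) ⟨r, hr⟩
      simpa [youngWeight] using this
    · have h0 : ∀ μ : YoungDiagram, μ.colLen 0 ≤ ν j → μ.rowLen r = 0 := by
        intro μ hμ
        by_contra h0
        have h1 := YoungDiagram.mem_iff_lt_colLen.1
          (YoungDiagram.mem_iff_lt_rowLen.2 (Nat.pos_of_ne_zero h0))
        omega
      rw [h0 _ (h j), h0 _ (h' j)]
  ext ⟨r, c⟩
  rw [YoungDiagram.mem_cells, YoungDiagram.mem_cells, YoungDiagram.mem_iff_lt_rowLen,
    YoungDiagram.mem_iff_lt_rowLen, hrow]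

-- The last entry of `ρ` is `0`, so the weakly decreasing `κ - ρ` is bounded below by the last entry
-- of `κ`.
omit [DecidableEq Q₀] [Fintype Q₀] in
theorem nonneg_sub_rho {κ : Weight ν} (h : IsStrict κ) (h' : ∀ j l, 0 ≤ κ j l) (j : Q₀)
    (l : Fin (ν j)) : 0 ≤ (κ - rho ν) j l := by
  have h0 : 0 < ν j := l.pos
  have h1 : l ≤ ⟨ν j - 1, by omega⟩ := Fin.le_def.2 (by have := l.2; simp only; omega)
  refine le_trans ?_ (antitone_sub_rho h j h1)
  have := h' j ⟨ν j - 1, by omega⟩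
  simp only [Pi.sub_apply, rho]
  omega

omit [DecidableEq Q₀] [Fintype Q₀] in
theorem exists_youngWeight_add_rho_eq {κ : Weight ν} (h : IsStrict κ) (h' : ∀ j l, 0 ≤ κ j l) :
    ∃ lam : Q₀ → YoungDiagram, (∀ j, (lam j).colLen 0 ≤ ν j) ∧
      (youngWeight ν lam).1 + rho ν = κ := by
  obtain ⟨lam, h1, h2⟩ := exists_youngWeight_eq (antitone_sub_rho h) (nonneg_sub_rho h h')
  exact ⟨lam, h1, by rw [h2, sub_add_cancel]⟩

/-! #### Summation of a function against the products `h_γ` -/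

/-- The sum of the entries of a weight. -/
def size : Weight ν →+ ℤ where
  toFun γ := ∑ j, ∑ l, γ j l
  map_zero' := by simp
  map_add' γ γ' := by simp [Finset.sum_add_distrib]

omit [DecidableEq Q₀] in
theorem size_permWeight (w : PermGroup ν) (γ : Weight ν) : size (permWeight w γ) = size γ :=
  Finset.sum_congr rfl fun j _ => Equiv.sum_comp (w j)⁻¹ fun l => γ j l

/-- The nonnegative weights of size `n`. -/
def comps (ν : Q₀ → ℕ) (n : ℤ) : Finset (Weight ν) :=
  (Fintype.piFinset fun _ => Fintype.piFinset fun _ => Finset.Icc 0 n).filter fun γ => size γ = n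

theorem mem_comps {n : ℤ} {γ : Weight ν} : γ ∈ comps ν n ↔ (∀ j l, 0 ≤ γ j l) ∧ size γ = n := by
  simp only [comps, Finset.mem_filter, Fintype.mem_piFinset, Finset.mem_Icc]
  refine ⟨fun h => ⟨fun j l => (h.1 j l).1, h.2⟩, fun h => ⟨fun j l => ⟨h.1 j l, ?_⟩, h.2⟩⟩
  rw [← h.2]
  exact (Finset.single_le_sum (f := fun l => γ j l) (fun l _ => h.1 j l) (Finset.mem_univ l)).trans
    (Finset.single_le_sum (f := fun j => ∑ l, γ j l)
      (fun j _ => Finset.sum_nonneg fun l _ => h.1 j l) (Finset.mem_univ j))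

/-- The sum `∑ F(γ) h_γ` over the weights of size `n`. -/
def hsum (ν : Q₀ → ℕ) (n : ℤ) : (Weight ν → LaurentQT) →ₗ[LaurentQT] QSym Q₀ where
  toFun F := ∑ γ ∈ comps ν n, F γ • hmon γ
  map_add' F F' := by simp [add_smul, Finset.sum_add_distrib]
  map_smul' r F := by simp [mul_smul, Finset.smul_sum]

theorem hsum_apply (n : ℤ) (F : Weight ν → LaurentQT) :
    hsum ν n F = ∑ γ ∈ comps ν n, F γ • hmon γ := rfl

theorem act_alt_neg_rho (G : Weight ν → LaurentQT) (γ : Weight ν) :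
    act (alt LaurentQT (-rho ν)) G γ =
      ∑ w : PermGroup ν, sgn w • G (γ + permWeight w (rho ν)) := by
  rw [alt, map_sum, LinearMap.sum_apply, Finset.sum_apply]
  refine Finset.sum_congr rfl fun w _ => ?_
  rw [map_zsmul, LinearMap.smul_apply, Pi.smul_apply, act_single, map_neg, sub_neg_eq_add, one_mul]

/-- The Schur expansion of `∑_γ (a_{-ρ} G)(γ) h_γ`. -/
theorem hsum_act_alt (n : ℤ) (G : Weight ν → LaurentQT) [DecidablePred (IsStrict (ν := ν))] :
    hsum ν n (act (alt LaurentQT (-rho ν)) G) =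
      ∑ κ ∈ comps ν (n + size (rho ν)) with IsStrict κ,
        (∑ w : PermGroup ν, sgn w • G (permWeight w κ)) • schurZ (κ - rho ν) := by
  classical
  -- The substitution `κ = γ + wρ` moves the alternant from `G` to the `h_γ`, producing Jacobi-Trudi
  -- determinants. The extra `κ` on the right give an `h` of negative index, hence zero.
  have h1 : hsum ν n (act (alt LaurentQT (-rho ν)) G) =
      ∑ κ ∈ comps ν (n + size (rho ν)), G κ • schurZ (κ - rho ν) := by
    rw [hsum_apply]
    simp only [act_alt_neg_rho, schurZ_sub_rho_eq_sum, Finset.sum_smul, Finset.smul_sum]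
    rw [Finset.sum_comm]
    conv_rhs => rw [Finset.sum_comm]
    refine Finset.sum_congr rfl fun w _ => ?_
    symm
    have hinj : Function.Injective fun γ : Weight ν => γ + permWeight w (rho ν) :=
      add_left_injective _
    rw [← Finset.sum_subset (s₁ := (comps ν n).image fun γ => γ + permWeight w (rho ν))]
    · rw [Finset.sum_image hinj.injOn]
      refine Finset.sum_congr rfl fun γ _ => ?_
      rw [add_sub_cancel_right, smul_assoc, smul_comm]
    · intro κ hκ
      obtain ⟨γ, hγ, rfl⟩ := Finset.mem_image.1 hκ
      rw [mem_comps] at hγ ⊢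
      refine ⟨fun j l => add_nonneg (hγ.1 j l) (rho_nonneg j _), ?_⟩
      rw [map_add, size_permWeight, hγ.2]
    · intro κ hκ hκ'
      have h2 : ¬ ∀ j l, 0 ≤ (κ - permWeight w (rho ν)) j l := by
        intro h3
        refine hκ' (Finset.mem_image.2 ⟨κ - permWeight w (rho ν), mem_comps.2 ⟨h3, ?_⟩,
          sub_add_cancel _ _⟩)
        rw [map_sub, size_permWeight, (mem_comps.1 hκ).2, add_sub_cancel_right]
      push Not at h2
      obtain ⟨j, l, hjl⟩ := h2
      rw [hmon_of_neg hjl, smul_zero, smul_zero]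
  rw [h1, sum_eq_sum_isStrict]
  · refine Finset.sum_congr (by ext; simp) fun κ _ => ?_
    rw [Finset.sum_smul]
    refine Finset.sum_congr rfl fun w _ => ?_
    rw [schurZ_permWeight_sub_rho, smul_assoc, smul_comm]
  · intro w γ h
    rw [mem_comps] at h ⊢
    exact ⟨fun j l => h.1 j _, by rw [size_permWeight, h.2]⟩
  · intro γ h
    rw [eq_zero_of_antisymm (fun κ => schurZ (κ - rho ν)) schurZ_permWeight_sub_rho h, smul_zero]

/-! #### The Vandermonde product -/

/-- The product `∏_j ∏_{k < l} (1 - x_k^{(j)} / x_l^{(j)})`. -/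
def vandInv (R : Type*) [CommRing R] (ν : Q₀ → ℕ) : AddMonoidAlgebra R (Weight ν) :=
  ∏ j, ∏ k, ∏ l ∈ Finset.Ioi k, (1 - single (varWeight j k - varWeight j l) 1)

/-- The Vandermonde determinant: up to a constant at each vertex, `-ρ` is the exponent sequence `0,
1, 2, …`. -/
theorem alt_neg_rho (R : Type*) [CommRing R] :
    alt R (-rho ν) = single (-rho ν) 1 * vandInv R ν := by
  have h1 : -rho ν = (fun j (k : Fin (ν j)) => (((k : ℕ) : ℕ) : ℤ)) + fun j _ => 1 - (ν j : ℤ) := by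
    funext j k
    simp only [Pi.neg_apply, Pi.add_apply, rho]; ring
  have h2 : ∀ j, Matrix.det (Matrix.of fun k l : Fin (ν j) => var R j k ^ (l : ℕ)) =
      ∏ k, ∏ l ∈ Finset.Ioi k, (var R j l *
        (1 - single (varWeight j k - varWeight j l) 1)) := by
    intro j
    rw [show (Matrix.of fun k l : Fin (ν j) => var R j k ^ (l : ℕ)) =
      Matrix.vandermonde (var R j) from rfl, Matrix.det_vandermonde]
    refine Finset.prod_congr rfl fun k _ => Finset.prod_congr rfl fun l _ => ?_
    rw [mul_sub, mul_one, var, var, AddMonoidAlgebra.single_mul_single, one_mul,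
      add_sub_cancel]
  have h3 : ∀ j, ∏ k : Fin (ν j), ∏ l ∈ Finset.Ioi k, var R j l =
      ∏ l : Fin (ν j), var R j l ^ (l : ℕ) := by
    intro j
    rw [Finset.prod_comm' (t' := Finset.univ) (s' := fun l => Finset.Iio l) (by simp)]
    exact Finset.prod_congr rfl fun l _ => by rw [Finset.prod_const, Fin.card_Iio]
  conv_lhs => rw [h1]
  rw [alt_add_const, alt_eq_prod_det R fun j (k : Fin (ν j)) => (k : ℕ)]
  simp only [h2, Finset.prod_mul_distrib, h3]
  rw [← vandInv, prod_var_pow R fun j (k : Fin (ν j)) => (k : ℕ), ← mul_assoc,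
    AddMonoidAlgebra.single_mul_single, one_mul, h1, add_comm]

/-- Inverts the Vandermonde product as a formal series, so that each `h_γ` can be expanded in Schur
functions. -/
theorem exists_act_alt_neg_rho_eq (γ : Weight ν) :
    ∃ G : Weight ν → LaurentQT, act (alt LaurentQT (-rho ν)) G = Pi.single γ 1 := by
  classical
  -- Pairing with `ρ` is positive on every ratio `x_k / x_l` with `k < l`, so all geometric series
  -- run in one direction.
  let φ : Weight ν →+ ℤ :=
    { toFun := fun γ => ∑ j, ∑ l, rho ν j l * γ j l
      map_zero' := by simp
      map_add' := fun γ γ' => by simp [mul_add, Finset.sum_add_distrib] }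
  have hφ : ∀ j k, φ (varWeight j k) = rho ν j k := by
    intro j k
    change ∑ i, ∑ l, rho ν i l * varWeight j k i l = _
    rw [Finset.sum_eq_single j]
    · simp [varWeight, Pi.single_apply]
    · intro i _ hi
      simp [varWeight, hi]
    · simp
  let s : Finset (Σ j, Fin (ν j) × Fin (ν j)) := Finset.univ.filter fun p => p.2.1 < p.2.2
  have hs : vandInv LaurentQT ν =
      ∏ p ∈ s, (1 - single (varWeight p.1 p.2.1 - varWeight p.1 p.2.2) 1) := by
    rw [Finset.prod_filter, Fintype.prod_sigma]
    refine Finset.prod_congr rfl fun j _ => ?_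
    rw [Fintype.prod_prod_type]
    refine Finset.prod_congr rfl fun k _ => ?_
    rw [← Finset.prod_filter]
    exact Finset.prod_congr (by ext; simp) fun _ _ => rfl
  let γ' := γ + rho ν
  obtain ⟨G, -, hG⟩ := exists_act_prod_eq (k := LaurentQT) s φ
    (fun p => varWeight p.1 p.2.1 - varWeight p.1 p.2.2) (fun p hp => by
      rw [map_sub, hφ, hφ]
      have h1 : p.2.1 < p.2.2 := (Finset.mem_filter.1 hp).2
      exact sub_pos.2 (isStrict_rho p.1 h1)) (φ (γ + rho ν)) (Pi.single (γ + rho ν) 1) (by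
      intro κ hκ
      rw [Pi.single_apply, if_neg]
      rintro rfl
      exact lt_irrefl _ hκ)
  refine ⟨G, ?_⟩
  rw [alt_neg_rho, map_mul, Module.End.mul_apply, hs, hG]
  funext κ
  rw [act_single, one_mul, sub_neg_eq_add, Pi.single_apply, Pi.single_apply]
  exact if_congr (add_left_inj _) rfl rfl

/-! #### Schur functions form a basis -/

theorem hmon_mem_span (γ : Weight ν) :
    hmon γ ∈ Submodule.span LaurentQT (Set.range (schurFun (Q₀ := Q₀))) := by
  classical
  by_cases h : ∀ j l, 0 ≤ γ j l
  · obtain ⟨G, hG⟩ := exists_act_alt_neg_rho_eq γ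
    have h1 : hsum ν (size γ) (Pi.single γ 1) = hmon γ := by
      rw [hsum_apply, Finset.sum_eq_single γ]
      · simp
      · intro κ _ hκ
        rw [Pi.single_eq_of_ne hκ, zero_smul]
      · intro hγ
        exact absurd (mem_comps.2 ⟨h, rfl⟩) hγ
    rw [← h1, ← hG, hsum_act_alt]
    refine Submodule.sum_mem _ fun κ hκ => Submodule.smul_mem _ _ ?_
    rw [Finset.mem_filter, mem_comps] at hκ
    obtain ⟨lam, h2, h3⟩ := exists_youngWeight_add_rho_eq hκ.2 hκ.1.1
    rw [← h3, add_sub_cancel_right, schurZ_youngWeight h2]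
    exact Submodule.subset_span ⟨lam, rfl⟩
  · push Not at h
    obtain ⟨j, l, hjl⟩ := h
    rw [hmon_of_neg hjl]
    exact Submodule.zero_mem _

theorem exists_isSchurFunExpansion (f : QSym Q₀) : ∃ c, IsSchurFunExpansion f c := by
  have h : f ∈ Submodule.span LaurentQT (Set.range (schurFun (Q₀ := Q₀))) := by
    rw [← (MvPolynomial.basisMonomials (Q₀ × ℕ) LaurentQT).linearCombination_repr f]
    rw [Finsupp.linearCombination_apply, Finsupp.sum]
    refine Submodule.sum_mem _ fun d _ => Submodule.smul_mem _ _ ?_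
    obtain ⟨ν, γ, e⟩ := exists_hmon_eq_monomial d
    rw [MvPolynomial.coe_basisMonomials]
    simp only [e]
    exact hmon_mem_span γ
  obtain ⟨c, hc⟩ := (Finsupp.mem_span_range_iff_exists_finsupp).1 h
  exact ⟨c, hc.symm⟩

/-- In an alphabet with enough variables for all shapes involved, Schur functions become quotients
of alternants, which are separated by their strict exponents. -/
theorem IsSchurFunExpansion.coeff_eq {f : QSym Q₀} {c : (Q₀ → YoungDiagram) →₀ LaurentQT}
    (h : IsSchurFunExpansion f c) (hc : ∀ lam ∈ c.support, ∀ j, (lam j).colLen 0 ≤ ν j)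
    {lam : Q₀ → YoungDiagram} (hlam : ∀ j, (lam j).colLen 0 ≤ ν j) :
    c lam = (alt LaurentQT (rho ν) * ev ν f).coeff ((youngWeight ν lam).1 + rho ν) := by
  classical
  have h1 : ∀ lam : Q₀ → YoungDiagram, (∀ j, (lam j).colLen 0 ≤ ν j) →
      alt LaurentQT (rho ν) * ev ν (schurFun lam) =
        alt LaurentQT ((youngWeight ν lam).1 + rho ν) := fun lam hl => by
    rw [← schurZ_youngWeight hl, alt_rho_mul_ev_schurZ]
    exact fun j l => add_nonneg (Int.natCast_nonneg _) (rho_nonneg j l)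
  rw [IsSchurFunExpansion, Finsupp.sum] at h
  rw [h, map_sum, Finset.mul_sum, AddMonoidAlgebra.coeff_sum, Finsupp.finsetSum_apply,
    Finset.sum_eq_single lam]
  · rw [map_smul, mul_smul_comm, h1 lam hlam, AddMonoidAlgebra.coeff_smul, Finsupp.smul_apply,
      coeff_alt_of_isStrict _ (isStrict_add_rho (youngWeight ν lam).2)
        (isStrict_add_rho (youngWeight ν lam).2), if_pos rfl, smul_eq_mul, mul_one]
  · intro lam' hl hne
    rw [map_smul, mul_smul_comm, h1 lam' (hc lam' hl), AddMonoidAlgebra.coeff_smul,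
      Finsupp.smul_apply, coeff_alt_of_isStrict _ (isStrict_add_rho (youngWeight ν lam').2)
        (isStrict_add_rho (youngWeight ν lam).2), if_neg, smul_zero]
    exact fun e => hne (youngWeight_injOn (hc lam' hl) hlam (add_right_cancel e))
  · intro hl
    simp [Finsupp.notMem_support_iff.1 hl]

omit [DecidableEq Q₀] [Fintype Q₀] in
theorem exists_colLen_le (S : Finset (Q₀ → YoungDiagram)) :
    ∃ ν : Q₀ → ℕ, ∀ lam ∈ S, ∀ j, (lam j).colLen 0 ≤ ν j :=
  ⟨fun j => S.sup fun lam => (lam j).colLen 0, fun _ h j =>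
    Finset.le_sup (f := fun lam : Q₀ → YoungDiagram => (lam j).colLen 0) h⟩

theorem IsSchurFunExpansion.unique {f : QSym Q₀} {c c' : (Q₀ → YoungDiagram) →₀ LaurentQT}
    (h : IsSchurFunExpansion f c) (h' : IsSchurFunExpansion f c') : c = c' := by
  classical
  ext1 lam
  obtain ⟨ν, hν⟩ := exists_colLen_le (insert lam (c.support ∪ c'.support))
  rw [h.coeff_eq (fun l hl => hν l (by simp_all)) (hν lam (by simp)),
    h'.coeff_eq (fun l hl => hν l (by simp_all)) (hν lam (by simp))]

theorem eq_zero_of_ev_eq_zero {f : QSym Q₀} (h : ∀ ν : Q₀ → ℕ, ev ν f = 0) : f = 0 := by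
  obtain ⟨c, hc⟩ := exists_isSchurFunExpansion f
  have : c = 0 := by
    ext1 lam
    classical
    obtain ⟨ν, hν⟩ := exists_colLen_le (insert lam c.support)
    rw [hc.coeff_eq (fun l hl => hν l (Finset.mem_insert_of_mem hl))
      (hν lam (Finset.mem_insert_self _ _)), h, mul_zero]
    rfl
  rw [hc, this, Finsupp.sum_zero_index]

/-! #### The skewing operators -/

/-- The pairings with the `h_γ` are all the coefficients of `f` in finite alphabets. Nondegeneracy
makes adjoints unique. -/
theorem eq_of_hall_eq {f f' : QSym Q₀} (h : ∀ g, hall f g = hall f' g) : f = f' := by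
  rw [← sub_eq_zero]
  refine eq_zero_of_ev_eq_zero fun ν => ?_
  ext1
  ext1 γ
  rw [← hall_hmon, ← hallBilin_apply, map_sub, LinearMap.sub_apply, hallBilin_apply,
    hallBilin_apply, h, sub_self]
  rfl

/-- Skewing by `f` is multiplication by `f[V^*]` before applying `x^γ ↦ h_γ`. -/
theorem perp_hlin (f : QSym Q₀) (p : AddMonoidAlgebra LaurentQT (Weight ν)) :
    perp f (hlin ν p) = hlin ν (p * evInv ν f) :=
  eq_of_hall_eq fun g => by rw [hall_perp, hall_hlin_mul_evInv]

/-- Jacobi-Trudi in raising operator form: the factors `1 - x_k / x_l` act on the indices of the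
`h`'s. -/
theorem schurZ_eq_hlin (γ : Weight ν) :
    schurZ γ = hlin ν (single γ 1 * vandInv LaurentQT ν) := by
  have h : single γ 1 * vandInv LaurentQT ν =
      single (γ + rho ν) 1 * alt LaurentQT (-rho ν) := by
    rw [alt_neg_rho, ← mul_assoc, AddMonoidAlgebra.single_mul_single, one_mul,
      add_neg_cancel_right]
  rw [h, schurZ_eq_sum, alt, Finset.mul_sum, map_sum]
  refine Finset.sum_congr rfl fun w _ => ?_
  rw [mul_smul_comm, map_zsmul, AddMonoidAlgebra.single_mul_single, one_mul, hlin_single, one_smul,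
    map_neg, sub_eq_add_neg]

end SchurFunctions

/-! ### Products of power series in separate variables -/

section Tensor

variable {A : Type*} [CommRing A] {a : ℕ}

/-- The product `∏_k f_k(x_k)`. -/
def tensorSeries (f : Fin a → PowerSeries A) : MvPowerSeries (Fin a) A :=
  fun δ => ∏ k, PowerSeries.coeff (δ k) (f k)

theorem coeff_tensorSeries (f : Fin a → PowerSeries A) (δ : Fin a →₀ ℕ) :
    MvPowerSeries.coeff δ (tensorSeries f) = ∏ k, PowerSeries.coeff (δ k) (f k) := rfl

theorem tensorSeries_mul (f g : Fin a → PowerSeries A) :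
    tensorSeries (f * g) = tensorSeries f * tensorSeries g := by
  classical
  ext δ
  rw [coeff_tensorSeries, MvPowerSeries.coeff_mul]
  simp only [Pi.mul_apply, PowerSeries.coeff_mul, coeff_tensorSeries]
  rw [Finset.prod_univ_sum]
  symm
  refine Finset.sum_bij' (fun p _ k => (p.1 k, p.2 k))
    (fun x _ => (Finsupp.equivFunOnFinite.symm fun k => (x k).1,
      Finsupp.equivFunOnFinite.symm fun k => (x k).2)) ?_ ?_ ?_ ?_ ?_
  · intro p hp
    rw [Fintype.mem_piFinset]
    intro k
    rw [Finset.HasAntidiagonal.mem_antidiagonal] at hp ⊢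
    rw [← hp, Finsupp.add_apply]
  · intro x hx
    rw [Fintype.mem_piFinset] at hx
    rw [Finset.HasAntidiagonal.mem_antidiagonal]
    ext k
    simpa using Finset.HasAntidiagonal.mem_antidiagonal.1 (hx k)
  · intro p _
    ext <;> simp
  · intro x _
    simp
  · intro p _
    rw [Finset.prod_mul_distrib]

theorem tensorSeries_one : tensorSeries (1 : Fin a → PowerSeries A) = 1 := by
  classical
  ext δ
  rw [coeff_tensorSeries, MvPowerSeries.coeff_one]
  simp only [Pi.one_apply, PowerSeries.coeff_one]
  split_ifs with h
  · simp [h]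
  · obtain ⟨k, hk⟩ := Finsupp.ne_iff.1 h
    exact Finset.prod_eq_zero (Finset.mem_univ k) (if_neg hk)

/-- `tensorSeries` as a monoid homomorphism. -/
def tensorHom : (Fin a → PowerSeries A) →* MvPowerSeries (Fin a) A where
  toFun := tensorSeries
  map_one' := tensorSeries_one
  map_mul' := tensorSeries_mul

theorem tensorSeries_mulSingle (c : A) (k : Fin a) :
    tensorSeries (Pi.mulSingle k (1 - PowerSeries.C c * PowerSeries.X)) =
      1 - MvPowerSeries.C c * MvPowerSeries.X k := by
  classical
  ext δ
  rw [coeff_tensorSeries, map_sub, MvPowerSeries.coeff_one, MvPowerSeries.coeff_C_mul,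
    MvPowerSeries.coeff_X, ← Finset.mul_prod_erase _ _ (Finset.mem_univ k), Pi.mulSingle_eq_same]
  have h1 : ∀ l ∈ Finset.univ.erase k, PowerSeries.coeff (δ l)
      (Pi.mulSingle (M := fun _ => PowerSeries A) k (1 - PowerSeries.C c * PowerSeries.X) l) =
        if δ l = 0 then 1 else 0 := by
    intro l hl
    rw [Pi.mulSingle_eq_of_ne (Finset.ne_of_mem_erase hl), PowerSeries.coeff_one]
  rw [Finset.prod_congr rfl h1, map_sub, PowerSeries.coeff_one, PowerSeries.coeff_C_mul,
    PowerSeries.coeff_X]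
  by_cases h : ∀ l ∈ Finset.univ.erase k, δ l = 0
  · rw [Finset.prod_congr rfl fun l hl => if_pos (h l hl), Finset.prod_const_one, mul_one]
    have h2 : δ = Finsupp.single k (δ k) := by
      ext l
      by_cases hl : l = k
      · subst hl; simp
      · rw [h l (by simp [hl]), Finsupp.single_eq_of_ne hl]
    have h3 : δ = 0 ↔ δ k = 0 := by
      conv_lhs => rw [h2]
      simp
    have h4 : δ = Finsupp.single k 1 ↔ δ k = 1 := by
      conv_lhs => rw [h2]
      exact (Finsupp.single_injective k).eq_iff
    simp only [h3, h4]
  · push Not at h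
    obtain ⟨l, hl, hl'⟩ := h
    have hk := Finset.ne_of_mem_erase hl
    rw [Finset.prod_eq_zero hl (if_neg hl'), mul_zero, if_neg, if_neg, mul_zero, sub_zero]
    · rintro rfl
      simp [Finsupp.single_eq_of_ne hk] at hl'
    · rintro rfl
      simp at hl'

theorem tensorSeries_mul_prod {ι : Type*} [Fintype ι] {g : PowerSeries A} {c : ι → A}
    (h : g * ∏ l, (1 - PowerSeries.C (c l) * PowerSeries.X) = 1) :
    tensorSeries (fun _ : Fin a => g) *
      ∏ k, ∏ l, (1 - MvPowerSeries.C (c l) * MvPowerSeries.X k) = 1 := by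
  have h1 : ∀ k : Fin a, ∏ l, (1 - MvPowerSeries.C (c l) * MvPowerSeries.X k) =
      tensorHom (Pi.mulSingle k (∏ l, (1 - PowerSeries.C (c l) * PowerSeries.X))) := by
    intro k
    have := map_prod (tensorHom (A := A).comp (MonoidHom.mulSingle (fun _ : Fin a => PowerSeries A) k))
      (fun l => 1 - PowerSeries.C (c l) * PowerSeries.X) Finset.univ
    refine Eq.trans ?_ this.symm
    exact Finset.prod_congr rfl fun l _ => (tensorSeries_mulSingle (c l) k).symm
  simp only [h1]
  rw [← map_prod, Finset.univ_prod_mulSingle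
    (fun _ : Fin a => ∏ l, (1 - PowerSeries.C (c l) * PowerSeries.X))]
  change tensorHom _ * _ = _
  rw [← map_mul]
  rw [← map_one tensorHom]
  exact congrArg tensorHom (funext fun _ => h)

end Tensor

theorem rescale_C {A : Type*} [CommRing A] (c x : A) :
    PowerSeries.rescale c (PowerSeries.C x) = PowerSeries.C x := by
  ext n
  rw [PowerSeries.coeff_rescale, PowerSeries.coeff_C]
  split_ifs with h
  · simp [h]
  · simp

/-! ### The skewing series in terms of characters -/

section Skew

variable {Q₀ : Type u} [DecidableEq Q₀] [Fintype Q₀] {β : Q₀ → ℕ}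

/-- The factor `1 - z / (u_k v_l^{(j)})` with `z = q ^ m t ^ n`, `e = (m, n)`, as a power series in
the `u_k⁻¹`. -/
def dualFactor (a : ℕ) (e : ℤ × ℤ) (j : Q₀) (k : Fin a) (l : Fin (β j)) :
    MvPowerSeries (Fin a) (AddMonoidAlgebra LaurentQT (Weight β)) :=
  1 - MvPowerSeries.C (single (-varWeight j l) (single e 1)) * MvPowerSeries.X k

omit [Fintype Q₀] in
theorem map_evInv_omegaDual (a : ℕ) (e : ℤ × ℤ) (j : Q₀) :
    MvPowerSeries.map (evInv β).toRingHom (omegaDual a e j) =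
      tensorSeries fun _ => PowerSeries.rescale
        (algebraMap LaurentQT (AddMonoidAlgebra LaurentQT (Weight β)) (single e 1))
        (completeSeries fun l : Fin (β j) =>
          single (-varWeight j l) (1 : LaurentQT)) := by
  ext1 δ
  have h : MvPowerSeries.coeff δ (omegaDual a e j) = ∏ k,
    (MvPolynomial.C (single e (1 : ℤ)) ^ δ k * hfun j (δ k : ℤ) : QSym Q₀) := rfl
  rw [MvPowerSeries.coeff_map, coeff_tensorSeries, h, map_prod]
  refine Finset.prod_congr rfl fun k _ => ?_
  rw [map_mul, map_pow, PowerSeries.coeff_rescale]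
  congr 1
  · congr 1
    exact (evInv β).commutes _
  · rw [evInv, AlgHom.toRingHom_eq_coe, RingHom.coe_coe, AlgHom.comp_apply, ev_hfun, ← completeZ_natCast]
    refine (map_completeZ (AlgHom.toRingHom _) _ _).trans ?_
    congr 1
    funext l
    simp [var]

-- The Cauchy product for `Ω[z U^* V^*]`, one rescaled complete series in the `v_l⁻¹` for each
-- `u_k`.
omit [Fintype Q₀] in
theorem map_evInv_omegaDual_mul_prod (a : ℕ) (e : ℤ × ℤ) (j : Q₀) :
    MvPowerSeries.map (evInv β).toRingHom (omegaDual a e j) *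
      ∏ k, ∏ l, dualFactor a e j k l = 1 := by
  rw [map_evInv_omegaDual]
  refine tensorSeries_mul_prod ?_
  have h := congrArg (PowerSeries.rescale
    (algebraMap LaurentQT (AddMonoidAlgebra LaurentQT (Weight β)) (single e 1)))
    (completeSeries_mul_prod fun l : Fin (β j) => single (-varWeight j l) (1 : LaurentQT))
  rw [map_mul, map_prod, map_one] at h
  refine Eq.trans ?_ h
  congr 1
  refine Finset.prod_congr rfl fun l _ => ?_
  rw [map_sub, map_one, map_mul, PowerSeries.rescale_X, rescale_C, ← mul_assoc, ← map_mul,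
    AddMonoidAlgebra.coe_algebraMap, Function.comp_apply, AddMonoidAlgebra.single_mul_single,
    add_zero, one_mul]
  rfl

end Skew

/-! ### The kernel as a power series in the inverse variables of `U`, and its homogeneity. -/

section SkewKernel

variable {Q₀ : Type u} [Fintype Q₀] {β : Q₀ → ℕ} {a : ℕ}

/-- Power series in the `u_k⁻¹` whose terms have the same degree in the `u_k⁻¹` and the `v_l⁻¹`. -/
def IsBalanced (P : MvPowerSeries (Fin a) (AddMonoidAlgebra LaurentQT (Weight β))) : Prop :=
  ∀ δ, MvPowerSeries.coeff δ P ∈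
    AddMonoidAlgebra.gradeBy LaurentQT (size (ν := β)) (-(∑ k, (δ k : ℤ)))

theorem isBalanced_one :
    IsBalanced (1 : MvPowerSeries (Fin a) (AddMonoidAlgebra LaurentQT (Weight β))) := by
  classical
  intro δ
  rw [MvPowerSeries.coeff_one]
  split_ifs with h
  · subst h
    simpa using SetLike.GradedOne.one_mem (A := AddMonoidAlgebra.gradeBy LaurentQT (size (ν := β)))
  · exact Submodule.zero_mem _

theorem IsBalanced.mul {P P' : MvPowerSeries (Fin a) (AddMonoidAlgebra LaurentQT (Weight β))}
    (h : IsBalanced P) (h' : IsBalanced P') : IsBalanced (P * P') := by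
  classical
  intro δ
  rw [MvPowerSeries.coeff_mul]
  refine Submodule.sum_mem _ fun p hp => ?_
  rw [Finset.HasAntidiagonal.mem_antidiagonal] at hp
  have := SetLike.GradedMul.mul_mem (h p.1) (h' p.2)
  rw [← hp]
  convert this using 2
  simp [Finset.sum_add_distrib]
  ring

theorem IsBalanced.prod {ι : Type*} (s : Finset ι)
    {P : ι → MvPowerSeries (Fin a) (AddMonoidAlgebra LaurentQT (Weight β))}
    (h : ∀ i ∈ s, IsBalanced (P i)) : IsBalanced (∏ i ∈ s, P i) :=
  Finset.prod_induction _ IsBalanced (fun _ _ => IsBalanced.mul) isBalanced_one h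

variable [DecidableEq Q₀]

theorem size_varWeight (j : Q₀) (l : Fin (β j)) : size (varWeight j l) = 1 := by
  change ∑ i, ∑ l', varWeight j l i l' = 1
  rw [Finset.sum_eq_single j]
  · simp [varWeight, Pi.single_apply]
  · intro i _ hi
    simp [varWeight, hi]
  · simp

theorem single_neg_varWeight_mem (j : Q₀) (l : Fin (β j)) (r : LaurentQT) :
    single (-varWeight j l) r ∈ AddMonoidAlgebra.gradeBy LaurentQT (size (ν := β)) (-1) := by
  convert AddMonoidAlgebra.single_mem_gradeBy (size (ν := β)) (-varWeight j l) r using 2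
  rw [map_neg, size_varWeight]

theorem isBalanced_dualFactor (e : ℤ × ℤ) (j : Q₀) (k : Fin a) (l : Fin (β j)) :
    IsBalanced (dualFactor a e j k l) := by
  classical
  intro δ
  rw [dualFactor, map_sub]
  refine Submodule.sub_mem _ (isBalanced_one δ) ?_
  rw [MvPowerSeries.coeff_C_mul, MvPowerSeries.coeff_X]
  split_ifs with h
  · subst h
    rw [mul_one]
    convert single_neg_varWeight_mem j l _ using 2
    simp [Finsupp.single_apply]
  · rw [mul_zero]
    exact Submodule.zero_mem _

theorem isBalanced_map_evInv_omegaDual (e : ℤ × ℤ) (j : Q₀) :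
    IsBalanced (MvPowerSeries.map (evInv β).toRingHom (omegaDual a e j)) := by
  classical
  intro δ
  rw [map_evInv_omegaDual, coeff_tensorSeries, ← Finset.sum_neg_distrib]
  refine SetLike.prod_mem_graded _ _ _ fun k _ => ?_
  rw [PowerSeries.coeff_rescale, ← map_pow, ← Algebra.smul_def]
  refine Submodule.smul_mem _ _ ?_
  rw [coeff_completeSeries]
  refine Submodule.sum_mem _ fun p hp => ?_
  rw [← (Finset.mem_finsuppAntidiag.1 hp).1, Nat.cast_sum, ← Finset.sum_neg_distrib]
  refine SetLike.prod_mem_graded _ _ _ fun l _ => ?_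
  convert SetLike.pow_mem_graded (p l) (single_neg_varWeight_mem j l 1) using 2
  simp

variable [Quiver.{v} Q₀] [∀ i j : Q₀, Fintype (i ⟶ j)]

variable (β a) in
/-- The image of the series `Ω[-q t U^* X^{(i)}] ∏_e Ω[t_e U^* X^{(he)}]` under `X ↦ V^*`. -/
def kernelSeries (i : Q₀) : MvPowerSeries (Fin a) (AddMonoidAlgebra LaurentQT (Weight β)) :=
  (∏ k, ∏ l, dualFactor a (1, 1) i k l) *
    ∏ j, ∏ e : DoubledHom i j, MvPowerSeries.map (evInv β).toRingHom (omegaDual a (arrowExp e) j)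

theorem isBalanced_kernelSeries (i : Q₀) : IsBalanced (kernelSeries β a i) :=
  (IsBalanced.prod _ fun _ _ => IsBalanced.prod _ fun _ _ => isBalanced_dualFactor _ _ _ _).mul
    (IsBalanced.prod _ fun _ _ => IsBalanced.prod _ fun _ _ => isBalanced_map_evInv_omegaDual _ _)

theorem kernelSeries_mul_prod (i : Q₀) :
    kernelSeries β a i *
      ∏ j, ∏ e : DoubledHom i j, ∏ k, ∏ l, dualFactor a (arrowExp e) j k l =
    ∏ k, ∏ l, dualFactor a (1, 1) i k l := by
  rw [kernelSeries, mul_assoc]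
  simp only [← Finset.prod_mul_distrib, map_evInv_omegaDual_mul_prod, Finset.prod_const_one, mul_one]

omit [Fintype Q₀] [DecidableEq Q₀] [Quiver.{v} Q₀] [∀ i j : Q₀, Fintype (i ⟶ j)] in
theorem constantCoeff_omegaDual (e : ℤ × ℤ) (j : Q₀) :
    MvPowerSeries.constantCoeff (omegaDual a e j) = 1 := by
  rw [← MvPowerSeries.coeff_zero_eq_constantCoeff_apply]
  have h : MvPowerSeries.coeff 0 (omegaDual a e j) = ∏ k : Fin a,
    (MvPolynomial.C (single e (1 : ℤ)) ^ ((0 : Fin a →₀ ℕ) k) *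
      hfun j (((0 : Fin a →₀ ℕ) k : ℕ) : ℤ) : QSym Q₀) := rfl
  rw [h]
  simp [hfun_zero]

/-- In `Ω[-U^* X (1 + qt)]` the summand `1` yields the mixed Vandermonde factors, and the summand
`qt` the numerator of the shuffle kernel. -/
theorem map_evInv_skewSeries (i : Q₀) :
    MvPowerSeries.map (evInv β).toRingHom (skewSeries i a) =
      (∏ k, ∏ l, dualFactor a (0, 0) i k l) * kernelSeries β a i := by
  have h1 := congrArg (MvPowerSeries.map (evInv β).toRingHom)
    (MvPowerSeries.invOfUnit_mul (omegaDual a (0, 0) i * omegaDual a (1, 1) i) 1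
      (by rw [map_mul, constantCoeff_omegaDual, constantCoeff_omegaDual, mul_one, Units.val_one]))
  have h2 := map_evInv_omegaDual_mul_prod (β := β) a (0, 0) i
  have h3 := map_evInv_omegaDual_mul_prod (β := β) a (1, 1) i
  rw [map_mul, map_mul, map_one] at h1
  rw [skewSeries, kernelSeries, map_mul, map_prod]
  simp only [map_prod]
  rw [← mul_assoc]
  congr 1
  set I := MvPowerSeries.map (evInv β).toRingHom
    (MvPowerSeries.invOfUnit (omegaDual a (0, 0) i * omegaDual a (1, 1) i) 1)
  set B := MvPowerSeries.map (evInv β).toRingHom (omegaDual a (1, 1) i)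
  set D₀ := ∏ k : Fin a, ∏ l : Fin (β i), dualFactor a (0, 0) i k l
  set D₁ := ∏ k : Fin a, ∏ l : Fin (β i), dualFactor a (1, 1) i k l
  -- With `A` the image of `Ω[U^* X^{(i)}]`: from `I A B = 1`, `A D₀ = 1` and `B D₁ = 1` follows `I
  -- = D₀ D₁`.
  linear_combination h1 * D₀ * D₁ - I * B * D₁ * h2 - I * h3

end SkewKernel

/-! ### Geometric series in several variables -/

/-- The geometric series in one variable, transported along the order embedding `n ↦ n • e`. -/
theorem isUnit_one_sub_single {A : Type*} [CommRing A] {e : ℤ × ℤ} (he : 0 < e) (x : A) :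
    IsUnit (1 - HahnSeries.single e x) := by
  have hm : StrictMono (multiplesHom (ℤ × ℤ) e) := nsmul_left_strictMono he
  let φ : HahnSeries ℕ A →+* SeriesQT A :=
    HahnSeries.embDomainRingHom (multiplesHom (ℤ × ℤ) e) hm.injective fun _ _ => hm.le_iff_le
  have h1 : IsUnit (1 - PowerSeries.C x * PowerSeries.X) :=
    IsUnit.of_mul_eq_one_right _ (mk_pow_mul_one_sub x)
  have h2 := h1.map (φ.comp (HahnSeries.toPowerSeries (R := A)).symm.toRingHom)
  convert h2
  rw [map_sub, map_one]
  congr 1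
  have h3 : (HahnSeries.toPowerSeries (R := A)).symm (PowerSeries.C x * PowerSeries.X) =
      HahnSeries.single 1 x := by
    ext n
    rw [HahnSeries.coeff_toPowerSeries_symm, PowerSeries.coeff_C_mul, PowerSeries.coeff_X,
      HahnSeries.coeff_single]
    simp
  change _ = φ ((HahnSeries.toPowerSeries (R := A)).symm (PowerSeries.C x * PowerSeries.X))
  rw [h3]
  refine Eq.trans ?_ (HahnSeries.embDomain_single).symm
  exact congrArg (fun d => HahnSeries.single d x) (one_nsmul e).symm

/-- The exponents `d - n • e` strictly decrease, and a partially well ordered support contains no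
infinite descending sequence. -/
theorem exists_coeff_sub_nsmul_eq_zero {A : Type*} [CommRing A] (S : SeriesQT A) {e : ℤ × ℤ}
    (he : 0 < e) (d : ℤ × ℤ) (N : ℕ) : ∃ n, N ≤ n ∧ S.coeff (d - n • e) = 0 := by
  by_contra h
  push Not at h
  obtain ⟨m, n, hmn, hle⟩ := S.isPWO_support fun n : ℕ =>
    ⟨d - (N + n) • e, h _ (Nat.le_add_right N n)⟩
  have h1 : (N + n) • e ≤ (N + m) • e := (sub_le_sub_iff_left d).1 hle
  exact absurd ((nsmul_left_strictMono he).le_iff_le.1 h1) (by omega)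

/-! ### Comparison of series in the inverse variables of `U` with series in `q`, `t`. -/

section Kernel

variable {Q₀ : Type u} [DecidableEq Q₀] {α β : Q₀ → ℕ}

/-- The coefficients of a power series in the variables of `U`, as a function of the exponents of
the `u_k` and of the `v_l`. -/
def theta (i : Q₀) (P : MvPowerSeries (Fin (α i)) (AddMonoidAlgebra LaurentQT (Weight β)))
    (γ : Weight (α + β)) : LaurentQT :=
  if ∀ k : Fin (α i), 0 ≤ γ i (Fin.castAdd (β i) k) then
    (MvPowerSeries.coeff (Finsupp.equivFunOnFinite.symm fun k : Fin (α i) =>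
      (γ i (Fin.castAdd (β i) k)).toNat) P).coeff fun j l => γ j (Fin.natAdd (α j) l)
  else 0


omit [DecidableEq Q₀] in
theorem theta_sub (i : Q₀)
    (P P' : MvPowerSeries (Fin (α i)) (AddMonoidAlgebra LaurentQT (Weight β)))
    (γ : Weight (α + β)) : theta i (P - P') γ = theta i P γ - theta i P' γ := by
  unfold theta
  split_ifs <;> simp

/-- `theta` records the power of `u_k⁻¹` as an exponent of `u_k`, so `u_k⁻¹ v_l⁻¹` acts as
translation by the weight of `u_k / v_l`. -/
theorem theta_C_mul_X_mul (i j : Q₀) (k : Fin (α i)) (l : Fin (β j)) (r : LaurentQT)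
    (P : MvPowerSeries (Fin (α i)) (AddMonoidAlgebra LaurentQT (Weight β))) (γ : Weight (α + β)) :
    theta i (MvPowerSeries.C (single (-varWeight j l) r) * MvPowerSeries.X k * P) γ =
      r * theta i P (γ - ratio α β i j k l) := by
  classical
  have hu : ∀ k' : Fin (α i), (γ - ratio α β i j k l) i (Fin.castAdd (β i) k') =
      γ i (Fin.castAdd (β i) k') - if k' = k then 1 else 0 := by
    intro k'
    simp only [ratio, Pi.sub_apply, inclU_castAdd, inclV_castAdd, sub_zero, Pi.single_eq_same,
      Pi.single_apply]
  have hv : (fun (j' : Q₀) (l' : Fin (β j')) =>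
      (γ - ratio α β i j k l) j' (Fin.natAdd (α j') l')) =
      (fun (j' : Q₀) (l' : Fin (β j')) => γ j' (Fin.natAdd (α j') l')) + varWeight j l := by
    funext j' l'
    simp only [ratio, Pi.sub_apply, Pi.add_apply, inclU_natAdd, inclV_natAdd, varWeight]
    ring
  have hX : MvPowerSeries.C (single (-varWeight j l) r) * MvPowerSeries.X k =
      MvPowerSeries.monomial (Finsupp.single k 1) (single (-varWeight j l) r) := by
    ext1 δ
    rw [MvPowerSeries.coeff_C_mul, MvPowerSeries.coeff_X, MvPowerSeries.coeff_monomial]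
    split_ifs <;> simp
  rw [hX]
  unfold theta
  simp only [hu, hv]
  by_cases h : ∀ k' : Fin (α i), 0 ≤ γ i (Fin.castAdd (β i) k')
  · rw [if_pos h, MvPowerSeries.coeff_monomial_mul]
    by_cases hk : 1 ≤ γ i (Fin.castAdd (β i) k)
    · rw [if_pos, if_pos, AddMonoidAlgebra.coeff_single_mul_apply, neg_neg, add_comm]
      · congr 5
        refine DFunLike.ext _ _ fun k' => ?_
        simp only [Finsupp.tsub_apply, Finsupp.equivFunOnFinite_symm_apply_apply,
          Finsupp.single_apply, eq_comm (a := k)]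
        split_ifs with h'
        · subst h'; omega
        · simp
      · intro k'
        split_ifs with h'
        · subst h'; omega
        · simpa using h k'
      · intro k'
        simp only [Finsupp.equivFunOnFinite_symm_apply_apply, Finsupp.single_apply,
          eq_comm (a := k)]
        split_ifs with h'
        · subst h'; omega
        · omega
    · rw [if_neg, if_neg, mul_zero]
      · rfl
      · intro h'
        have := h' k
        simp only [if_true] at this
        omega
      · intro h'
        have := h' k
        simp only [Finsupp.equivFunOnFinite_symm_apply_apply, Finsupp.single_eq_same] at this
        omega
  · rw [if_neg h, if_neg, mul_zero]
    push Not at h ⊢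
    obtain ⟨k', hk'⟩ := h
    refine ⟨k', lt_of_le_of_lt ?_ hk'⟩
    split_ifs <;> omega

omit [DecidableEq Q₀] in
theorem theta_eq_zero_of_neg {i : Q₀} {γ : Weight (α + β)} {k : Fin (α i)}
    (h : γ i (Fin.castAdd (β i) k) < 0)
    (P : MvPowerSeries (Fin (α i)) (AddMonoidAlgebra LaurentQT (Weight β))) : theta i P γ = 0 :=
  if_neg fun h' => absurd (h' k) (not_le.2 h)

theorem theta_dualFactor_mul (e : ℤ × ℤ) (i j : Q₀) (k : Fin (α i)) (l : Fin (β j))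
    (P : MvPowerSeries (Fin (α i)) (AddMonoidAlgebra LaurentQT (Weight β))) (γ : Weight (α + β)) :
    theta i (dualFactor (α i) e j k l * P) γ =
      theta i P γ - single e 1 * theta i P (γ - ratio α β i j k l) := by
  rw [dualFactor, sub_mul, one_mul, theta_sub, theta_C_mul_X_mul]

variable (α β) in
/-- Pairs of a power series in the `u_k` whose coefficients are Laurent polynomials in `q`, `t` and
the `v_l`, and a series in `q`, `t`. -/
abbrev SeriesPair (i : Q₀) : Type _ :=
  MvPowerSeries (Fin (α i)) (AddMonoidAlgebra LaurentQT (Weight β)) × TorusSeries (α + β)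

/-- The two series of the pair have the same coefficients. -/
def IsCompatible {i : Q₀} (x : SeriesPair α β i) : Prop :=
  ∀ γ d, (theta i x.1 γ).coeff d = (x.2.coeff d).coeff γ

/-- `theta` ignores the exponents of `U` at vertices other than `i`; the dimension vector must be
concentrated at `i` for the comparison to hold. -/
theorem isCompatible_one {i : Q₀} (hα : ∀ j, j ≠ i → α j = 0) :
    IsCompatible (1 : SeriesPair α β i) := by
  classical
  intro γ d
  have h0 : (theta i (1 : MvPowerSeries (Fin (α i)) (AddMonoidAlgebra LaurentQT (Weight β))) γ) =
      if γ = 0 then 1 else 0 := by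
    unfold theta
    split_ifs with h1 h2 h2
    · subst h2
      rw [MvPowerSeries.coeff_one, if_pos (by ext; simp), AddMonoidAlgebra.one_def,
        AddMonoidAlgebra.coeff_single]
      exact Finsupp.single_eq_same
    · rw [MvPowerSeries.coeff_one]
      split_ifs with h3
      · rw [AddMonoidAlgebra.one_def, AddMonoidAlgebra.coeff_single, Finsupp.single_apply, if_neg]
        intro h4
        refine h2 (weight_add_ext (fun j k => ?_) fun j l => ?_)
        · by_cases hj : j = i
          · subst hj
            have h5 := DFunLike.congr_fun h3 k
            simp only [Finsupp.equivFunOnFinite_symm_apply_apply, Finsupp.coe_zero,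
              Pi.zero_apply] at h5
            have := h1 k
            simp only [Pi.zero_apply]
            omega
          · exact absurd k.pos (by rw [hα j hj]; exact lt_irrefl 0)
        · exact (congrFun (congrFun h4 j) l).symm
      · rfl
    · subst h2
      exact absurd (fun _ => le_rfl) h1
    · rfl
  rw [Prod.fst_one, Prod.snd_one, h0, HahnSeries.coeff_one]
  split_ifs with h1 h2 h2
  · subst h1 h2
    rw [AddMonoidAlgebra.one_def, AddMonoidAlgebra.one_def, AddMonoidAlgebra.coeff_single,
      AddMonoidAlgebra.coeff_single, Finsupp.single_eq_same, Finsupp.single_eq_same]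
  · rw [AddMonoidAlgebra.one_def, AddMonoidAlgebra.coeff_single, Finsupp.single_apply,
      if_neg (Ne.symm h2)]
    rfl
  · rw [AddMonoidAlgebra.one_def, AddMonoidAlgebra.coeff_single, Finsupp.single_apply,
      if_neg (Ne.symm h1)]
    rfl
  · rfl

/-- The factor `1 - z u_k / v_l`, as a series of either kind. -/
def pairFactor (α β : Q₀ → ℕ) (e : ℤ × ℤ) (i j : Q₀) (k : Fin (α i)) (l : Fin (β j)) :
    SeriesPair α β i :=
  (dualFactor (α i) e j k l, shuffleFactor α β e i j k l)

theorem coeff_theta_pairFactor_mul (e : ℤ × ℤ) (i j : Q₀) (k : Fin (α i)) (l : Fin (β j))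
    (x : SeriesPair α β i) (γ : Weight (α + β)) (d : ℤ × ℤ) :
    (theta i (pairFactor α β e i j k l * x).1 γ).coeff d =
      (theta i x.1 γ).coeff d - (theta i x.1 (γ - ratio α β i j k l)).coeff (d - e) := by
  rw [Prod.fst_mul, pairFactor, theta_dualFactor_mul, AddMonoidAlgebra.coeff_sub,
    Finsupp.sub_apply, AddMonoidAlgebra.coeff_single_mul_apply, one_mul, neg_add_eq_sub]

theorem coeff_coeff_pairFactor_mul (e : ℤ × ℤ) (i j : Q₀) (k : Fin (α i)) (l : Fin (β j))
    (x : SeriesPair α β i) (γ : Weight (α + β)) (d : ℤ × ℤ) :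
    ((pairFactor α β e i j k l * x).2.coeff d).coeff γ =
      (x.2.coeff d).coeff γ - (x.2.coeff (d - e)).coeff (γ - ratio α β i j k l) := by
  rw [Prod.snd_mul, pairFactor, shuffleFactor, sub_mul, one_mul, HahnSeries.coeff_sub,
    HahnSeries.coeff_single_mul, AddMonoidAlgebra.coeff_sub,
    Finsupp.sub_apply, AddMonoidAlgebra.coeff_single_mul_apply, one_mul, neg_add_eq_sub]

theorem IsCompatible.pairFactor_mul {i : Q₀} {x : SeriesPair α β i} (h : IsCompatible x)
    (e : ℤ × ℤ) (j : Q₀) (k : Fin (α i)) (l : Fin (β j)) :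
    IsCompatible (pairFactor α β e i j k l * x) := by
  intro γ d
  rw [coeff_theta_pairFactor_mul, coeff_coeff_pairFactor_mul, h, h]

/-- The discrepancy of the two coefficients is invariant under `(γ, d) ↦ (γ - ratio, d - e)`. Far
along this ray both coefficients vanish: one for a negative exponent of `u_k`, the other by well
ordering of the support. -/
theorem IsCompatible.of_pairFactor_mul {i : Q₀} {x : SeriesPair α β i} {e : ℤ × ℤ} (he : 0 < e)
    {j : Q₀} {k : Fin (α i)} {l : Fin (β j)} (h : IsCompatible (pairFactor α β e i j k l * x)) :
    IsCompatible x := by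
  let f : Weight (α + β) → ℤ × ℤ → ℤ := fun γ d =>
    (theta i x.1 γ).coeff d - (x.2.coeff d).coeff γ
  have h1 : ∀ γ d, f γ d = f (γ - ratio α β i j k l) (d - e) := by
    intro γ d
    have := h γ d
    rw [coeff_theta_pairFactor_mul, coeff_coeff_pairFactor_mul] at this
    change _ - _ = _ - _
    linarith
  have h2 : ∀ (n : ℕ) γ d, f γ d = f (γ - n • ratio α β i j k l) (d - n • e) := by
    intro n
    induction n with
    | zero => intro γ d; simp
    | succ n ih =>
      intro γ d
      rw [ih, h1, sub_sub, sub_sub, ← succ_nsmul, ← succ_nsmul]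
  intro γ d
  -- The `+ 1` makes the exponent of `u_k` strictly negative after `n` steps.
  obtain ⟨n, hn, hS⟩ := exists_coeff_sub_nsmul_eq_zero x.2 he d
    ((γ i (Fin.castAdd (β i) k)).toNat + 1)
  have h3 : (γ - n • ratio α β i j k l) i (Fin.castAdd (β i) k) < 0 := by
    have : ratio α β i j k l i (Fin.castAdd (β i) k) = 1 := by
      simp [ratio]
    rw [Pi.sub_apply, Pi.sub_apply, Pi.smul_apply, Pi.smul_apply, this]
    simp only [nsmul_eq_mul, mul_one]
    omega
  have h4 := h2 n γ d
  simp only [f] at h4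
  rw [theta_eq_zero_of_neg h3, hS] at h4
  simpa [sub_eq_zero] using h4

omit [DecidableEq Q₀] in
theorem IsCompatible.prod_mul {i : Q₀} {ι : Type*} {s : Finset ι} {p : ι → SeriesPair α β i}
    (hp : ∀ n ∈ s, ∀ x, IsCompatible x → IsCompatible (p n * x)) {x : SeriesPair α β i}
    (h : IsCompatible x) : IsCompatible ((∏ n ∈ s, p n) * x) :=
  Finset.prod_induction p (fun y => ∀ x, IsCompatible x → IsCompatible (y * x))
    (fun y y' hy hy' x hx => by rw [mul_assoc]; exact hy _ (hy' _ hx))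
    (fun x hx => by rwa [one_mul]) hp x h

omit [DecidableEq Q₀] in
theorem IsCompatible.of_prod_mul {i : Q₀} {ι : Type*} {s : Finset ι} {p : ι → SeriesPair α β i}
    (hp : ∀ n ∈ s, ∀ x, IsCompatible (p n * x) → IsCompatible x) {x : SeriesPair α β i}
    (h : IsCompatible ((∏ n ∈ s, p n) * x)) : IsCompatible x :=
  Finset.prod_induction p (fun y => ∀ x, IsCompatible (y * x) → IsCompatible x)
    (fun y y' hy hy' x hx => by rw [mul_assoc] at hx; exact hy' _ (hy _ hx))
    (fun x hx => by rwa [one_mul] at hx) hp x h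

end Kernel

/-! ### Agreement of the two expansions of the shuffle kernel. -/

section ShuffleKernel

variable {Q₀ : Type u} [DecidableEq Q₀] [Fintype Q₀] [Quiver.{v} Q₀]
  [∀ i j : Q₀, Fintype (i ⟶ j)] {α β : Q₀ → ℕ}

omit [DecidableEq Q₀] [Fintype Q₀] [∀ i j : Q₀, Fintype (i ⟶ j)] in
theorem arrowExp_pos {i j : Q₀} (e : DoubledHom i j) : 0 < arrowExp e := by
  rcases e with e | e
  · exact show (0 : ℤ × ℤ) < (0, 1) from by simp [Prod.lt_iff]
  · exact show (0 : ℤ × ℤ) < (1, 0) from by simp [Prod.lt_iff]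

theorem shuffleKernel_mul_prod (α β : Q₀ → ℕ) :
    shuffleKernel α β * ∏ i, ∏ j, ∏ e : DoubledHom i j, ∏ k : Fin (α i), ∏ l : Fin (β j),
      shuffleFactor α β (arrowExp e) i j k l =
    ∏ i, ∏ k : Fin (α i), ∏ l : Fin (β i), shuffleFactor α β (1, 1) i i k l := by
  rw [shuffleKernel, mul_assoc]
  simp only [← Finset.prod_mul_distrib]
  refine Finset.prod_congr rfl fun i _ => (congrArg (HMul.hMul (∏ k : Fin (α i), ∏ l : Fin (β i),
    shuffleFactor α β (1, 1) i i k l)) ?_).trans (mul_one _)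
  refine Finset.prod_eq_one fun j _ => Finset.prod_eq_one fun e _ =>
    Finset.prod_eq_one fun k _ => Finset.prod_eq_one fun l _ => Ring.inverse_mul_cancel _ ?_
  exact isUnit_one_sub_single (arrowExp_pos e) _

/-- Both expansions, multiplied by the same denominators, give the same finite product.
Compatibility passes to that product from `1` and then back through the denominators, factor by
factor. -/
theorem isCompatible_kernel {i : Q₀} (hα : ∀ j, j ≠ i → α j = 0) :
    IsCompatible ((kernelSeries β (α i) i, shuffleKernel α β) : SeriesPair α β i) := by
  have hN : IsCompatible ((∏ k, ∏ l, pairFactor α β (1, 1) i i k l) * 1) :=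
    (isCompatible_one hα).prod_mul fun k _ x hx =>
      hx.prod_mul fun l _ x hx => hx.pairFactor_mul _ _ _ _
  have hK : (∏ j, ∏ e : DoubledHom i j, ∏ k, ∏ l, pairFactor α β (arrowExp e) i j k l) *
      ((kernelSeries β (α i) i, shuffleKernel α β) : SeriesPair α β i) =
      (∏ k, ∏ l, pairFactor α β (1, 1) i i k l) * 1 := by
    have hempty : ∀ i', i' ≠ i → IsEmpty (Fin (α i')) := fun i' h => by
      rw [hα i' h]; exact Fin.isEmpty
    refine Prod.ext ?_ ?_
    · simp only [Prod.fst_mul, Prod.fst_prod, pairFactor, mul_one]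
      rw [mul_comm, kernelSeries_mul_prod]
    · simp only [Prod.snd_mul, Prod.snd_prod, pairFactor, mul_one]
      have h := shuffleKernel_mul_prod α β
      rw [Finset.prod_eq_single (ι := Q₀) (s := Finset.univ) (f := fun i' => ∏ j,
        ∏ e : DoubledHom i' j, ∏ k : Fin (α i'), ∏ l : Fin (β j),
          shuffleFactor α β (arrowExp e) i' j k l) i,
        Finset.prod_eq_single (ι := Q₀) (s := Finset.univ) (f := fun i' => ∏ k : Fin (α i'),
          ∏ l : Fin (β i'), shuffleFactor α β (1, 1) i' i' k l) i] at h
      · rw [mul_comm, h]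
      · intro i' _ hi'
        have := hempty i' hi'
        exact Finset.prod_of_isEmpty _
      · simp
      · intro i' _ hi'
        have := hempty i' hi'
        exact Finset.prod_eq_one fun j _ => Finset.prod_eq_one fun e _ => Finset.prod_of_isEmpty _
      · simp
  rw [← hK] at hN
  exact IsCompatible.of_prod_mul (fun j _ x hx => IsCompatible.of_prod_mul (fun e _ x hx =>
    IsCompatible.of_prod_mul (fun k _ x hx => IsCompatible.of_prod_mul (fun l _ x hx =>
      hx.of_pairFactor_mul (arrowExp_pos e)) hx) hx) hx) hN

end ShuffleKernel

/-! ### The symmetry of the shuffle kernel -/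

section Symmetry

variable {Q₀ : Type u} [DecidableEq Q₀] {α β : Q₀ → ℕ}

/-- The action of permutations on series. -/
def permSeries {ν : Q₀ → ℕ} (w : PermGroup ν) : TorusSeries ν →+* TorusSeries ν where
  toFun x := x.map (permRing w)
  map_one' := by
    rw [← HahnSeries.C_one, HahnSeries.map_C, map_one]
  map_zero' := HahnSeries.ext (funext fun _ => map_zero (permRing w))
  map_add' _ _ := HahnSeries.ext (funext fun _ => map_add (permRing w) _ _)
  map_mul' _ _ := HahnSeries.map_mul (permRing w).toNonUnitalRingHom

theorem permWeight_varWeight {ν : Q₀ → ℕ} (w : PermGroup ν) (j : Q₀) (k : Fin (ν j)) :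
    permWeight w (varWeight j k) = varWeight j (w j k) := by
  funext i l
  rw [permWeight_apply]
  by_cases h : i = j
  · subst h
    simp [varWeight, Pi.single_apply, Equiv.symm_apply_eq]
  · simp [varWeight, h]

theorem permSeries_shuffleFactor (w : PermGroup α) (w' : PermGroup β) (e : ℤ × ℤ) (i j : Q₀)
    (k : Fin (α i)) (l : Fin (β j)) :
    permSeries (blockPerm w w') (shuffleFactor α β e i j k l) =
      shuffleFactor α β e i j (w i k) (w' j l) := by
  rw [shuffleFactor, map_sub, map_one, shuffleFactor]
  congr 1
  refine (HahnSeries.map_single (permRing (blockPerm w w')).toAddMonoidHom.toZeroHom).trans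
    (congrArg (HahnSeries.single e) ?_)
  change permRing _ _ = _
  rw [permRing_single]
  congr 1
  change permWeight _ (inclU α β (varWeight i k) - inclV α β (varWeight j l)) = _
  rw [map_sub, permWeight_blockPerm_inclU, permWeight_blockPerm_inclV, permWeight_varWeight,
    permWeight_varWeight]
  rfl

variable [Fintype Q₀] [Quiver.{v} Q₀] [∀ i j : Q₀, Fintype (i ⟶ j)]

/-- Block permutations permute the factors of the numerator and of the denominator; the denominator
is a unit and cancels. -/
theorem permSeries_shuffleKernel (w : PermGroup α) (w' : PermGroup β) :
    permSeries (blockPerm w w') (shuffleKernel α β) = shuffleKernel α β := by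
  have hp : ∀ e i j, permSeries (blockPerm w w')
      (∏ k : Fin (α i), ∏ l : Fin (β j), shuffleFactor α β e i j k l) =
      ∏ k : Fin (α i), ∏ l : Fin (β j), shuffleFactor α β e i j k l := by
    intro e i j
    rw [map_prod]
    refine Fintype.prod_equiv (w i) _ _ fun k => ?_
    rw [map_prod]
    exact Fintype.prod_equiv (w' j) _ _ fun l => permSeries_shuffleFactor w w' e i j k l
  have hU : IsUnit (∏ i, ∏ j, ∏ e : DoubledHom i j, ∏ k : Fin (α i), ∏ l : Fin (β j),
      shuffleFactor α β (arrowExp e) i j k l) := by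
    refine Finset.prod_induction _ IsUnit (fun _ _ => IsUnit.mul) isUnit_one fun i _ => ?_
    refine Finset.prod_induction _ IsUnit (fun _ _ => IsUnit.mul) isUnit_one fun j _ => ?_
    refine Finset.prod_induction _ IsUnit (fun _ _ => IsUnit.mul) isUnit_one fun e _ => ?_
    refine Finset.prod_induction _ IsUnit (fun _ _ => IsUnit.mul) isUnit_one fun k _ => ?_
    refine Finset.prod_induction _ IsUnit (fun _ _ => IsUnit.mul) isUnit_one fun l _ => ?_
    exact isUnit_one_sub_single (arrowExp_pos e) _
  have h := congrArg (permSeries (blockPerm w w')) (shuffleKernel_mul_prod α β)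
  simp only [map_mul, map_prod _ _ (Finset.univ : Finset Q₀),
    map_prod _ _ (Finset.univ : Finset (DoubledHom _ _)), hp] at h
  rw [← shuffleKernel_mul_prod α β] at h
  exact hU.mul_right_cancel h

theorem permRing_coeff_shuffleKernel (w : PermGroup α) (w' : PermGroup β) (d : ℤ × ℤ) :
    permRing (blockPerm w w') ((shuffleKernel α β).coeff d) = (shuffleKernel α β).coeff d :=
  congrArg (fun x : TorusSeries (α + β) => x.coeff d) (permSeries_shuffleKernel w w')

end Symmetry

/-! ### The currents in terms of the kernel -/

section Currents

variable {Q₀ : Type u} {α β : Q₀ → ℕ}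

variable (α β) in
/-- Laurent polynomials in `U`, as Laurent polynomials in `U + V`. -/
abbrev inclAlgU : AddMonoidAlgebra LaurentQT (Weight α) →ₐ[LaurentQT]
    AddMonoidAlgebra LaurentQT (Weight (α + β)) :=
  AddMonoidAlgebra.mapDomainAlgHom LaurentQT LaurentQT (inclU α β)

variable (α β) in
/-- Laurent polynomials in `V`, as Laurent polynomials in `U + V`. -/
abbrev inclAlgV : AddMonoidAlgebra LaurentQT (Weight β) →ₐ[LaurentQT]
    AddMonoidAlgebra LaurentQT (Weight (α + β)) :=
  AddMonoidAlgebra.mapDomainAlgHom LaurentQT LaurentQT (inclV α β)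

theorem inclAlgU_single (κ : Weight α) (r : LaurentQT) :
    inclAlgU α β (single κ r) = single (inclU α β κ) r := by
  simp [inclAlgU]

theorem inclAlgV_single (η : Weight β) (r : LaurentQT) :
    inclAlgV α β (single η r) = single (inclV α β η) r := by
  simp [inclAlgV]

theorem theta_C_mul (i : Q₀) (q : AddMonoidAlgebra LaurentQT (Weight β))
    (P : MvPowerSeries (Fin (α i)) (AddMonoidAlgebra LaurentQT (Weight β))) :
    theta i (MvPowerSeries.C q * P) = act (inclAlgV α β q) (theta i P) := by
  induction q using AddMonoidAlgebra.induction_linear with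
  | zero =>
    funext γ
    rw [map_zero, zero_mul, map_zero, map_zero]
    unfold theta
    split_ifs <;> rfl
  | add p q hp hq =>
    rw [map_add, add_mul, map_add, map_add, LinearMap.add_apply, ← hp, ← hq]
    funext γ
    unfold theta
    rw [Pi.add_apply]
    split_ifs <;> simp
  | single η r =>
    funext γ
    rw [inclAlgV_single, act_single]
    unfold theta
    simp only [Pi.sub_apply, inclV_castAdd, inclV_natAdd, sub_zero]
    split_ifs
    · rw [MvPowerSeries.coeff_C_mul, AddMonoidAlgebra.coeff_single_mul_apply, neg_add_eq_sub]
      rfl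
    · rw [mul_zero]

variable [Fintype Q₀]

theorem size_add (γ : Weight (α + β)) :
    size γ = size (fun j k => γ j (Fin.castAdd (β j) k) : Weight α) +
      size (fun j l => γ j (Fin.natAdd (α j) l) : Weight β) := by
  change ∑ j, ∑ k : Fin (α j + β j), _ = ∑ j, ∑ k : Fin (α j), _ + ∑ j, ∑ l : Fin (β j), _
  rw [← Finset.sum_add_distrib]
  exact Finset.sum_congr rfl fun j _ => Fin.sum_univ_add _

variable [DecidableEq Q₀]

omit [Fintype Q₀] in
theorem theta_prod_dualFactor_mul (i : Q₀)
    (P : MvPowerSeries (Fin (α i)) (AddMonoidAlgebra LaurentQT (Weight β))) :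
    theta i ((∏ k, ∏ l, dualFactor (α i) (0, 0) i k l) * P) =
      act (∏ k, ∏ l, (1 - single (ratio α β i i k l) 1)) (theta i P) := by
  rw [← Fintype.prod_prod_type', ← Fintype.prod_prod_type']
  induction (Finset.univ : Finset (Fin (α i) × Fin (β i))) using Finset.cons_induction with
  | empty => simp
  | cons p s hp ih =>
    rw [Finset.prod_cons, Finset.prod_cons, mul_assoc, map_mul, Module.End.mul_apply, ← ih]
    funext γ
    rw [theta_dualFactor_mul, act_one_sub_single]
    rfl

/-- The pairs `k < l` lie inside `U`, inside `V`, or go from `U` to `V`; none goes from `V` to `U`.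
-/
theorem vandInv_add : vandInv LaurentQT (α + β) =
    inclAlgU α β (vandInv LaurentQT α) * inclAlgV α β (vandInv LaurentQT β) *
      ∏ j, ∏ k, ∏ l, (1 - single (ratio α β j j k l) 1) := by
  have hlt : ∀ j (k : Fin (α j)) (l : Fin (β j)), Fin.castAdd (β j) k < Fin.natAdd (α j) l :=
    fun j k l => Fin.lt_def.2 (k.2.trans_le (Nat.le_add_right _ _))
  have hU : ∀ j (k : Fin (α j)), (varWeight j (Fin.castAdd (β j) k) : Weight (α + β)) =
      inclU α β (varWeight j k) := by
    intro j k
    apply weight_add_ext <;> intro i l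
    · rw [inclU_castAdd]
      by_cases h : i = j
      · subst h; simp [varWeight, Pi.single_apply]
      · simp [varWeight, h]
    · rw [inclU_natAdd]
      by_cases h : i = j
      · subst h
        simp [varWeight, (hlt i k l).ne']
      · simp [varWeight, h]
  have hV : ∀ j (l : Fin (β j)), (varWeight j (Fin.natAdd (α j) l) : Weight (α + β)) =
      inclV α β (varWeight j l) := by
    intro j k
    apply weight_add_ext <;> intro i l
    · rw [inclV_castAdd]
      by_cases h : i = j
      · subst h
        simp [varWeight, (hlt i l k).ne]
      · simp [varWeight, h]
    · rw [inclV_natAdd]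
      by_cases h : i = j
      · subst h; simp [varWeight, Pi.single_apply]
      · simp [varWeight, h]
  have hfil : ∀ (n : ℕ) (k : Fin n) (f : Fin n → AddMonoidAlgebra LaurentQT (Weight (α + β))),
      ∏ l ∈ Finset.Ioi k, f l = ∏ l, if k < l then f l else 1 := by
    intro n k f
    rw [← Finset.prod_filter]
    exact Finset.prod_congr (by ext; simp) fun _ _ => rfl
  simp only [vandInv, map_prod, ← Finset.prod_mul_distrib]
  refine Finset.prod_congr rfl fun j _ => ?_
  change ∏ k : Fin (α j + β j), ∏ l ∈ Finset.Ioi k, _ = _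
  rw [Fin.prod_univ_add, mul_right_comm, ← Finset.prod_mul_distrib]
  congr 1
  · refine Finset.prod_congr rfl fun k _ => ?_
    rw [hfil, Fin.prod_univ_add, hfil]
    congr 1
    · refine Finset.prod_congr rfl fun l _ => ?_
      refine if_congr Iff.rfl ?_ rfl
      rw [map_sub, map_one, inclAlgU_single, map_sub, hU, hU]
    · refine Finset.prod_congr rfl fun l _ => ?_
      rw [if_pos (hlt j k l), hU, hV]
      rfl
  · refine Finset.prod_congr rfl fun k _ => ?_
    rw [hfil, Fin.prod_univ_add, hfil, Finset.prod_eq_one, one_mul]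
    · refine Finset.prod_congr rfl fun l _ => ?_
      refine if_congr (Fin.natAdd_lt_natAdd_iff _) ?_ rfl
      rw [map_sub, map_one, inclAlgV_single, map_sub, hV, hV]
    · intro l _
      exact if_neg (not_lt.2 (hlt j l k).le)

end Currents

/-! ### The action of a current on a Schur function as one sum over exponents. -/

section Currents

variable {Q₀ : Type u} [DecidableEq Q₀] [Fintype Q₀] {α β : Q₀ → ℕ}

omit [DecidableEq Q₀] in
theorem size_eq_of_forall_ne {i : Q₀} (hα : ∀ j, j ≠ i → α j = 0) (κ : Weight α) :
    size κ = ∑ k, κ i k := by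
  refine Finset.sum_eq_single i (fun j _ hj => ?_) (by simp)
  have : IsEmpty (Fin (α j)) := by rw [hα j hj]; exact Fin.isEmpty
  exact Finset.sum_of_isEmpty _

omit [DecidableEq Q₀] in
theorem hmon_eq_of_forall_ne {i : Q₀} (hα : ∀ j, j ≠ i → α j = 0) (κ : Weight α) :
    hmon κ = ∏ k, hfun i (κ i k) := by
  refine Finset.prod_eq_single i (fun j _ hj => ?_) (by simp)
  have : IsEmpty (Fin (α j)) := by rw [hα j hj]; exact Fin.isEmpty
  exact Finset.prod_of_isEmpty _

omit [DecidableEq Q₀] in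
theorem size_eq_of_mem_gradeBy {ν : Q₀ → ℕ} {n : ℤ} {p : AddMonoidAlgebra LaurentQT (Weight ν)}
    (h : p ∈ AddMonoidAlgebra.gradeBy LaurentQT (size (ν := ν)) n) {γ : Weight ν}
    (hγ : p.coeff γ ≠ 0) : size γ = n :=
  (AddMonoidAlgebra.mem_gradeBy_iff _ _ _ _).1 h (Finsupp.mem_support_iff.2 hγ)

/-- The power `δ` of `u⁻¹` fixes the `U`-part of the exponent. The grading of `P` fixes the total
size, so all nonzero terms lie in one finite set and the sum over `δ` is a sum over its fibres. -/
theorem finsum_hfun_mul_hlin {i : Q₀} (hα : ∀ j, j ≠ i → α j = 0) (τ : Weight α) (m : ℤ)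
    {P : MvPowerSeries (Fin (α i)) (AddMonoidAlgebra LaurentQT (Weight β))}
    (hP : ∀ δ, MvPowerSeries.coeff δ P ∈
      AddMonoidAlgebra.gradeBy LaurentQT (size (ν := β)) (m - ∑ k, (δ k : ℤ))) :
    ∑ᶠ δ : Fin (α i) →₀ ℕ, (∏ k, hfun i (τ i k + (δ k : ℤ))) *
      hlin β (MvPowerSeries.coeff δ P) =
    hsum (α + β) (size τ + m) (act (single (inclU α β τ) 1) (theta i P)) := by
  classical
  rw [hsum_apply]
  let φ : Weight (α + β) → Fin (α i) →₀ ℕ := fun γ =>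
    Finsupp.equivFunOnFinite.symm fun k => (γ i (Fin.castAdd (β i) k) - τ i k).toNat
  rw [← finsum_sum_filter φ]
  refine finsum_congr fun δ => ?_
  let κ : Weight α := τ + Pi.single i fun k => (δ k : ℤ)
  have hκ : ∀ k, κ i k = τ i k + δ k := fun k => by simp [κ]
  have h1 : ∏ k, hfun i (τ i k + (δ k : ℤ)) = hmon κ := by
    rw [hmon_eq_of_forall_ne hα]
    simp only [hκ]
  have h2 : hlin β (MvPowerSeries.coeff δ P) = ∑ η ∈ (MvPowerSeries.coeff δ P).coeff.support,
      (MvPowerSeries.coeff δ P).coeff η • hmon η := by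
    rw [hlin, LinearMap.comp_apply]
    exact Finsupp.linearCombination_apply _ _
  have hval : ∀ η : Weight β, act (single (inclU α β τ) 1) (theta i P)
      (inclU α β κ + inclV α β η) = (MvPowerSeries.coeff δ P).coeff η := by
    intro η
    rw [act_single, one_mul, theta, if_pos]
    · congr 3
      · refine congrArg (fun δ => MvPowerSeries.coeff δ) (DFunLike.ext _ _ fun k => ?_)
        simp [hκ]
      · funext j l
        simp
    · intro k
      simp [hκ]
  rw [h1, h2, Finset.mul_sum]
  simp only [mul_smul_comm, hmon_inclU_mul_hmon_inclV]
  refine Finset.sum_bij_ne_zero (fun η _ _ => inclU α β κ + inclV α β η) ?_ ?_ ?_ ?_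
  · intro η hη hne
    rw [Finset.mem_filter, mem_comps]
    refine ⟨⟨?_, ?_⟩, ?_⟩
    · by_contra h
      push Not at h
      obtain ⟨j, l, hjl⟩ := h
      exact hne (by rw [hmon_of_neg hjl, smul_zero])
    · rw [size_add]
      have := size_eq_of_mem_gradeBy (hP δ) (Finsupp.mem_support_iff.1 hη)
      simp only [Pi.add_apply, inclU_castAdd, inclV_castAdd, add_zero, inclU_natAdd,
        inclV_natAdd, zero_add]
      rw [this, size_eq_of_forall_ne hα, size_eq_of_forall_ne hα]
      simp only [hκ, Finset.sum_add_distrib]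
      ring
    · refine DFunLike.ext _ _ fun k => ?_
      simp [φ, hκ]
  · intro η _ _ η' _ _ h
    funext j l
    have := congrFun (congrFun h j) (Fin.natAdd (α j) l)
    simpa using this
  · intro γ hγ hne
    rw [Finset.mem_filter] at hγ
    have hθ : act (single (inclU α β τ) 1) (theta i P) γ ≠ 0 := fun h => hne (by rw [h, zero_smul])
    rw [act_single, one_mul] at hθ
    -- The truncation in `φ` loses nothing: exponents below `τ` are killed by `theta`.
    have hu : ∀ k, 0 ≤ γ i (Fin.castAdd (β i) k) - τ i k := by
      by_contra h
      push Not at h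
      obtain ⟨k, hk⟩ := h
      exact hθ (theta_eq_zero_of_neg (k := k) (by simpa using hk) P)
    have hγ' : γ = inclU α β κ + inclV α β fun j l => γ j (Fin.natAdd (α j) l) := by
      apply weight_add_ext
      · intro j k
        by_cases hj : j = i
        · subst hj
          rw [Pi.add_apply, Pi.add_apply, inclU_castAdd, inclV_castAdd, add_zero, hκ, ← hγ.2]
          have := hu k
          simp only [φ, Finsupp.equivFunOnFinite_symm_apply_apply]
          omega
        · exact absurd k.pos (by rw [hα j hj]; exact lt_irrefl 0)
      · intro j l
        simp
    rw [hγ', hval] at hne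
    exact ⟨_, Finsupp.mem_support_iff.2 fun h => hne (by rw [h, zero_smul]), hne, hγ'.symm⟩
  · intro η _ _
    rw [hval]

theorem vandInv_mem_gradeBy (ν : Q₀ → ℕ) :
    vandInv LaurentQT ν ∈ AddMonoidAlgebra.gradeBy LaurentQT (size (ν := ν)) 0 := by
  refine Finset.prod_induction _ (· ∈ _) (fun p q hp hq => ?_) ?_ fun j _ =>
    Finset.prod_induction _ (· ∈ _) (fun p q hp hq => ?_) ?_ fun k _ =>
    Finset.prod_induction _ (· ∈ _) (fun p q hp hq => ?_) ?_ fun l _ => ?_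
  any_goals exact SetLike.GradedOne.one_mem
  any_goals
    rw [← add_zero (0 : ℤ)]
    exact SetLike.GradedMul.mul_mem hp hq
  refine Submodule.sub_mem _ SetLike.GradedOne.one_mem ?_
  convert AddMonoidAlgebra.single_mem_gradeBy (size (ν := ν)) (varWeight j k - varWeight j l)
    (1 : LaurentQT) using 2
  rw [map_sub, size_varWeight, size_varWeight, sub_self]

theorem sum_eq_zero_of_mem_support_rFactor {a : ℕ} {κ : Fin a → ℤ}
    (hκ : κ ∈ (rFactor a).coeff.support) : ∑ k, κ k = 0 := by
  let s : (Fin a → ℤ) →+ ℤ :=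
    { toFun := fun κ => ∑ k, κ k
      map_zero' := by simp
      map_add' := fun κ κ' => by simp [Finset.sum_add_distrib] }
  have h : rFactor a ∈ AddMonoidAlgebra.gradeBy ℤ s 0 := by
    refine Finset.prod_induction _ (· ∈ _) (fun p q hp hq => ?_) ?_ fun k _ =>
      Finset.prod_induction _ (· ∈ _) (fun p q hp hq => ?_) ?_ fun l _ => ?_
    any_goals exact SetLike.GradedOne.one_mem
    any_goals
      rw [← add_zero (0 : ℤ)]
      exact SetLike.GradedMul.mul_mem hp hq
    refine Submodule.sub_mem _ SetLike.GradedOne.one_mem ?_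
    convert AddMonoidAlgebra.single_mem_gradeBy s (Pi.single l 1 - Pi.single k 1) (1 : ℤ) using 2
    simp [s]
  exact (AddMonoidAlgebra.mem_gradeBy_iff _ _ _ _).1 h hκ

/-- `R(U)` as a product of the factors `1 - u_k / u_l` after inverting the variables. -/
theorem sum_rFactor_smul_single {i : Q₀} (hα : ∀ j, j ≠ i → α j = 0) :
    ∑ κ ∈ (rFactor (α i)).coeff.support, (rFactor (α i)).coeff κ •
      (single (-(Pi.single i κ : Weight α)) 1 : AddMonoidAlgebra LaurentQT (Weight α)) =
    vandInv LaurentQT α := by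
  let ψ : AddMonoidAlgebra ℤ (Fin (α i) → ℤ) →ₐ[ℤ] AddMonoidAlgebra LaurentQT (Weight α) :=
    AddMonoidAlgebra.lift ℤ _ _
      { toFun := fun κ => single (-(Pi.single i κ.toAdd : Weight α)) 1
        map_one' := by simp [AddMonoidAlgebra.one_def]
        map_mul' := fun κ κ' => by
          rw [AddMonoidAlgebra.single_mul_single, one_mul, toAdd_mul, Pi.single_add, neg_add] }
  have hψ : ∀ κ, ψ (single κ 1) = single (-(Pi.single i κ : Weight α)) 1 := fun κ => by
    simp [ψ]
  have h1 : ψ (rFactor (α i)) = ∑ κ ∈ (rFactor (α i)).coeff.support, (rFactor (α i)).coeff κ •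
      (single (-(Pi.single i κ : Weight α)) 1 : AddMonoidAlgebra LaurentQT (Weight α)) := by
    rw [AddMonoidAlgebra.lift_apply]
    rfl
  rw [← h1, vandInv, Finset.prod_eq_single i, rFactor, map_prod]
  · refine Finset.prod_congr rfl fun k _ => ?_
    rw [map_prod]
    refine Finset.prod_congr rfl fun l _ => ?_
    rw [map_sub, map_one, hψ]
    congr 2
    rw [Pi.single_sub, neg_sub]
    rfl
  · intro j _ hj
    have : IsEmpty (Fin (α j)) := by rw [hα j hj]; exact Fin.isEmpty
    exact Finset.prod_of_isEmpty _
  · simp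

variable [Quiver.{v} Q₀] [∀ i j : Q₀, Fintype (i ⟶ j)]

/-- All Vandermonde factors merge, leaving the Vandermonde product of `U + V` applied to the kernel
alone. -/
theorem current_schurFun {i : Q₀} (hα : ∀ j, j ≠ i → α j = 0) (μ : Weight α)
    {ξ : Q₀ → YoungDiagram} (hξ : ∀ j, (ξ j).colLen 0 ≤ β j) :
    current i (α i) (μ i) (schurFun ξ) =
      hsum (α + β) (size μ + size (youngWeight β ξ).1)
        (act (single (inclU α β μ + inclV α β (youngWeight β ξ).1) 1 *
          vandInv LaurentQT (α + β)) (theta i (kernelSeries β (α i) i))) := by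
  set q := single (youngWeight β ξ).1 1 * vandInv LaurentQT β with hq
  set P := MvPowerSeries.C q * MvPowerSeries.map (evInv β).toRingHom (skewSeries i (α i)) with hP
  have hqmem : q ∈ AddMonoidAlgebra.gradeBy LaurentQT (size (ν := β))
      (size (youngWeight β ξ).1) := by
    rw [← add_zero (size (youngWeight β ξ).1)]
    exact SetLike.GradedMul.mul_mem (AddMonoidAlgebra.single_mem_gradeBy _ _ _)
      (vandInv_mem_gradeBy β)
  have hPmem : ∀ δ, MvPowerSeries.coeff δ P ∈ AddMonoidAlgebra.gradeBy LaurentQT (size (ν := β))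
      (size (youngWeight β ξ).1 - ∑ k, (δ k : ℤ)) := by
    intro δ
    rw [hP, MvPowerSeries.coeff_C_mul, sub_eq_add_neg, map_evInv_skewSeries]
    exact SetLike.GradedMul.mul_mem hqmem
      ((IsBalanced.prod _ fun _ _ => IsBalanced.prod _ fun _ _ =>
      isBalanced_dualFactor _ _ _ _).mul (isBalanced_kernelSeries i) δ)
  have hskew : ∀ δ, perp (MvPowerSeries.coeff δ (skewSeries i (α i))) (schurFun ξ) =
      hlin β (MvPowerSeries.coeff δ P) := by
    intro δ
    rw [← schurZ_youngWeight hξ, schurZ_eq_hlin, perp_hlin, hP, MvPowerSeries.coeff_C_mul,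
      MvPowerSeries.coeff_map]
    rfl
  have hθ : theta i P = act (inclAlgV α β q * ∏ j, ∏ k, ∏ l, (1 - single (ratio α β j j k l) 1))
      (theta i (kernelSeries β (α i) i)) := by
    rw [hP, theta_C_mul, map_evInv_skewSeries, theta_prod_dualFactor_mul,
      ← Module.End.mul_apply, ← map_mul act, Finset.prod_eq_single i]
    · intro j _ hj
      have : IsEmpty (Fin (α j)) := by rw [hα j hj]; exact Fin.isEmpty
      exact Finset.prod_of_isEmpty _
    · simp
  -- The exponent `κ` from `R(U)` is subtracted from the index of `h`, so `R(U)` contributes with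
  -- inverted variables. It has degree zero and does not change the size.
  have hterm : ∀ κ ∈ (rFactor (α i)).coeff.support,
      ∑ᶠ δ : Fin (α i) →₀ ℕ, (∏ k, hfun i (μ i k - κ k + (δ k : ℤ))) *
        perp (MvPowerSeries.coeff δ (skewSeries i (α i))) (schurFun ξ) =
      hsum (α + β) (size μ + size (youngWeight β ξ).1)
        (act (single (inclU α β (μ - Pi.single i κ)) 1) (theta i P)) := by
    intro κ hκ
    have h1 : size (μ - Pi.single i κ) = size μ := by
      rw [map_sub, size_eq_of_forall_ne hα (Pi.single i κ), Pi.single_eq_same,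
        sum_eq_zero_of_mem_support_rFactor hκ, sub_zero]
    rw [← h1, ← finsum_hfun_mul_hlin hα _ _ hPmem]
    simp only [hskew, Pi.sub_apply, Pi.single_eq_same]
  rw [current, Finset.sum_congr rfl fun κ hκ => by rw [hterm κ hκ]]
  have hlin_sum : ∑ κ ∈ (rFactor (α i)).coeff.support, (rFactor (α i)).coeff κ •
      hsum (α + β) (size μ + size (youngWeight β ξ).1)
        (act (single (inclU α β (μ - Pi.single i κ)) 1) (theta i P)) =
      hsum (α + β) (size μ + size (youngWeight β ξ).1)
        (act (∑ κ ∈ (rFactor (α i)).coeff.support, (rFactor (α i)).coeff κ •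
          single (inclU α β (μ - Pi.single i κ)) 1) (theta i P)) := by
    simp only [map_sum, map_zsmul, LinearMap.sum_apply, LinearMap.smul_apply]
  rw [hlin_sum, hθ, ← Module.End.mul_apply, ← map_mul act]
  congr 3
  rw [vandInv_add, hq, ← sum_rFactor_smul_single hα, map_sum, map_mul, inclAlgV_single,
    ← one_mul (1 : LaurentQT), ← AddMonoidAlgebra.single_mul_single, one_mul]
  have h2 : ∑ κ ∈ (rFactor (α i)).coeff.support, (rFactor (α i)).coeff κ •
      (single (inclU α β (μ - Pi.single i κ)) 1 : AddMonoidAlgebra LaurentQT (Weight (α + β))) =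
      single (inclU α β μ) 1 * ∑ κ ∈ (rFactor (α i)).coeff.support,
        inclAlgU α β ((rFactor (α i)).coeff κ • single (-(Pi.single i κ : Weight α)) 1) := by
    rw [Finset.mul_sum]
    refine Finset.sum_congr rfl fun κ _ => ?_
    rw [map_zsmul, mul_smul_comm, inclAlgU_single, AddMonoidAlgebra.single_mul_single, one_mul,
      ← map_add, sub_eq_add_neg]
  rw [h2]
  ring

end Currents

/-! ### The two coefficients as the same signed sum. -/

section Comparison

variable {Q₀ : Type u} [DecidableEq Q₀] [Fintype Q₀] {α β : Q₀ → ℕ}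

omit [DecidableEq Q₀] in
theorem size_eq_zero_of_theta_ne_zero {i : Q₀} (hα : ∀ j, j ≠ i → α j = 0)
    {P : MvPowerSeries (Fin (α i)) (AddMonoidAlgebra LaurentQT (Weight β))} (hP : IsBalanced P)
    {γ : Weight (α + β)} (hγ : theta i P γ ≠ 0) : size γ = 0 := by
  unfold theta at hγ
  split_ifs at hγ with h
  · rw [size_add, size_eq_of_mem_gradeBy (hP _) hγ, size_eq_of_forall_ne hα]
    simp [h]
  · exact absurd rfl hγ

variable [Quiver.{v} Q₀] [∀ i j : Q₀, Fintype (i ⟶ j)]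

theorem exists_isSchurFunExpansion_current {i : Q₀} (hα : ∀ j, j ≠ i → α j = 0) (μ : Weight α)
    {ξ : Q₀ → YoungDiagram} (hξ : ∀ j, (ξ j).colLen 0 ≤ β j) :
    ∃ c, IsSchurFunExpansion (current i (α i) (μ i) (schurFun ξ)) c ∧
      (∀ lam : Q₀ → YoungDiagram, (∀ j, (lam j).colLen 0 ≤ (α + β) j) →
        c lam = ∑ w, sgn w • theta i (kernelSeries β (α i) i)
          (permWeight w ((youngWeight (α + β) lam).1 + rho (α + β)) -
            (rho (α + β) + (inclU α β μ + inclV α β (youngWeight β ξ).1)))) ∧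
      ∀ lam : Q₀ → YoungDiagram, ¬ (∀ j, (lam j).colLen 0 ≤ (α + β) j) → c lam = 0 := by
  classical
  set θ := theta i (kernelSeries β (α i) i)
  set τ := rho (α + β) + (inclU α β μ + inclV α β (youngWeight β ξ).1) with hτ
  let x : Weight (α + β) → LaurentQT := fun κ => ∑ w, sgn w • θ (permWeight w κ - τ)
  let n : ℤ := size μ + size (youngWeight β ξ).1
  let T := (comps (α + β) (n + size (rho (α + β)))).filter IsStrict
  have hsizeτ : size τ = n + size (rho (α + β)) := by
    have h1 : size (inclU α β μ) = size μ := by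
      rw [size_add]
      simp only [inclU_castAdd, inclU_natAdd]
      exact add_eq_left.2 (map_zero size)
    have h2 : size (inclV α β (youngWeight β ξ).1) = size (youngWeight β ξ).1 := by
      rw [size_add]
      simp only [inclV_castAdd, inclV_natAdd]
      exact add_eq_right.2 (map_zero size)
    rw [hτ, map_add, map_add, h1, h2, add_comm]
  have hex : ∀ κ ∈ T, ∃ lam : Q₀ → YoungDiagram, (∀ j, (lam j).colLen 0 ≤ (α + β) j) ∧
      (youngWeight (α + β) lam).1 + rho (α + β) = κ := fun κ hκ => by
    rw [Finset.mem_filter, mem_comps] at hκ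
    exact exists_youngWeight_add_rho_eq hκ.2 hκ.1.1
  choose! L hL hL' using hex
  have hcur : current i (α i) (μ i) (schurFun ξ) = ∑ κ ∈ T, x κ • schurFun (L κ) := by
    -- Trading the Vandermonde product for the alternant of `-ρ` produces the `ρ` in `τ` and the
    -- form required by `hsum_act_alt`.
    have h1 : single (inclU α β μ + inclV α β (youngWeight β ξ).1) 1 *
        vandInv LaurentQT (α + β) = alt LaurentQT (-rho (α + β)) * single τ 1 := by
      rw [alt_neg_rho, mul_right_comm, AddMonoidAlgebra.single_mul_single, one_mul, hτ,
        neg_add_cancel_left]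
    rw [current_schurFun hα μ hξ, h1, map_mul, Module.End.mul_apply, hsum_act_alt]
    refine Finset.sum_congr rfl fun κ hκ => ?_
    congr 1
    · refine Finset.sum_congr rfl fun w _ => ?_
      rw [act_single, one_mul]
    · rw [← schurZ_youngWeight (hL κ hκ)]
      congr 1
      rw [← hL' κ hκ, add_sub_cancel_right]
      rw [hL' κ hκ]
  refine ⟨∑ κ ∈ T, Finsupp.single (L κ) (x κ), ?_, fun lam hlam => ?_, fun lam hlam => ?_⟩
  · rw [IsSchurFunExpansion, hcur, ← Finsupp.sum_finsetSum_index]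
    · exact Finset.sum_congr rfl fun κ _ => (Finsupp.sum_single_index
        (h := fun lam r => r • schurFun lam) (zero_smul LaurentQT (schurFun (L κ)))).symm
    · exact fun _ => zero_smul _ _
    · exact fun _ _ _ => add_smul _ _ _
  · change _ = x _
    set κ₀ := (youngWeight (α + β) lam).1 + rho (α + β) with hκ₀
    rw [Finsupp.finsetSum_apply]
    by_cases hT : κ₀ ∈ T
    · rw [Finset.sum_eq_single κ₀]
      · have : L κ₀ = lam := youngWeight_injOn (hL κ₀ hT) hlam (add_right_cancel (hL' κ₀ hT))
        rw [this, Finsupp.single_eq_same]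
      · intro κ hκ hne
        refine Finsupp.single_eq_of_ne fun h => hne ?_
        rw [← hL' κ hκ, ← h]
      · exact fun h => absurd hT h
    -- If `λ + ρ` has the wrong size it does not occur in the expansion. The signed sum vanishes as
    -- well, because the kernel has total degree zero.
    · have hx : x κ₀ = 0 := by
        refine Finset.sum_eq_zero fun w _ => ?_
        by_contra hne
        have h1 := size_eq_zero_of_theta_ne_zero hα (isBalanced_kernelSeries i)
          (right_ne_zero_of_smul hne)
        rw [map_sub, size_permWeight, hsizeτ, sub_eq_zero] at h1
        refine hT (Finset.mem_filter.2 ⟨mem_comps.2 ⟨fun j l => ?_, h1⟩,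
          isStrict_add_rho (youngWeight (α + β) lam).2⟩)
        exact add_nonneg (Int.natCast_nonneg _) (rho_nonneg j l)
      rw [hx]
      refine Finset.sum_eq_zero fun κ hκ => Finsupp.single_eq_of_ne fun h => hT ?_
      rw [hκ₀, h, hL' κ hκ]
      exact hκ
  · rw [Finsupp.finsetSum_apply]
    refine Finset.sum_eq_zero fun κ hκ => Finsupp.single_eq_of_ne fun h => hlam ?_
    rw [h]
    exact hL κ hκ

/-- Block symmetry of the kernel, degree by degree in `q, t`, lets the monomials `u^κ v^η` stand for
the Schur polynomials. -/
theorem IsSchurPolyExpansion.coeff_eq_of_shuffle {κ : DominantWeight α} {η : DominantWeight β}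
    {C : DominantWeight (α + β) → SeriesQT ℤ}
    (h : IsSchurPolyExpansion
      (shuffle (HahnSeries.C (schurPoly κ)) (HahnSeries.C (schurPoly η))) C)
    (lam : DominantWeight (α + β)) (d : ℤ × ℤ) :
    (C lam).coeff d = ∑ w, sgn w * ((shuffleKernel α β).coeff d).coeff
      (permWeight w (lam.1 + rho (α + β)) - (rho (α + β) + (inclU α β κ.1 + inclV α β η.1))) := by
  rw [h.coeff_eq, shuffle, alt_rho_mul_coeff_demazure, HahnSeries.map_C, HahnSeries.map_C,
    ← map_mul, coeff_C_mul, antisymm_schurPoly_mul_schurPoly _ _ _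
      fun w w' => permRing_coeff_shuffleKernel w w' d, coeff_antisymm]
  refine Finset.sum_congr rfl fun w _ => ?_
  rw [AddMonoidAlgebra.coeff_single_mul_apply, one_mul, neg_add_eq_sub]

/-- The rank `a` is tied to `α i` by an equation so that substitution removes the cast between index
types. Uniqueness of Schur expansions then reduces the claim to the explicit one. -/
theorem coeff_current_eq_coeff_shuffle {i : Q₀} (hα : ∀ j, j ≠ i → α j = 0) {a : ℕ}
    (ha : α i = a) {μ : Fin a → ℤ} {κ : DominantWeight α}
    (hκ : ∀ k, κ.1 i k = μ (Fin.cast ha k)) {ξ : Q₀ → YoungDiagram}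
    (hξ : ∀ j, (ξ j).colLen 0 ≤ β j) {c : (Q₀ → YoungDiagram) →₀ LaurentQT}
    {C : DominantWeight (α + β) → SeriesQT ℤ}
    (hc : IsSchurFunExpansion (current i a μ (schurFun ξ)) c)
    (hC : IsSchurPolyExpansion (shuffle (HahnSeries.C (schurPoly κ))
      (HahnSeries.C (schurPoly (youngWeight β ξ)))) C) :
    (∀ lam : Q₀ → YoungDiagram, (∀ j, (lam j).colLen 0 ≤ (α + β) j) →
      (c lam).toSeries = C (youngWeight (α + β) lam)) ∧
    ∀ lam : Q₀ → YoungDiagram, ¬ (∀ j, (lam j).colLen 0 ≤ (α + β) j) → c lam = 0 := by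
  subst ha
  obtain rfl : κ.1 i = μ := funext hκ
  obtain ⟨c', h1, h2, h3⟩ := exists_isSchurFunExpansion_current hα κ.1 hξ
  obtain rfl := hc.unique h1
  refine ⟨fun lam hlam => ?_, h3⟩
  ext d
  rw [hC.coeff_eq_of_shuffle]
  change (c lam).coeff d = _
  rw [h2 lam hlam, AddMonoidAlgebra.coeff_sum, Finsupp.finsetSum_apply]
  refine Finset.sum_congr rfl fun w _ => ?_
  rw [AddMonoidAlgebra.coeff_smul, Finsupp.smul_apply, smul_eq_mul]
  congr 1
  exact isCompatible_kernel hα _ d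

end Comparison

end

end QuiverCurrents

open QuiverCurrents
theorem proposition5p12 {Q₀ : Type u} [Fintype Q₀] [DecidableEq Q₀] [Quiver.{v} Q₀]
    [∀ i j : Q₀, Fintype (i ⟶ j)] (i : Q₀) (a : ℕ) (ha : 0 < a) (μ : Fin a → ℤ) (hμ : Antitone μ)
    (β : Q₀ → ℕ) (ξ : Q₀ → YoungDiagram) (hξ : ∀ j, (ξ j).colLen 0 ≤ β j) :
    (∃ c, IsSchurFunExpansion (current i a μ (schurFun ξ)) c) ∧
    (∃ C, IsSchurPolyExpansion
      (shuffle (HahnSeries.C (schurPoly (vertexWeight i μ hμ)))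
        (HahnSeries.C (schurPoly (youngWeight β ξ)))) C) ∧
    ∀ c C, IsSchurFunExpansion (current i a μ (schurFun ξ)) c →
      IsSchurPolyExpansion
        (shuffle (HahnSeries.C (schurPoly (vertexWeight i μ hμ)))
          (HahnSeries.C (schurPoly (youngWeight β ξ)))) C →
      (∀ lam : Q₀ → YoungDiagram,
        (∀ j, (lam j).colLen 0 ≤ ((Pi.single i a : Q₀ → ℕ) + β) j) →
          (c lam).toSeries = C (youngWeight (Pi.single i a + β) lam)) ∧
      (∀ lam : Q₀ → YoungDiagram,
        ¬ (∀ j, (lam j).colLen 0 ≤ ((Pi.single i a : Q₀ → ℕ) + β) j) → c lam = 0) := by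
  refine ⟨exists_isSchurFunExpansion _, exists_isSchurPolyExpansion_demazure _, ?_⟩
  intro c C hc hC
  exact coeff_current_eq_coeff_shuffle (α := Pi.single i a) (κ := vertexWeight i μ hμ)
    (fun _ hj => Pi.single_eq_of_ne (M := fun _ => ℕ) hj a)
    (Pi.single_eq_same (M := fun _ => ℕ) i a) (fun _ => dif_pos rfl) hξ hc hC
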